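/- Let $n\ge 3$, let $M$ be a closed (compact, without boundary) smooth $n$-dimensional manifold and let $g$ be a smooth Riemannian metric on $M$. Suppose that $(M,g)$ is a gradient shrinking Ricci soliton, that is, there are a smooth function $f:M\to\mathbb{R}$ and a constant $\rho>0$ with $$R_{ij}+\nabla_i\nabla_j f=\rho\, g_{ij}\quad\text{on } M,$$ where $R_{ij}$ is the Ricci tensor of $g$ and $\nabla$ its Levi-Civita connection. Suppose moreover that $(M,g)$ is locally conformally flat, that is, around every point of $M$ there are local coordinates in which $g_{ij}=e^{2\varphi}\delta_{ij}$ for some smooth function $\varphi$. Then $(M,g)$ is Einstein, i.e. there is a constant $c$ with $R_{ij}=c\,g_{ij}$ on $M$. Moreover, $(M,g)$ has constant sectional curvature, i.e. there is a constant $\kappa$ such that every tangent plane at every point of $M$ has sectional curvature $\kappa$. -/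

import Mathlib

open Bundle
open scoped Manifold ContDiff

noncomputable section

namespace RicciSoliton

/-! ### Curvature of a metric given by its coefficients on an open subset of `ℝⁿ` -/

/-- The `i`-th partial derivative `∂ᵢ u`. -/
def partialDeriv {n : ℕ} (i : Fin n) (u : EuclideanSpace ℝ (Fin n) → ℝ)
    (y : EuclideanSpace ℝ (Fin n)) : ℝ :=
  fderiv ℝ u y (EuclideanSpace.single i 1)

/-- The Christoffel symbols
`Γᵏᵢⱼ = ½ gᵏˡ (∂ᵢ gₗⱼ + ∂ⱼ gᵢₗ - ∂ₗ gᵢⱼ)` of the metric with coefficients `G`. -/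
def christoffel {n : ℕ} (G : EuclideanSpace ℝ (Fin n) → Matrix (Fin n) (Fin n) ℝ)
    (k i j : Fin n) (y : EuclideanSpace ℝ (Fin n)) : ℝ :=
  (1 / 2 : ℝ) * ∑ l, (G y)⁻¹ k l *
    (partialDeriv i (fun z => G z l j) y + partialDeriv j (fun z => G z i l) y
      - partialDeriv l (fun z => G z i j) y)

/-- The coefficients `R(∂ᵢ, ∂ⱼ) ∂ₖ = ∑ₗ Rᵢⱼₖˡ ∂ₗ` of the curvature operator
`R(X, Y) = ∇_X ∇_Y - ∇_Y ∇_X - ∇_[X, Y]` of the Levi-Civita connection: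
`Rᵢⱼₖˡ = ∂ᵢ Γˡⱼₖ - ∂ⱼ Γˡᵢₖ + Γᵖⱼₖ Γˡᵢₚ - Γᵖᵢₖ Γˡⱼₚ`. -/
def curvatureUp {n : ℕ} (G : EuclideanSpace ℝ (Fin n) → Matrix (Fin n) (Fin n) ℝ)
    (i j k l : Fin n) (y : EuclideanSpace ℝ (Fin n)) : ℝ :=
  partialDeriv i (christoffel G l j k) y - partialDeriv j (christoffel G l i k) y
    + ∑ p, (christoffel G p j k y * christoffel G l i p y
        - christoffel G p i k y * christoffel G l j p y)

/-- The Riemann curvature tensor `Rᵢⱼₖₗ = g(R(∂ᵢ, ∂ⱼ) ∂ₗ, ∂ₖ)`; with this sign convention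
`Rᵢⱼₖₗ = gᵢₖ gⱼₗ - gᵢₗ gⱼₖ` on the unit sphere. -/
def riemann {n : ℕ} (G : EuclideanSpace ℝ (Fin n) → Matrix (Fin n) (Fin n) ℝ)
    (i j k l : Fin n) (y : EuclideanSpace ℝ (Fin n)) : ℝ :=
  ∑ m, G y k m * curvatureUp G i j l m y

/-- The Ricci tensor `Rⱼₗ = ∑ᵢₖ gⁱᵏ Rᵢⱼₖₗ`. -/
def ricci {n : ℕ} (G : EuclideanSpace ℝ (Fin n) → Matrix (Fin n) (Fin n) ℝ)
    (j l : Fin n) (y : EuclideanSpace ℝ (Fin n)) : ℝ :=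
  ∑ i, ∑ k, (G y)⁻¹ i k * riemann G i j k l y

/-- The Hessian `∇ᵢ∇ⱼ u = ∂ᵢ ∂ⱼ u - Γᵏᵢⱼ ∂ₖ u`. -/
def hessian {n : ℕ} (G : EuclideanSpace ℝ (Fin n) → Matrix (Fin n) (Fin n) ℝ)
    (u : EuclideanSpace ℝ (Fin n) → ℝ) (i j : Fin n) (y : EuclideanSpace ℝ (Fin n)) : ℝ :=
  partialDeriv i (partialDeriv j u) y - ∑ k, christoffel G k i j y * partialDeriv k u y

/-- The scalar product `g(v, w) = ∑ᵢⱼ gᵢⱼ vⁱ wʲ` at the point `y`. -/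
def pairing {n : ℕ} (G : EuclideanSpace ℝ (Fin n) → Matrix (Fin n) (Fin n) ℝ)
    (y v w : EuclideanSpace ℝ (Fin n)) : ℝ :=
  ∑ i, ∑ j, G y i j * v i * w j

/-- The sectional curvature
`K(v, w) = Rm(v, w, v, w) / (g(v, v) g(w, w) - g(v, w)²)` of the plane at `y` spanned by the
linearly independent vectors `v` and `w`. -/
def sectionalCurvature {n : ℕ} (G : EuclideanSpace ℝ (Fin n) → Matrix (Fin n) (Fin n) ℝ)
    (y v w : EuclideanSpace ℝ (Fin n)) : ℝ :=
  (∑ i, ∑ j, ∑ k, ∑ l, riemann G i j k l y * v i * w j * v k * w l) /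
    (pairing G y v v * pairing G y w w - pairing G y v w ^ 2)

/-! ### Riemannian manifolds -/

section Manifold

variable {n : ℕ} {M : Type*} [TopologicalSpace M] [ChartedSpace (EuclideanSpace ℝ (Fin n)) M]
  [IsManifold (𝓡 n) ∞ M]

/-- The coefficients `gᵢⱼ = g(∂ᵢ, ∂ⱼ)` of the metric `g` in the local coordinates given by the
chart `e`, as functions on `e.target`; `∂ᵢ` is the image of the `i`-th standard basis vector under
the differential of `e.symm`. -/
def metricCoeff
    (g : ContMDiffRiemannianMetric (𝓡 n) ∞ (EuclideanSpace ℝ (Fin n))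
      (fun x : M => TangentSpace (𝓡 n) x))
    (e : OpenPartialHomeomorph M (EuclideanSpace ℝ (Fin n)))
    (y : EuclideanSpace ℝ (Fin n)) : Matrix (Fin n) (Fin n) ℝ :=
  Matrix.of fun i j =>
    g.inner (e.symm y)
      (mfderiv (𝓡 n) (𝓡 n) e.symm y (EuclideanSpace.single i (1 : ℝ)))
      (mfderiv (𝓡 n) (𝓡 n) e.symm y (EuclideanSpace.single j (1 : ℝ)))

/-- `(M, g)` is a gradient shrinking Ricci soliton: there are a smooth function `f` on `M` and a
constant `ρ > 0` with `Rᵢⱼ + ∇ᵢ∇ⱼ f = ρ gᵢⱼ` in all local coordinates. -/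
def IsGradientShrinkingSoliton
    (g : ContMDiffRiemannianMetric (𝓡 n) ∞ (EuclideanSpace ℝ (Fin n))
      (fun x : M => TangentSpace (𝓡 n) x)) : Prop :=
  ∃ f : M → ℝ, ContMDiff (𝓡 n) 𝓘(ℝ, ℝ) ∞ f ∧ ∃ ρ : ℝ, 0 < ρ ∧
    ∀ e ∈ IsManifold.maximalAtlas (𝓡 n) ∞ M, ∀ y ∈ e.target, ∀ i j : Fin n,
      ricci (metricCoeff g e) i j y + hessian (metricCoeff g e) (f ∘ e.symm) i j y
        = ρ * metricCoeff g e y i j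

/-- `(M, g)` is locally conformally flat: around every point there are local coordinates in which
`gᵢⱼ = exp(2φ) δᵢⱼ` for a smooth function `φ`. -/
def IsLocallyConformallyFlat
    (g : ContMDiffRiemannianMetric (𝓡 n) ∞ (EuclideanSpace ℝ (Fin n))
      (fun x : M => TangentSpace (𝓡 n) x)) : Prop :=
  ∀ x : M, ∃ e ∈ IsManifold.maximalAtlas (𝓡 n) ∞ M, x ∈ e.source ∧
    ∃ φ : EuclideanSpace ℝ (Fin n) → ℝ, ContDiffOn ℝ ∞ φ e.target ∧
      ∀ y ∈ e.target, metricCoeff g e y =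
        Real.exp (2 * φ y) • (1 : Matrix (Fin n) (Fin n) ℝ)

/-- `(M, g)` is Einstein: `Rᵢⱼ = c gᵢⱼ` in all local coordinates, for a constant `c`. -/
def IsEinstein
    (g : ContMDiffRiemannianMetric (𝓡 n) ∞ (EuclideanSpace ℝ (Fin n))
      (fun x : M => TangentSpace (𝓡 n) x)) : Prop :=
  ∃ c : ℝ, ∀ e ∈ IsManifold.maximalAtlas (𝓡 n) ∞ M, ∀ y ∈ e.target, ∀ i j : Fin n,
    ricci (metricCoeff g e) i j y = c * metricCoeff g e y i j

/-- `(M, g)` has constant sectional curvature: all tangent planes, at all points, have the same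
sectional curvature `κ`. -/
def HasConstantSectionalCurvature
    (g : ContMDiffRiemannianMetric (𝓡 n) ∞ (EuclideanSpace ℝ (Fin n))
      (fun x : M => TangentSpace (𝓡 n) x)) : Prop :=
  ∃ κ : ℝ, ∀ e ∈ IsManifold.maximalAtlas (𝓡 n) ∞ M, ∀ y ∈ e.target,
    ∀ v w : EuclideanSpace ℝ (Fin n), LinearIndependent ℝ ![v, w] →
      sectionalCurvature (metricCoeff g e) y v w = κ

end Manifold

end RicciSoliton

end

/-! Local conformal flatness leaves the Ricci tensor as the only curvature. In a chart with g =
e^{2φ}δ the Riemann tensor is the product of the metric with the Schouten tensor (`riemann_eq`), and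
the Cotton tensor vanishes (`partialDeriv_schouten_sub`). Commuting the third derivatives of f in
the soliton equation then yields an algebraic constraint (`schouten_mul_sub`): where ∇f ≠ 0, Ric has
an eigenvalue r along ∇f and the single eigenvalue (R - r)/(n - 1) on the complement
(`exists_radial`). Since ∇R = 2 Ric(∇f), the gradients of R, r and |∇f|² are all multiples of ∇f,
and the analysis there becomes ODE calculus in f (`HasSlope`).

The maximum principle applied to R - ε e^f gives R > 0 (`scalar_pos`). The pinching function is Y =
(n r/R - 1)²/(n - 1)² where ∇f ≠ 0; it satisfies LY ≥ 0 for Lu = Δu - ⟨∇f, ∇u⟩ + 2⟨∇ log R, ∇u⟩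
(`driftLaplacian_pinching`, `le_driftLaplacian_pinching`). At a positive maximum the inequality
forces r = 0 or ∇f = 0, with ∇R = 0 and the value Y = 1/(n - 1)² of the cylinder in either case. The
cylinder is excluded by compactness, without a strong maximum principle: B = e^f R^{-(n-1)/2}
satisfies LB = ρB > 0 at such points (`driftLaplacian_barrier_pos`), so for small ε > 0 the function
Y + εB would attain its maximum where L(Y + εB) > 0. Hence Y = 0 (`pinching_eq_zero`).

With Y = 0 one has r = R/n wherever ∇f ≠ 0, whereas the ODE for r/R gives that quotient the slope (n
- 2)/n² ≠ 0. So ∇f = 0 everywhere, Ric = ρg, and the Riemann tensor is that of constant curvature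
ρ/(n - 1). Connectedness plays no role, because the constant ρ is the same on every component.

The conclusions concern every chart of the maximal atlas, while the analysis takes place in
conformally flat charts. The two are linked by computing connection, curvature and Hessian for a
pullback of e^{2φ}δ under an arbitrary local diffeomorphism ψ (`IsConformalPullback`), with ψ the
transition map. -/

noncomputable section

namespace RicciSoliton

open Filter Topology Finset

local notation "𝔡" => partialDeriv

/-! ### Partial derivatives -/

section Calculus

variable {n : ℕ} {u v : EuclideanSpace ℝ (Fin n) → ℝ} {y : EuclideanSpace ℝ (Fin n)} {i j : Fin n}

theorem partialDeriv_congr (h : u =ᶠ[𝓝 y] v) : 𝔡 i u y = 𝔡 i v y := by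
  simp only [partialDeriv, h.fderiv_eq]

theorem partialDeriv_eventuallyEq (h : u =ᶠ[𝓝 y] v) : 𝔡 i u =ᶠ[𝓝 y] 𝔡 i v :=
  h.eventuallyEq_nhds.mono fun _ hz => partialDeriv_congr hz

theorem partialDeriv_congr_on {U : Set (EuclideanSpace ℝ (Fin n))} (hU : IsOpen U)
    (h : ∀ z ∈ U, u z = v z) (hy : y ∈ U) : 𝔡 i u y = 𝔡 i v y :=
  partialDeriv_congr (eventually_of_mem (hU.mem_nhds hy) h)

theorem partialDeriv_const (c : ℝ) : 𝔡 i (fun _ => c) y = 0 := by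
  simp [partialDeriv]

theorem partialDeriv_add (hu : DifferentiableAt ℝ u y) (hv : DifferentiableAt ℝ v y) :
    𝔡 i (fun z => u z + v z) y = 𝔡 i u y + 𝔡 i v y := by
  simp [partialDeriv, fderiv_fun_add hu hv]

theorem partialDeriv_sub (hu : DifferentiableAt ℝ u y) (hv : DifferentiableAt ℝ v y) :
    𝔡 i (fun z => u z - v z) y = 𝔡 i u y - 𝔡 i v y := by
  simp [partialDeriv, fderiv_fun_sub hu hv]

theorem partialDeriv_neg : 𝔡 i (fun z => - u z) y = - 𝔡 i u y := by
  simp [partialDeriv, fderiv_fun_neg]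

theorem partialDeriv_mul (hu : DifferentiableAt ℝ u y) (hv : DifferentiableAt ℝ v y) :
    𝔡 i (fun z => u z * v z) y = 𝔡 i u y * v y + u y * 𝔡 i v y := by
  simp [partialDeriv, fderiv_fun_mul hu hv]; ring

theorem partialDeriv_const_mul (c : ℝ) (hu : DifferentiableAt ℝ u y) :
    𝔡 i (fun z => c * u z) y = c * 𝔡 i u y := by
  simp [partialDeriv, fderiv_const_mul hu]

theorem partialDeriv_mul_const (c : ℝ) (hu : DifferentiableAt ℝ u y) :
    𝔡 i (fun z => u z * c) y = 𝔡 i u y * c := by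
  simp [partialDeriv, fderiv_mul_const hu]; ring

theorem partialDeriv_sum {ι : Type*} (s : Finset ι) {w : ι → EuclideanSpace ℝ (Fin n) → ℝ}
    (hw : ∀ a ∈ s, DifferentiableAt ℝ (w a) y) :
    𝔡 i (fun z => ∑ a ∈ s, w a z) y = ∑ a ∈ s, 𝔡 i (w a) y := by
  simp [partialDeriv, fderiv_fun_sum hw]

theorem partialDeriv_comp_real {θ : ℝ → ℝ} {θ' : ℝ} (hθ : HasDerivAt θ θ' (u y))
    (hu : DifferentiableAt ℝ u y) : 𝔡 i (fun z => θ (u z)) y = θ' * 𝔡 i u y := by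
  have := (hθ.comp_hasFDerivAt y hu.hasFDerivAt).fderiv
  simp only [partialDeriv]
  rw [show (fun z => θ (u z)) = θ ∘ u from rfl, this]
  simp

theorem partialDeriv_exp (hu : DifferentiableAt ℝ u y) :
    𝔡 i (fun z => Real.exp (u z)) y = Real.exp (u y) * 𝔡 i u y :=
  partialDeriv_comp_real (Real.hasDerivAt_exp _) hu

theorem contDiffAt_partialDeriv (hu : ContDiffAt ℝ ∞ u y) : ContDiffAt ℝ ∞ (𝔡 i u) y := by
  have : ContDiffAt ℝ ∞ (fderiv ℝ u) y := hu.fderiv_right (by simp)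
  exact this.clm_apply contDiffAt_const

theorem partialDeriv_comm (hu : ContDiffAt ℝ ∞ u y) :
    𝔡 i (𝔡 j u) y = 𝔡 j (𝔡 i u) y := by
  have h2 : ContDiffAt ℝ ∞ (fderiv ℝ u) y := hu.fderiv_right (by simp)
  have hd : DifferentiableAt ℝ (fderiv ℝ u) y := h2.differentiableAt (by simp)
  have key : ∀ a b : Fin n, 𝔡 a (𝔡 b u) y =
      fderiv ℝ (fderiv ℝ u) y (EuclideanSpace.single a 1) (EuclideanSpace.single b 1) := by
    intro a b
    simp only [partialDeriv]
    rw [show RicciSoliton.partialDeriv b u = fun z => fderiv ℝ u z (EuclideanSpace.single b 1)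
      from rfl, fderiv_clm_apply hd (by fun_prop)]
    simp
  have hs : IsSymmSndFDerivAt ℝ u y := hu.isSymmSndFDerivAt (by simp; exact WithTop.coe_le_coe.2 (le_top : (2 : ℕ∞) ≤ ⊤))
  rw [key, key, hs.eq]

theorem fderiv_apply_eq_sum (w : EuclideanSpace ℝ (Fin n)) :
    fderiv ℝ u y w = ∑ i, w i * 𝔡 i u y := by
  have : w = ∑ i, w i • EuclideanSpace.single i (1 : ℝ) := by
    ext k; simp [Finset.sum_apply, Pi.single_apply]
  conv_lhs => rw [this]
  simp [partialDeriv]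

theorem partialDeriv_comp {ψ : EuclideanSpace ℝ (Fin n) → EuclideanSpace ℝ (Fin n)}
    (hu : DifferentiableAt ℝ u (ψ y)) (hψ : DifferentiableAt ℝ ψ y) :
    𝔡 i (fun z => u (ψ z)) y = ∑ a, 𝔡 a u (ψ y) * 𝔡 i (fun z => ψ z a) y := by
  have h1 : ∀ a, 𝔡 i (fun z => ψ z a) y = (fderiv ℝ ψ y (EuclideanSpace.single i 1)) a := by
    intro a
    have := ((EuclideanSpace.proj (𝕜 := ℝ) a).hasFDerivAt.comp y hψ.hasFDerivAt).fderiv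
    simp only [partialDeriv]
    rw [show (fun z => ψ z a) = (EuclideanSpace.proj (𝕜 := ℝ) a) ∘ ψ from rfl, this]
    simp
  have h2 : 𝔡 i (fun z => u (ψ z)) y = fderiv ℝ u (ψ y) (fderiv ℝ ψ y (EuclideanSpace.single i 1)) := by
    simp only [partialDeriv]
    rw [show (fun z => u (ψ z)) = u ∘ ψ from rfl, fderiv_comp y hu hψ]
    simp
  rw [h2, fderiv_apply_eq_sum]
  exact sum_congr rfl fun a _ => by rw [h1, mul_comm]

/-- At a local maximum the gradient vanishes. -/
theorem partialDeriv_eq_zero_of_isLocalMax (h : IsLocalMax u y) : 𝔡 i u y = 0 := by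
  simp [partialDeriv, h.fderiv_eq_zero]

/-- At a local maximum the pure second derivatives are nonpositive. -/
theorem partialDeriv_partialDeriv_nonpos_of_isLocalMax (h : IsLocalMax u y)
    (hu : ContDiffAt ℝ ∞ u y) : 𝔡 i (𝔡 i u) y ≤ 0 := by
  set ℓ : ℝ → EuclideanSpace ℝ (Fin n) := fun s => y + s • EuclideanSpace.single i (1 : ℝ) with hℓ
  have hℓ0 : ℓ 0 = y := by simp [hℓ]
  have hℓd : ∀ s, HasDerivAt ℓ (EuclideanSpace.single i (1 : ℝ)) s := fun s => by
    have := ((hasDerivAt_id s).smul_const (EuclideanSpace.single i (1 : ℝ))).const_add y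
    rw [one_smul] at this
    exact this
  have hℓc : Tendsto ℓ (𝓝 0) (𝓝 y) := by
    have := (hℓd 0).continuousAt.tendsto; rwa [hℓ0] at this
  have hcomp : ∀ (w : EuclideanSpace ℝ (Fin n) → ℝ) s, DifferentiableAt ℝ w (ℓ s) →
      HasDerivAt (fun s => w (ℓ s)) (𝔡 i w (ℓ s)) s := fun w s hw => by
    exact hw.hasFDerivAt.comp_hasDerivAt s (hℓd s)
  have hev : ∀ᶠ z in 𝓝 y, DifferentiableAt ℝ u z := by
    have := (hu.of_le (m := 1) (WithTop.coe_le_coe.2 (le_top : (1 : ℕ∞) ≤ ⊤))).eventually (by simp)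
    exact this.mono fun _ hz => hz.differentiableAt (by simp)
  have h1 : deriv (fun s => u (ℓ s)) =ᶠ[𝓝 0] fun s => 𝔡 i u (ℓ s) :=
    (hℓc.eventually hev).mono fun s hs => (hcomp u s hs).deriv
  have hd2 : DifferentiableAt ℝ (𝔡 i u) (ℓ 0) := by
    rw [hℓ0]; exact (contDiffAt_partialDeriv hu).differentiableAt (by simp)
  have h2 : deriv (deriv (fun s => u (ℓ s))) 0 = 𝔡 i (𝔡 i u) y := by
    rw [h1.deriv_eq, (hcomp _ 0 hd2).deriv, hℓ0]
  have h0 : deriv (fun s => u (ℓ s)) 0 = 0 := by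
    rw [h1.eq_of_nhds, hℓ0]; exact partialDeriv_eq_zero_of_isLocalMax h
  have hmax : IsLocalMax (fun s => u (ℓ s)) 0 := by
    have := hℓc.eventually h
    simpa [IsLocalMax, IsMaxFilter, hℓ0] using this
  -- A positive second derivative would make 0 a local minimum along the line as well. The
  -- restriction would then be constant near 0 and its second derivative would vanish.
  by_contra hpos
  push Not at hpos
  have hcont : ContinuousAt (fun s => u (ℓ s)) 0 :=
    (hcomp u 0 (by rw [hℓ0]; exact hu.differentiableAt (by simp))).continuousAt
  have hmin : IsLocalMin (fun s => u (ℓ s)) 0 :=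
    isLocalMin_of_deriv_deriv_pos (by rw [h2]; exact hpos) h0 hcont
  have hconst : (fun s => u (ℓ s)) =ᶠ[𝓝 0] fun _ => u (ℓ 0) := by
    filter_upwards [hmax, hmin] with s hs1 hs2 using le_antisymm hs1 hs2
  have h3 : deriv (deriv (fun s => u (ℓ s))) 0 = 0 := by
    rw [hconst.deriv.deriv_eq]; simp
  rw [h3] at h2
  linarith

end Calculus

/-! ### Pullbacks of conformally flat metrics -/

section MatrixInverse

variable {n : ℕ} {M : EuclideanSpace ℝ (Fin n) → Matrix (Fin n) (Fin n) ℝ}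
  {z : EuclideanSpace ℝ (Fin n)}

theorem contDiffAt_det (hM : ∀ i j, ContDiffAt ℝ ∞ (fun w => M w i j) z) :
    ContDiffAt ℝ ∞ (fun w => (M w).det) z := by
  simp only [Matrix.det_apply]
  exact ContDiffAt.sum fun σ _ => (contDiffAt_prod fun i _ => hM (σ i) i).const_smul _

theorem contDiffAt_inv (hM : ∀ i j, ContDiffAt ℝ ∞ (fun w => M w i j) z)
    (hdet : IsUnit (M z).det) (i j : Fin n) : ContDiffAt ℝ ∞ (fun w => (M w)⁻¹ i j) z := by
  simp only [Matrix.inv_def, Ring.inverse_eq_inv', Matrix.smul_apply, smul_eq_mul,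
    Matrix.adjugate_apply]
  refine ((contDiffAt_det hM).inv hdet.ne_zero).mul (contDiffAt_det fun p q => ?_)
  simp only [Matrix.updateRow_apply]
  split_ifs
  · exact contDiffAt_const
  · exact hM p q

end MatrixInverse

/-! ### Schouten tensor, Ricci tensor and Hessian of e^{2φ}δ -/

section Tensors

variable {n : ℕ}

/-- The Kronecker delta. -/
def kron (i j : Fin n) : ℝ := if i = j then 1 else 0

theorem kron_comm (i j : Fin n) : kron i j = kron j i := by simp [kron, eq_comm]

@[simp] theorem kron_self (i : Fin n) : kron i i = 1 := by simp [kron]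

@[simp] theorem sum_kron_mul (i : Fin n) (u : Fin n → ℝ) : ∑ l, kron i l * u l = u i := by
  simp [kron]

@[simp] theorem sum_kron_mul' (i : Fin n) (u : Fin n → ℝ) : ∑ l, kron l i * u l = u i := by
  simp [kron]

/-- The Schouten tensor of the metric `exp (2 φ) δ`. -/
def schouten (φ : EuclideanSpace ℝ (Fin n) → ℝ) (i j : Fin n) (y : EuclideanSpace ℝ (Fin n)) : ℝ :=
  - 𝔡 i (𝔡 j φ) y + 𝔡 i φ y * 𝔡 j φ y - (1 / 2 : ℝ) * (∑ d, 𝔡 d φ y ^ 2) * kron i j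

/-- The trace of the Schouten tensor of `exp (2 φ) δ` with respect to `δ`. -/
def schoutenTrace (φ : EuclideanSpace ℝ (Fin n) → ℝ) (y : EuclideanSpace ℝ (Fin n)) : ℝ :=
  ∑ i, schouten φ i i y

/-- The Ricci tensor of the metric `exp (2 φ) δ`. -/
def flatRicci (φ : EuclideanSpace ℝ (Fin n) → ℝ) (i j : Fin n) (y : EuclideanSpace ℝ (Fin n)) : ℝ :=
  (n - 2) * schouten φ i j y + schoutenTrace φ y * kron i j

/-- The Hessian of `u` for the metric `exp (2 φ) δ`. -/
def flatHessian (φ u : EuclideanSpace ℝ (Fin n) → ℝ) (i j : Fin n)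
    (y : EuclideanSpace ℝ (Fin n)) : ℝ :=
  𝔡 i (𝔡 j u) y - 𝔡 i φ y * 𝔡 j u y - 𝔡 j φ y * 𝔡 i u y + (∑ d, 𝔡 d φ y * 𝔡 d u y) * kron i j

end Tensors

/-! ### Connection, curvature and Hessian of a pulled back conformally flat metric -/

section Pullback

variable {n : ℕ} {φ : EuclideanSpace ℝ (Fin n) → ℝ}
  {ψ : EuclideanSpace ℝ (Fin n) → EuclideanSpace ℝ (Fin n)}
  {G : EuclideanSpace ℝ (Fin n) → Matrix (Fin n) (Fin n) ℝ} {S : Set (EuclideanSpace ℝ (Fin n))}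

/-- The Jacobian matrix of `ψ`. -/
def jac (ψ : EuclideanSpace ℝ (Fin n) → EuclideanSpace ℝ (Fin n)) (a i : Fin n)
    (z : EuclideanSpace ℝ (Fin n)) : ℝ := 𝔡 i (fun w => ψ w a) z

/-- On `S`, the coefficients `G` are those of the pullback under the local diffeomorphism `ψ` of
the conformally flat metric `exp (2 φ) δ`. -/
structure IsConformalPullback (φ : EuclideanSpace ℝ (Fin n) → ℝ)
    (ψ : EuclideanSpace ℝ (Fin n) → EuclideanSpace ℝ (Fin n))
    (G : EuclideanSpace ℝ (Fin n) → Matrix (Fin n) (Fin n) ℝ)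
    (S : Set (EuclideanSpace ℝ (Fin n))) : Prop where
  isOpen : IsOpen S
  smooth_map : ∀ z ∈ S, ContDiffAt ℝ ∞ ψ z
  smooth_factor : ∀ z ∈ S, ContDiffAt ℝ ∞ φ (ψ z)
  metric_eq : ∀ z ∈ S, ∀ i j,
    G z i j = Real.exp (2 * φ (ψ z)) * ∑ a, jac ψ a i z * jac ψ a j z
  isUnit_det : ∀ z ∈ S, IsUnit (Matrix.of fun a i => jac ψ a i z).det

namespace IsConformalPullback

variable (h : IsConformalPullback φ ψ G S) {z : EuclideanSpace ℝ (Fin n)} (hz : z ∈ S)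
include h hz

theorem contDiffAt_coord (a : Fin n) : ContDiffAt ℝ ∞ (fun w => ψ w a) z := by
  have := h.smooth_map z hz
  exact (contDiffAt_euclidean.1 this) a

theorem contDiffAt_jac (a i : Fin n) : ContDiffAt ℝ ∞ (jac ψ a i) z :=
  contDiffAt_partialDeriv (h.contDiffAt_coord hz a)

theorem jac_comm (a i j : Fin n) : 𝔡 i (jac ψ a j) z = 𝔡 j (jac ψ a i) z :=
  partialDeriv_comm (h.contDiffAt_coord hz a)

theorem contDiffAt_comp {u : EuclideanSpace ℝ (Fin n) → ℝ} (hu : ContDiffAt ℝ ∞ u (ψ z)) :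
    ContDiffAt ℝ ∞ (fun w => u (ψ w)) z := hu.comp z (h.smooth_map z hz)

theorem partialDeriv_comp_map {u : EuclideanSpace ℝ (Fin n) → ℝ} (hu : ContDiffAt ℝ ∞ u (ψ z))
    (i : Fin n) : 𝔡 i (fun w => u (ψ w)) z = ∑ a, 𝔡 a u (ψ z) * jac ψ a i z :=
  partialDeriv_comp (hu.differentiableAt (by simp)) ((h.smooth_map z hz).differentiableAt (by simp))

theorem partialDeriv_gram (k i j : Fin n) :
    𝔡 k (fun w => ∑ a, jac ψ a i w * jac ψ a j w) z =
      ∑ a, jac ψ a j z * 𝔡 k (jac ψ a i) z + ∑ a, jac ψ a i z * 𝔡 k (jac ψ a j) z := by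
  have hd : ∀ a i, DifferentiableAt ℝ (jac ψ a i) z := fun a i =>
    (h.contDiffAt_jac hz a i).differentiableAt (by simp)
  rw [partialDeriv_sum (w := fun a w => jac ψ a i w * jac ψ a j w) _
    fun a _ => (hd a i).mul (hd a j), ← sum_add_distrib]
  refine sum_congr rfl fun a _ => ?_
  rw [partialDeriv_mul (hd a i) (hd a j)]; ring

theorem partialDeriv_metric (k i j : Fin n) :
    𝔡 k (fun w => G w i j) z = Real.exp (2 * φ (ψ z)) *
      (2 * 𝔡 k (fun w => φ (ψ w)) z * ∑ a, jac ψ a i z * jac ψ a j z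
        + ∑ a, jac ψ a j z * 𝔡 k (jac ψ a i) z + ∑ a, jac ψ a i z * 𝔡 k (jac ψ a j) z) := by
  have hd : ∀ a i, DifferentiableAt ℝ (jac ψ a i) z := fun a i =>
    (h.contDiffAt_jac hz a i).differentiableAt (by simp)
  have hφ : DifferentiableAt ℝ (fun w => φ (ψ w)) z :=
    (h.contDiffAt_comp hz (h.smooth_factor z hz)).differentiableAt (by simp)
  rw [partialDeriv_congr_on h.isOpen (fun w hw => h.metric_eq w hw i j) hz,
    partialDeriv_mul (hφ.const_mul 2).exp (by fun_prop), h.partialDeriv_gram hz,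
    partialDeriv_exp (hφ.const_mul 2), partialDeriv_const_mul _ hφ]
  ring

/-- The Levi-Civita connection of the pulled back metric:
`∑ₗ Γˡᵢⱼ ∂ₗψ = ∂ᵢ∂ⱼψ + vᵢ ∂ⱼψ + vⱼ ∂ᵢψ - ⟨∂ᵢψ, ∂ⱼψ⟩ ∇φ`. -/
theorem sum_christoffel (a i j : Fin n) :
    ∑ l, jac ψ a l z * christoffel G l i j z =
      𝔡 i (jac ψ a j) z + 𝔡 i (fun w => φ (ψ w)) z * jac ψ a j z
        + 𝔡 j (fun w => φ (ψ w)) z * jac ψ a i z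
        - (∑ b, jac ψ b i z * jac ψ b j z) * 𝔡 a φ (ψ z) := by
  set v : Fin n → ℝ := fun i => 𝔡 i (fun w => φ (ψ w)) z with hv
  set g : Fin n → Fin n → ℝ := fun i j => ∑ b, jac ψ b i z * jac ψ b j z with hg
  set B : Fin n → ℝ := fun b => 𝔡 i (jac ψ b j) z + v i * jac ψ b j z
        + v j * jac ψ b i z - g i j * 𝔡 b φ (ψ z) with hB
  set E := Real.exp (2 * φ (ψ z)) with hE
  have hgs : ∀ i j, g i j = g j i := fun i j => sum_congr rfl fun _ _ => mul_comm _ _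
  have hvk : ∀ k, v k = ∑ b, 𝔡 b φ (ψ z) * jac ψ b k z := fun k =>
    h.partialDeriv_comp_map hz (h.smooth_factor z hz) k
  -- The Christoffel symbols of the first kind: by symmetry of the second derivatives of ψ, only
  -- ∂ᵢ∂ⱼψ survives the alternating sum, and the bracket is the expected vector B paired with ∂ₖψ.
  have hlow : ∀ k, 𝔡 i (fun w => G w k j) z + 𝔡 j (fun w => G w i k) z - 𝔡 k (fun w => G w i j) z
      = 2 * (E * ∑ b, jac ψ b k z * B b) := by
    intro k
    have h1 : ∑ b, jac ψ b k z * B b =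
        ∑ b, jac ψ b k z * 𝔡 i (jac ψ b j) z + v i * g k j + v j * g k i - g i j * v k := by
      rw [hvk k]
      simp only [hB, hg, mul_sum, ← sum_add_distrib, ← sum_sub_distrib]
      exact sum_congr rfl fun b _ => by ring
    rw [h.partialDeriv_metric hz, h.partialDeriv_metric hz, h.partialDeriv_metric hz, h1]
    have e1 : ∀ b, 𝔡 k (jac ψ b i) z = 𝔡 i (jac ψ b k) z := fun b => h.jac_comm hz b k i
    have e2 : ∀ b, 𝔡 k (jac ψ b j) z = 𝔡 j (jac ψ b k) z := fun b => h.jac_comm hz b k j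
    have e3 : ∀ b, 𝔡 j (jac ψ b i) z = 𝔡 i (jac ψ b j) z := fun b => h.jac_comm hz b j i
    simp only [e1, e2, e3]
    change E * (2 * v i * g k j + _ + _) + E * (2 * v j * g i k + _ + _)
      - E * (2 * v k * g i j + _ + _) = _
    rw [hgs i k]
    ring
  -- Since G = E AᵀA with A the Jacobian matrix, A G⁻¹ (E Aᵀ) = 1: raising the index and pushing
  -- forward by A recovers B.
  have hmat : ∀ b, ∑ l, jac ψ a l z * ∑ k, (G z)⁻¹ l k * (E * jac ψ b k z) =
      if a = b then 1 else 0 := by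
    intro b
    set A : Matrix (Fin n) (Fin n) ℝ := Matrix.of fun a i => jac ψ a i z with hA
    have hGA : G z = E • (A.transpose * A) := by
      ext p q
      rw [h.metric_eq z hz p q]
      simp [Matrix.mul_apply, hA, hE]
    have hAu := h.isUnit_det z hz
    have hAu' : IsUnit A.transpose.det := by rwa [Matrix.det_transpose]
    have hE0 : E ≠ 0 := (Real.exp_pos _).ne'
    have : A * (G z)⁻¹ * (E • A.transpose) = 1 := by
      have hinv : (G z)⁻¹ = E⁻¹ • (A⁻¹ * A.transpose⁻¹) := by
        apply Matrix.inv_eq_left_inv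
        rw [hGA, Matrix.smul_mul, Matrix.mul_smul, smul_smul, inv_mul_cancel₀ hE0, one_smul,
          Matrix.mul_assoc, ← Matrix.mul_assoc A.transpose⁻¹, Matrix.nonsing_inv_mul _ hAu',
          Matrix.one_mul, Matrix.nonsing_inv_mul _ hAu]
      rw [hinv, Matrix.mul_smul, Matrix.mul_smul, Matrix.smul_mul, smul_smul, mul_inv_cancel₀ hE0,
        one_smul, ← Matrix.mul_assoc A, Matrix.mul_nonsing_inv _ hAu, Matrix.one_mul,
        Matrix.nonsing_inv_mul _ hAu']
    have h2 := congrFun (congrFun this a) b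
    rw [Matrix.one_apply, Matrix.mul_assoc] at h2
    rw [← h2]
    simp only [Matrix.mul_apply, Matrix.smul_apply, Matrix.transpose_apply, hA, Matrix.of_apply,
      smul_eq_mul]
  calc ∑ l, jac ψ a l z * christoffel G l i j z
      = ∑ l, jac ψ a l z * ∑ k, (G z)⁻¹ l k * (E * ∑ b, jac ψ b k z * B b) := by
        refine sum_congr rfl fun l _ => ?_
        rw [christoffel, mul_sum]
        congr 1
        exact sum_congr rfl fun k _ => by rw [hlow]; ring
    _ = ∑ b, (∑ l, jac ψ a l z * ∑ k, (G z)⁻¹ l k * (E * jac ψ b k z)) * B b := by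
        simp only [mul_sum, sum_mul]
        rw [sum_congr rfl fun l _ => sum_comm, sum_comm]
        refine sum_congr rfl fun b _ => sum_congr rfl fun l _ => sum_congr rfl fun k _ => by ring
    _ = B a := by simp [hmat]

theorem metric_eq_smul : G z = Real.exp (2 * φ (ψ z)) •
    ((Matrix.of fun a i => jac ψ a i z).transpose * Matrix.of fun a i => jac ψ a i z) := by
  ext p q
  rw [h.metric_eq z hz p q]
  simp [Matrix.mul_apply]

theorem isUnit_det_metric : IsUnit (G z).det := by
  have hAu := (h.isUnit_det z hz).ne_zero
  rw [h.metric_eq_smul hz, Matrix.det_smul, Matrix.det_mul, Matrix.det_transpose,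
    isUnit_iff_ne_zero]
  exact mul_ne_zero (pow_ne_zero _ (Real.exp_pos _).ne') (mul_ne_zero hAu hAu)

theorem contDiffAt_metric (i j : Fin n) : ContDiffAt ℝ ∞ (fun w => G w i j) z := by
  have h1 : ContDiffAt ℝ ∞ (fun w => Real.exp (2 * φ (ψ w)) *
      ∑ a, jac ψ a i w * jac ψ a j w) z := by
    refine ((contDiffAt_const.mul (h.contDiffAt_comp hz (h.smooth_factor z hz))).exp).mul
      (ContDiffAt.sum fun a _ => (h.contDiffAt_jac hz a i).mul (h.contDiffAt_jac hz a j))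
  exact h1.congr_of_eventuallyEq
    (eventually_of_mem (h.isOpen.mem_nhds hz) fun w hw => h.metric_eq w hw i j)

theorem contDiffAt_christoffel (l i j : Fin n) : ContDiffAt ℝ ∞ (christoffel G l i j) z := by
  have hG := h.contDiffAt_metric hz
  unfold christoffel
  refine contDiffAt_const.mul (ContDiffAt.sum fun k _ =>
    (contDiffAt_inv hG (h.isUnit_det_metric hz) l k).mul
      (((contDiffAt_partialDeriv (hG k j)).add (contDiffAt_partialDeriv (hG i k))).sub
        (contDiffAt_partialDeriv (hG i j))))

/-- The derivative of the connection coefficients, before antisymmetrization. -/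
theorem sum_partialDeriv_christoffel (a i j k : Fin n) :
    ∑ l, jac ψ a l z * (𝔡 i (christoffel G l j k) z
        + ∑ p, christoffel G p j k z * christoffel G l i p z) =
      𝔡 i (𝔡 j (jac ψ a k)) z
      + 𝔡 i (𝔡 j (fun w => φ (ψ w))) z * jac ψ a k z
      + 𝔡 j (fun w => φ (ψ w)) z * 𝔡 i (jac ψ a k) z
      + 𝔡 i (𝔡 k (fun w => φ (ψ w))) z * jac ψ a j z
      + 𝔡 k (fun w => φ (ψ w)) z * 𝔡 i (jac ψ a j) z
      - (∑ b, jac ψ b k z * 𝔡 i (jac ψ b j) z + ∑ b, jac ψ b j z * 𝔡 i (jac ψ b k) z) * 𝔡 a φ (ψ z)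
      - (∑ b, jac ψ b j z * jac ψ b k z) * 𝔡 i (fun w => 𝔡 a φ (ψ w)) z
      + 𝔡 i (fun w => φ (ψ w)) z * (𝔡 j (jac ψ a k) z + 𝔡 j (fun w => φ (ψ w)) z * jac ψ a k z
        + 𝔡 k (fun w => φ (ψ w)) z * jac ψ a j z
        - (∑ b, jac ψ b j z * jac ψ b k z) * 𝔡 a φ (ψ z))
      + (∑ b, 𝔡 b φ (ψ z) * 𝔡 j (jac ψ b k) z
        + 2 * 𝔡 j (fun w => φ (ψ w)) z * 𝔡 k (fun w => φ (ψ w)) z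
        - (∑ b, jac ψ b j z * jac ψ b k z) * ∑ b, 𝔡 b φ (ψ z) ^ 2) * jac ψ a i z
      - (∑ b, jac ψ b i z * 𝔡 j (jac ψ b k) z
        + 𝔡 j (fun w => φ (ψ w)) z * ∑ b, jac ψ b i z * jac ψ b k z
        + 𝔡 k (fun w => φ (ψ w)) z * ∑ b, jac ψ b i z * jac ψ b j z
        - (∑ b, jac ψ b j z * jac ψ b k z) * 𝔡 i (fun w => φ (ψ w)) z) * 𝔡 a φ (ψ z) := by
  have hJ : ∀ a i, DifferentiableAt ℝ (jac ψ a i) z := fun a i =>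
    (h.contDiffAt_jac hz a i).differentiableAt (by simp)
  have hdJ : ∀ a i j, DifferentiableAt ℝ (𝔡 i (jac ψ a j)) z := fun a i j =>
    (contDiffAt_partialDeriv (h.contDiffAt_jac hz a j)).differentiableAt (by simp)
  have hΓ : ∀ l, DifferentiableAt ℝ (christoffel G l j k) z := fun l =>
    (h.contDiffAt_christoffel hz l j k).differentiableAt (by simp)
  have hv : ∀ i, DifferentiableAt ℝ (𝔡 i (fun w => φ (ψ w))) z := fun i =>
    (contDiffAt_partialDeriv (h.contDiffAt_comp hz (h.smooth_factor z hz))).differentiableAt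
      (by simp)
  have hV : DifferentiableAt ℝ (fun w => 𝔡 a φ (ψ w)) z :=
    (h.contDiffAt_comp hz (contDiffAt_partialDeriv (h.smooth_factor z hz))).differentiableAt
      (by simp)
  have hg : DifferentiableAt ℝ (fun w => ∑ b, jac ψ b j w * jac ψ b k w) z :=
    DifferentiableAt.fun_sum fun b _ => (hJ b j).mul (hJ b k)
  -- The connection formula holds on the open set S, so it may be differentiated. The product rule
  -- on the left leaves a term ∂ᵢ(∂ₗψ) Γˡⱼₖ, which the connection formula itself turns into ΓΓ plus
  -- first order terms.
  have hder := partialDeriv_congr_on (i := i) h.isOpen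
    (fun w hw => h.sum_christoffel hw a j k) hz
  rw [partialDeriv_sum (w := fun l w => jac ψ a l w * christoffel G l j k w) _
      fun l _ => (hJ a l).mul (hΓ l),
    partialDeriv_sub (((hdJ a j k).fun_add ((hv j).fun_mul (hJ a k))).fun_add ((hv k).fun_mul (hJ a j)))
      (hg.fun_mul hV),
    partialDeriv_add ((hdJ a j k).fun_add ((hv j).fun_mul (hJ a k))) ((hv k).fun_mul (hJ a j)),
    partialDeriv_add (hdJ a j k) ((hv j).fun_mul (hJ a k)),
    partialDeriv_mul (hv j) (hJ a k), partialDeriv_mul (hv k) (hJ a j),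
    partialDeriv_mul hg hV, h.partialDeriv_gram hz] at hder
  simp only [fun l => partialDeriv_mul (i := i) (hJ a l) (hΓ l), sum_add_distrib] at hder
  have hB := fun b => h.sum_christoffel hz b j k
  have hvk : ∀ k, 𝔡 k (fun w => φ (ψ w)) z = ∑ b, 𝔡 b φ (ψ z) * jac ψ b k z := fun k =>
    h.partialDeriv_comp_map hz (h.smooth_factor z hz) k
  have hVB : ∑ l, 𝔡 l (fun w => φ (ψ w)) z * christoffel G l j k z =
      ∑ b, 𝔡 b φ (ψ z) * 𝔡 j (jac ψ b k) z
        + 2 * 𝔡 j (fun w => φ (ψ w)) z * 𝔡 k (fun w => φ (ψ w)) z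
        - (∑ b, jac ψ b j z * jac ψ b k z) * ∑ b, 𝔡 b φ (ψ z) ^ 2 := by
    have : ∑ l, 𝔡 l (fun w => φ (ψ w)) z * christoffel G l j k z =
        ∑ b, 𝔡 b φ (ψ z) * ∑ l, jac ψ b l z * christoffel G l j k z := by
      simp only [hvk, mul_sum, sum_mul]
      rw [sum_comm]
      exact sum_congr rfl fun _ _ => sum_congr rfl fun _ _ => by ring
    rw [this, sum_congr rfl fun b _ => by rw [hB b]]
    generalize hg' : (∑ b, jac ψ b j z * jac ψ b k z) = g'
    have e : 2 * 𝔡 j (fun w => φ (ψ w)) z * 𝔡 k (fun w => φ (ψ w)) z =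
        𝔡 j (fun w => φ (ψ w)) z * (∑ b, 𝔡 b φ (ψ z) * jac ψ b k z)
        + 𝔡 k (fun w => φ (ψ w)) z * (∑ b, 𝔡 b φ (ψ z) * jac ψ b j z) := by
      rw [← hvk, ← hvk]; ring
    rw [e]
    simp only [mul_sum, ← sum_add_distrib, ← sum_sub_distrib]
    exact sum_congr rfl fun _ _ => by ring
  have hJB : ∑ l, (∑ b, jac ψ b i z * jac ψ b l z) * christoffel G l j k z =
      ∑ b, jac ψ b i z * 𝔡 j (jac ψ b k) z
        + 𝔡 j (fun w => φ (ψ w)) z * ∑ b, jac ψ b i z * jac ψ b k z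
        + 𝔡 k (fun w => φ (ψ w)) z * ∑ b, jac ψ b i z * jac ψ b j z
        - (∑ b, jac ψ b j z * jac ψ b k z) * 𝔡 i (fun w => φ (ψ w)) z := by
    have : ∑ l, (∑ b, jac ψ b i z * jac ψ b l z) * christoffel G l j k z =
        ∑ b, jac ψ b i z * ∑ l, jac ψ b l z * christoffel G l j k z := by
      simp only [mul_sum, sum_mul]
      rw [sum_comm]
      exact sum_congr rfl fun _ _ => sum_congr rfl fun _ _ => by ring
    rw [this, sum_congr rfl fun b _ => by rw [hB b]]
    generalize hg' : (∑ b, jac ψ b j z * jac ψ b k z) = g'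
    rw [hvk i]
    simp only [mul_sum, ← sum_add_distrib, ← sum_sub_distrib]
    exact sum_congr rfl fun _ _ => by ring
  -- The connection formula solved for the second derivative of ψ; multiplied by Γˡⱼₖ and summed, it
  -- produces the quadratic term of the curvature.
  have hH : ∀ l, 𝔡 i (jac ψ a l) z = ∑ p, jac ψ a p z * christoffel G p i l z
      - 𝔡 i (fun w => φ (ψ w)) z * jac ψ a l z - 𝔡 l (fun w => φ (ψ w)) z * jac ψ a i z
      + (∑ b, jac ψ b i z * jac ψ b l z) * 𝔡 a φ (ψ z) := fun l => by
    rw [h.sum_christoffel hz a i l]; ring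
  have hHΓ : ∑ l, 𝔡 i (jac ψ a l) z * christoffel G l j k z =
      ∑ l, jac ψ a l z * ∑ p, christoffel G p j k z * christoffel G l i p z
      - 𝔡 i (fun w => φ (ψ w)) z * (∑ l, jac ψ a l z * christoffel G l j k z)
      - (∑ l, 𝔡 l (fun w => φ (ψ w)) z * christoffel G l j k z) * jac ψ a i z
      + (∑ l, (∑ b, jac ψ b i z * jac ψ b l z) * christoffel G l j k z) * 𝔡 a φ (ψ z) := by
    have : ∑ l, jac ψ a l z * ∑ p, christoffel G p j k z * christoffel G l i p z =
        ∑ l, (∑ p, jac ψ a p z * christoffel G p i l z) * christoffel G l j k z := by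
      simp only [mul_sum, sum_mul]
      rw [sum_comm]
      exact sum_congr rfl fun _ _ => sum_congr rfl fun _ _ => by ring
    rw [this, sum_mul _ _ (jac ψ a i z), sum_mul _ _ (𝔡 a φ (ψ z)),
      mul_sum _ _ (𝔡 i (fun w => φ (ψ w)) z), ← sum_sub_distrib, ← sum_sub_distrib,
      ← sum_add_distrib]
    refine sum_congr rfl fun l _ => ?_
    rw [hH l]; ring
  rw [hHΓ, hVB, hJB, hB a] at hder
  simp only [mul_add, sum_add_distrib]
  linear_combination hder

/-- By the chain rule, the Hessian of φ contracted with the Jacobian is a derivative of (∂ₐφ) ∘ ψ,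
which is the form in which it occurs in `sum_partialDeriv_christoffel`. -/
theorem sum_schouten_jac (a i : Fin n) : ∑ b, schouten φ a b (ψ z) * jac ψ b i z =
    - 𝔡 i (fun w => 𝔡 a φ (ψ w)) z + 𝔡 a φ (ψ z) * 𝔡 i (fun w => φ (ψ w)) z
      - (1 / 2 : ℝ) * (∑ d, 𝔡 d φ (ψ z) ^ 2) * jac ψ a i z := by
  have hφ := h.smooth_factor z hz
  rw [h.partialDeriv_comp_map hz hφ, h.partialDeriv_comp_map hz (contDiffAt_partialDeriv hφ)]
  have : ∀ b, schouten φ a b (ψ z) * jac ψ b i z = - (𝔡 b (𝔡 a φ) (ψ z) * jac ψ b i z)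
      + 𝔡 a φ (ψ z) * (𝔡 b φ (ψ z) * jac ψ b i z)
      - (1 / 2 : ℝ) * (∑ d, 𝔡 d φ (ψ z) ^ 2) * (if a = b then jac ψ b i z else 0) := fun b => by
    rw [schouten, partialDeriv_comm hφ, kron]; split_ifs <;> ring
  simp only [this, sum_sub_distrib, sum_add_distrib, ← mul_sum, sum_neg_distrib]
  simp

omit hz in
theorem partialDeriv_partialDeriv_comp {u : EuclideanSpace ℝ (Fin n) → ℝ} (hz : z ∈ S)
    (hu : ∀ w ∈ S, ContDiffAt ℝ ∞ u (ψ w)) (i k : Fin n) :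
    𝔡 i (𝔡 k (fun w => u (ψ w))) z = ∑ a, 𝔡 i (fun w => 𝔡 a u (ψ w)) z * jac ψ a k z
      + ∑ b, 𝔡 b u (ψ z) * 𝔡 i (jac ψ b k) z := by
  have hJ : ∀ a i, DifferentiableAt ℝ (jac ψ a i) z := fun a i =>
    (h.contDiffAt_jac hz a i).differentiableAt (by simp)
  have hV : ∀ a, DifferentiableAt ℝ (fun w => 𝔡 a u (ψ w)) z := fun a =>
    (h.contDiffAt_comp hz (contDiffAt_partialDeriv (hu z hz))).differentiableAt (by simp)
  rw [partialDeriv_congr_on h.isOpen (fun w hw => h.partialDeriv_comp_map hw (hu w hw) k) hz,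
    partialDeriv_sum (w := fun a w => 𝔡 a u (ψ w) * jac ψ a k w) _
      fun a _ => (hV a).mul (hJ a k), ← sum_add_distrib]
  exact sum_congr rfl fun a _ => by rw [partialDeriv_mul (hV a) (hJ a k)]

theorem sum_sum_schouten_jac (i k : Fin n) :
    ∑ a, jac ψ a k z * ∑ b, schouten φ a b (ψ z) * jac ψ b i z =
      - 𝔡 i (𝔡 k (fun w => φ (ψ w))) z + ∑ b, 𝔡 b φ (ψ z) * 𝔡 i (jac ψ b k) z
      + 𝔡 i (fun w => φ (ψ w)) z * 𝔡 k (fun w => φ (ψ w)) z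
      - (1 / 2 : ℝ) * (∑ d, 𝔡 d φ (ψ z) ^ 2) * ∑ b, jac ψ b i z * jac ψ b k z := by
  have hφ := h.smooth_factor z hz
  have hJ : ∀ a i, DifferentiableAt ℝ (jac ψ a i) z := fun a i =>
    (h.contDiffAt_jac hz a i).differentiableAt (by simp)
  have hV : ∀ a, DifferentiableAt ℝ (fun w => 𝔡 a φ (ψ w)) z := fun a =>
    (h.contDiffAt_comp hz (contDiffAt_partialDeriv (h.smooth_factor z hz))).differentiableAt
      (by simp)
  have h2 := h.partialDeriv_partialDeriv_comp hz h.smooth_factor i k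
  rw [h2, h.partialDeriv_comp_map hz hφ k]
  simp only [h.sum_schouten_jac hz, mul_sum _ _ ((1 / 2 : ℝ) * _),
    mul_sum _ _ (𝔡 i (fun w => φ (ψ w)) z), neg_add, ← sum_neg_distrib, ← sum_add_distrib,
    ← sum_sub_distrib]
  exact sum_congr rfl fun a _ => by ring

/-- Antisymmetrization in i and j removes the third derivatives of ψ and every term symmetric in i
and j. The rest assembles into pulled back Schouten tensors: δ is flat, so only the conformal factor
contributes. -/
theorem sum_curvatureUp (a i j k : Fin n) :
    ∑ l, jac ψ a l z * curvatureUp G i j k l z =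
      - (∑ a, jac ψ a k z * ∑ b, schouten φ a b (ψ z) * jac ψ b i z) * jac ψ a j z
      + (∑ a, jac ψ a k z * ∑ b, schouten φ a b (ψ z) * jac ψ b j z) * jac ψ a i z
      + (∑ b, jac ψ b j z * jac ψ b k z) * (∑ b, schouten φ a b (ψ z) * jac ψ b i z)
      - (∑ b, jac ψ b i z * jac ψ b k z) * (∑ b, schouten φ a b (ψ z) * jac ψ b j z) := by
  have h1 := h.sum_partialDeriv_christoffel hz a i j k
  have h2 := h.sum_partialDeriv_christoffel hz a j i k
  have hφ := h.contDiffAt_comp hz (h.smooth_factor z hz)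
  have c1 := partialDeriv_comm (i := i) (j := j) (h.contDiffAt_jac hz a k)
  have c2 : ∀ b, 𝔡 j (jac ψ b i) z = 𝔡 i (jac ψ b j) z := fun b => h.jac_comm hz b j i
  have c3 := partialDeriv_comm (i := i) (j := j) hφ
  have hgs : ∑ b, jac ψ b j z * jac ψ b i z = ∑ b, jac ψ b i z * jac ψ b j z :=
    sum_congr rfl fun _ _ => mul_comm _ _
  simp only [c2, hgs] at h2
  have h3 : ∑ l, jac ψ a l z * curvatureUp G i j k l z =
      ∑ l, jac ψ a l z * (𝔡 i (christoffel G l j k) z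
        + ∑ p, christoffel G p j k z * christoffel G l i p z)
      - ∑ l, jac ψ a l z * (𝔡 j (christoffel G l i k) z
        + ∑ p, christoffel G p i k z * christoffel G l j p z) := by
    rw [← sum_sub_distrib]
    refine sum_congr rfl fun l _ => ?_
    rw [curvatureUp, sum_sub_distrib]; ring
  rw [h3, h1, h2]
  rw [h.sum_sum_schouten_jac hz i k, h.sum_sum_schouten_jac hz j k]
  simp only [h.sum_schouten_jac hz]
  rw [c1, c3]
  ring

/-- The decomposition of the Riemann tensor with no Weyl part. The Einstein condition therefore
determines it completely in `riemann_eq_of_flatRicci_eq`. -/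
theorem riemann_eq (i j k l : Fin n) : riemann G i j k l z = Real.exp (2 * φ (ψ z)) * (
    (∑ b, jac ψ b k z * jac ψ b i z)
        * (∑ a, jac ψ a l z * ∑ b, schouten φ a b (ψ z) * jac ψ b j z)
      - (∑ b, jac ψ b k z * jac ψ b j z)
        * (∑ a, jac ψ a l z * ∑ b, schouten φ a b (ψ z) * jac ψ b i z)
      + (∑ b, jac ψ b j z * jac ψ b l z)
        * (∑ a, jac ψ a k z * ∑ b, schouten φ a b (ψ z) * jac ψ b i z)
      - (∑ b, jac ψ b i z * jac ψ b l z)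
        * (∑ a, jac ψ a k z * ∑ b, schouten φ a b (ψ z) * jac ψ b j z)) := by
  have : riemann G i j k l z = Real.exp (2 * φ (ψ z)) *
      ∑ a, jac ψ a k z * ∑ m, jac ψ a m z * curvatureUp G i j l m z := by
    rw [riemann]
    simp only [h.metric_eq z hz, mul_sum, sum_mul]
    rw [sum_comm]
    exact sum_congr rfl fun _ _ => sum_congr rfl fun _ _ => by ring
  rw [this]
  congr 1
  simp only [h.sum_curvatureUp hz]
  generalize (∑ b, jac ψ b j z * jac ψ b l z) = g1
  generalize (∑ b, jac ψ b i z * jac ψ b l z) = g2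
  generalize (∑ a, jac ψ a l z * ∑ b, schouten φ a b (ψ z) * jac ψ b i z) = g3
  generalize (∑ a, jac ψ a l z * ∑ b, schouten φ a b (ψ z) * jac ψ b j z) = g4
  have : ∀ a, jac ψ a k z * (-g3 * jac ψ a j z + g4 * jac ψ a i z
      + g1 * ∑ b, schouten φ a b (ψ z) * jac ψ b i z
      - g2 * ∑ b, schouten φ a b (ψ z) * jac ψ b j z) =
      jac ψ a k z * jac ψ a i z * g4 - jac ψ a k z * jac ψ a j z * g3
      + g1 * (jac ψ a k z * ∑ b, schouten φ a b (ψ z) * jac ψ b i z)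
      - g2 * (jac ψ a k z * ∑ b, schouten φ a b (ψ z) * jac ψ b j z) := fun a => by ring
  simp only [this, sum_add_distrib, sum_sub_distrib, ← mul_sum, ← sum_mul]

/-- The Hessian of a function composed with `ψ` is the pullback of its Hessian for `exp (2 φ) δ`. -/
theorem hessian_eq {u : EuclideanSpace ℝ (Fin n) → ℝ} (hu : ∀ w ∈ S, ContDiffAt ℝ ∞ u (ψ w))
    (i j : Fin n) : hessian G (fun w => u (ψ w)) i j z =
    ∑ a, jac ψ a j z * ∑ b, flatHessian φ u a b (ψ z) * jac ψ b i z := by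
  have hφ := h.smooth_factor z hz
  have h1 : ∀ a, ∑ b, flatHessian φ u a b (ψ z) * jac ψ b i z =
      𝔡 i (fun w => 𝔡 a u (ψ w)) z - 𝔡 a φ (ψ z) * 𝔡 i (fun w => u (ψ w)) z
      - 𝔡 a u (ψ z) * 𝔡 i (fun w => φ (ψ w)) z
      + (∑ d, 𝔡 d φ (ψ z) * 𝔡 d u (ψ z)) * jac ψ a i z := by
    intro a
    simp only [flatHessian, kron]
    rw [h.partialDeriv_comp_map hz hφ, h.partialDeriv_comp_map hz (hu z hz),
      h.partialDeriv_comp_map hz (contDiffAt_partialDeriv (hu z hz))]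
    generalize (∑ d, 𝔡 d φ (ψ z) * 𝔡 d u (ψ z)) = c
    have : ∀ b, (𝔡 a (𝔡 b u) (ψ z) - 𝔡 a φ (ψ z) * 𝔡 b u (ψ z)
      - 𝔡 b φ (ψ z) * 𝔡 a u (ψ z) + c * (if a = b then 1 else 0)) * jac ψ b i z =
      𝔡 b (𝔡 a u) (ψ z) * jac ψ b i z - 𝔡 a φ (ψ z) * (𝔡 b u (ψ z) * jac ψ b i z)
      - 𝔡 a u (ψ z) * (𝔡 b φ (ψ z) * jac ψ b i z) + c * (if a = b then jac ψ b i z else 0) := by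
      intro b
      rw [partialDeriv_comm (hu z hz)]; split_ifs <;> ring
    simp only [this, sum_sub_distrib, sum_add_distrib, ← mul_sum]
    simp
  have h3 : ∑ k, christoffel G k i j z * 𝔡 k (fun w => u (ψ w)) z =
      ∑ b, 𝔡 b u (ψ z) * ∑ l, jac ψ b l z * christoffel G l i j z := by
    simp only [h.partialDeriv_comp_map hz (hu z hz), mul_sum]
    rw [sum_comm]
    exact sum_congr rfl fun _ _ => sum_congr rfl fun _ _ => by ring
  rw [hessian, h3, h.partialDeriv_partialDeriv_comp hz hu]
  simp only [h1, h.sum_christoffel hz]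
  rw [← sub_eq_zero]
  have e1 := h.partialDeriv_comp_map hz (hu z hz) j
  have e2 := h.partialDeriv_comp_map hz hφ j
  have e3 : (∑ d, 𝔡 d φ (ψ z) * 𝔡 d u (ψ z)) * (∑ b, jac ψ b i z * jac ψ b j z) =
      (∑ b, jac ψ b i z * jac ψ b j z) * (∑ d, 𝔡 d φ (ψ z) * 𝔡 d u (ψ z)) := mul_comm _ _
  have e4 : 𝔡 j (fun w => u (ψ w)) z * 𝔡 i (fun w => φ (ψ w)) z =
    𝔡 i (fun w => φ (ψ w)) z * 𝔡 j (fun w => u (ψ w)) z := mul_comm _ _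
  have e5 : 𝔡 j (fun w => φ (ψ w)) z * 𝔡 i (fun w => u (ψ w)) z =
    𝔡 i (fun w => u (ψ w)) z * 𝔡 j (fun w => φ (ψ w)) z := mul_comm _ _
  have e6 := h.partialDeriv_comp_map hz (hu z hz) i
  rw [← sum_add_distrib, ← sum_sub_distrib, ← sum_sub_distrib]
  generalize hc : (∑ d, 𝔡 d φ (ψ z) * 𝔡 d u (ψ z)) = c at *
  generalize hg : (∑ b, jac ψ b i z * jac ψ b j z) = g at *
  generalize 𝔡 j (fun w => φ (ψ w)) z = vj at *
  generalize 𝔡 i (fun w => φ (ψ w)) z = vi at *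
  generalize 𝔡 j (fun w => u (ψ w)) z = uj at *
  generalize 𝔡 i (fun w => u (ψ w)) z = ui at *
  have : ∀ x, 𝔡 i (fun w => 𝔡 x u (ψ w)) z * jac ψ x j z + 𝔡 x u (ψ z) * 𝔡 i (jac ψ x j) z
      - 𝔡 x u (ψ z) * (𝔡 i (jac ψ x j) z + vi * jac ψ x j z + vj * jac ψ x i z - g * 𝔡 x φ (ψ z))
      - jac ψ x j z * (𝔡 i (fun w => 𝔡 x u (ψ w)) z - 𝔡 x φ (ψ z) * ui - 𝔡 x u (ψ z) * vi
        + c * jac ψ x i z) =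
      g * (𝔡 x φ (ψ z) * 𝔡 x u (ψ z)) + ui * (𝔡 x φ (ψ z) * jac ψ x j z)
      - vj * (𝔡 x u (ψ z) * jac ψ x i z) - c * (jac ψ x i z * jac ψ x j z) := fun x => by ring
  simp only [this, sum_sub_distrib, sum_add_distrib, ← mul_sum, hc, hg, ← e2, ← e6]
  ring

end IsConformalPullback

end Pullback

/-! ### Solitons in a conformally flat chart -/

/-- The function `f` is the potential of a gradient Ricci soliton structure, with constant `ρ`, on
the open set `U` with the metric `exp (2 φ) δ`. -/
structure IsFlatSoliton {n : ℕ} (φ f : EuclideanSpace ℝ (Fin n) → ℝ) (ρ : ℝ)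
    (U : Set (EuclideanSpace ℝ (Fin n))) : Prop where
  isOpen : IsOpen U
  smooth_factor : ∀ z ∈ U, ContDiffAt ℝ ∞ φ z
  smooth_potential : ∀ z ∈ U, ContDiffAt ℝ ∞ f z
  equation : ∀ z ∈ U, ∀ i j, flatRicci φ i j z + flatHessian φ f i j z =
    ρ * (Real.exp (2 * φ z) * kron i j)

/-! ### Derivatives of the Schouten tensor -/

section Schouten

variable {n : ℕ} {φ : EuclideanSpace ℝ (Fin n) → ℝ} {z : EuclideanSpace ℝ (Fin n)}

theorem partialDeriv_partialDeriv_eq_schouten (i j : Fin n) :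
    𝔡 i (𝔡 j φ) z = - schouten φ i j z + 𝔡 i φ z * 𝔡 j φ z
      - (1 / 2 : ℝ) * (∑ d, 𝔡 d φ z ^ 2) * kron i j := by
  rw [schouten]; ring

variable (hφ : ContDiffAt ℝ ∞ φ z)
include hφ

theorem schouten_comm (i j : Fin n) : schouten φ i j z = schouten φ j i z := by
  rw [schouten, schouten, partialDeriv_comm hφ, kron_comm, mul_comm (𝔡 i φ z)]

theorem flatRicci_comm (i j : Fin n) : flatRicci φ i j z = flatRicci φ j i z := by
  rw [flatRicci, flatRicci, schouten_comm hφ, kron_comm]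

theorem contDiffAt_schouten (i j : Fin n) : ContDiffAt ℝ ∞ (schouten φ i j) z := by
  have h1 := fun i => contDiffAt_partialDeriv (i := i) hφ
  have h2 := fun i j => contDiffAt_partialDeriv (i := i) (h1 j)
  exact ((h2 i j).neg.add ((h1 i).mul (h1 j))).sub
    ((contDiffAt_const.mul (ContDiffAt.sum fun d _ => (h1 d).pow 2)).mul contDiffAt_const)

theorem contDiffAt_schoutenTrace : ContDiffAt ℝ ∞ (schoutenTrace φ) z :=
  ContDiffAt.sum fun i _ => contDiffAt_schouten hφ i i

theorem contDiffAt_flatRicci (i j : Fin n) : ContDiffAt ℝ ∞ (flatRicci φ i j) z :=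
  (contDiffAt_const.mul (contDiffAt_schouten hφ i j)).add
    ((contDiffAt_schoutenTrace hφ).mul contDiffAt_const)

theorem partialDeriv_schoutenTrace (k : Fin n) :
    𝔡 k (schoutenTrace φ) z = ∑ i, 𝔡 k (schouten φ i i) z :=
  partialDeriv_sum _ fun i _ => (contDiffAt_schouten hφ i i).differentiableAt (by simp)

/-- The Cotton tensor of a conformally flat metric vanishes, in terms of flat derivatives. -/
theorem partialDeriv_schouten_sub (k i j : Fin n) :
    𝔡 k (schouten φ i j) z - 𝔡 i (schouten φ k j) z =
      schouten φ i j z * 𝔡 k φ z - schouten φ k j z * 𝔡 i φ z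
      + (∑ l, schouten φ k l z * 𝔡 l φ z) * kron i j
      - (∑ l, schouten φ i l z * 𝔡 l φ z) * kron k j := by
  have d1 : ∀ i, DifferentiableAt ℝ (𝔡 i φ) z := fun i =>
    (contDiffAt_partialDeriv (i := i) hφ).differentiableAt (by simp)
  have d2 : ∀ i j, DifferentiableAt ℝ (𝔡 i (𝔡 j φ)) z := fun i j =>
    (contDiffAt_partialDeriv (contDiffAt_partialDeriv (i := j) hφ)).differentiableAt (by simp)
  have ds : DifferentiableAt ℝ (fun w => ∑ d, 𝔡 d φ w ^ 2) z :=
    DifferentiableAt.fun_sum fun d _ => (d1 d).pow 2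
  have hder : ∀ k i j, 𝔡 k (schouten φ i j) z = - 𝔡 k (𝔡 i (𝔡 j φ)) z
      + (𝔡 k (𝔡 i φ) z * 𝔡 j φ z + 𝔡 i φ z * 𝔡 k (𝔡 j φ) z)
      - (∑ l, 𝔡 k (𝔡 l φ) z * 𝔡 l φ z) * kron i j := by
    intro k i j
    have e : 𝔡 k (fun w => ∑ d, 𝔡 d φ w ^ 2) z = 2 * ∑ l, 𝔡 k (𝔡 l φ) z * 𝔡 l φ z := by
      rw [partialDeriv_sum (w := fun d w => 𝔡 d φ w ^ 2) _ fun d _ => (d1 d).pow 2, mul_sum]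
      refine sum_congr rfl fun d _ => ?_
      rw [partialDeriv_congr (v := fun w => 𝔡 d φ w * 𝔡 d φ w)
        (Eventually.of_forall fun w => pow_two _), partialDeriv_mul (d1 d) (d1 d)]
      ring
    rw [show schouten φ i j = fun w => - 𝔡 i (𝔡 j φ) w + 𝔡 i φ w * 𝔡 j φ w
        - (1 / 2 : ℝ) * (∑ d, 𝔡 d φ w ^ 2) * kron i j from rfl,
      partialDeriv_sub ((d2 i j).fun_neg.fun_add ((d1 i).fun_mul (d1 j)))
        ((ds.const_mul _).mul_const _),
      partialDeriv_add (d2 i j).fun_neg ((d1 i).fun_mul (d1 j)), partialDeriv_neg,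
      partialDeriv_mul (d1 i) (d1 j), partialDeriv_mul_const _ (ds.const_mul _),
      partialDeriv_const_mul _ ds, e]
    ring
  have hsum : ∀ k, ∑ l, 𝔡 k (𝔡 l φ) z * 𝔡 l φ z = - ∑ l, schouten φ k l z * 𝔡 l φ z
      + (1 / 2 : ℝ) * (∑ d, 𝔡 d φ z ^ 2) * 𝔡 k φ z := by
    intro k
    have : ∀ l, 𝔡 k (𝔡 l φ) z * 𝔡 l φ z = - (schouten φ k l z * 𝔡 l φ z)
        + 𝔡 k φ z * 𝔡 l φ z ^ 2
        - (1 / 2 : ℝ) * (∑ d, 𝔡 d φ z ^ 2) * (kron k l * 𝔡 l φ z) := fun l => by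
      rw [partialDeriv_partialDeriv_eq_schouten]; ring
    simp only [this, sum_sub_distrib, sum_add_distrib, ← mul_sum, sum_neg_distrib, sum_kron_mul]
    ring
  -- The third derivatives of φ are symmetric in k and i and cancel. The remaining Hessians of φ are
  -- traded for Schouten tensors, so no derivative of order above two is left on the right.
  rw [hder, hder, hsum, hsum, partialDeriv_comm (i := i) (j := k)
    (contDiffAt_partialDeriv (i := j) hφ), partialDeriv_comm (i := i) (j := k) hφ]
  rw [partialDeriv_partialDeriv_eq_schouten i j, partialDeriv_partialDeriv_eq_schouten k j]
  ring

/-- The divergence of the Schouten tensor, in terms of flat derivatives. -/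
theorem sum_partialDeriv_schouten (k : Fin n) :
    ∑ i, 𝔡 i (schouten φ k i) z = 𝔡 k (schoutenTrace φ) z - schoutenTrace φ z * 𝔡 k φ z
      - (n - 2) * ∑ l, schouten φ k l z * 𝔡 l φ z := by
  -- Contraction of the Cotton identity over its last two indices.
  have h1 : ∑ i, (𝔡 k (schouten φ i i) z - 𝔡 i (schouten φ k i) z) = _ :=
    sum_congr rfl fun i _ => partialDeriv_schouten_sub hφ k i i
  have h2 : ∑ x, (∑ l, schouten φ x l z * 𝔡 l φ z) * kron k x =
      ∑ l, schouten φ k l z * 𝔡 l φ z := by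
    simp only [mul_comm _ (kron k _)]
    exact sum_kron_mul k fun x => ∑ l, schouten φ x l z * 𝔡 l φ z
  rw [sum_sub_distrib, sum_sub_distrib, sum_add_distrib, sum_sub_distrib,
    ← partialDeriv_schoutenTrace hφ, h2, ← sum_mul] at h1
  simp only [kron_self, mul_one, sum_const, card_univ, Fintype.card_fin, nsmul_eq_mul] at h1
  rw [schoutenTrace]
  linarith

end Schouten

/-- The scalar curvature of `exp (2 φ) δ`. -/
def flatScalar {n : ℕ} (φ : EuclideanSpace ℝ (Fin n) → ℝ) (y : EuclideanSpace ℝ (Fin n)) : ℝ :=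
  Real.exp (-(2 * φ y)) * ∑ i, flatRicci φ i i y

/-- The squared norm of the Ricci tensor of `exp (2 φ) δ`. -/
def flatRicciNormSq {n : ℕ} (φ : EuclideanSpace ℝ (Fin n) → ℝ) (y : EuclideanSpace ℝ (Fin n)) : ℝ :=
  Real.exp (-(2 * φ y)) ^ 2 * ∑ i, ∑ j, flatRicci φ i j y ^ 2

/-- The scalar product of the gradients of `u` and `v` for the metric `exp (2 φ) δ`. -/
def flatGradInner {n : ℕ} (φ u v : EuclideanSpace ℝ (Fin n) → ℝ) (y : EuclideanSpace ℝ (Fin n)) : ℝ :=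
  Real.exp (-(2 * φ y)) * ∑ i, 𝔡 i u y * 𝔡 i v y

/-- The Laplacian of `u` for the metric `exp (2 φ) δ`. -/
def flatLaplacian {n : ℕ} (φ u : EuclideanSpace ℝ (Fin n) → ℝ) (y : EuclideanSpace ℝ (Fin n)) : ℝ :=
  Real.exp (-(2 * φ y)) * (∑ i, 𝔡 i (𝔡 i u) y + (n - 2) * ∑ i, 𝔡 i φ y * 𝔡 i u y)

/-! ### Soliton identities in a conformally flat chart -/

namespace IsFlatSoliton

variable {n : ℕ} {φ f : EuclideanSpace ℝ (Fin n) → ℝ} {ρ : ℝ}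
  {U : Set (EuclideanSpace ℝ (Fin n))} {z : EuclideanSpace ℝ (Fin n)}

theorem sum_flatRicci_self (φ : EuclideanSpace ℝ (Fin n) → ℝ) (z : EuclideanSpace ℝ (Fin n)) :
    ∑ i, flatRicci φ i i z = 2 * (n - 1) * schoutenTrace φ z := by
  simp only [flatRicci, sum_add_distrib, ← mul_sum, kron_self, sum_const, card_univ,
    Fintype.card_fin, nsmul_eq_mul, mul_one]
  rw [schoutenTrace]; ring

theorem sum_flatRicci_mul (φ : EuclideanSpace ℝ (Fin n) → ℝ) (z : EuclideanSpace ℝ (Fin n))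
    (k : Fin n) (u : Fin n → ℝ) : ∑ l, flatRicci φ k l z * u l =
      (n - 2) * ∑ l, schouten φ k l z * u l + schoutenTrace φ z * u k := by
  have : ∀ l, flatRicci φ k l z * u l = (n - 2) * (schouten φ k l z * u l)
      + schoutenTrace φ z * (kron k l * u l) := fun l => by rw [flatRicci]; ring
  simp only [this, sum_add_distrib, ← mul_sum, sum_kron_mul]

variable (h : IsFlatSoliton φ f ρ U) (hz : z ∈ U)
include h hz

theorem partialDeriv_partialDeriv_potential (i j : Fin n) : 𝔡 i (𝔡 j f) z =
    ρ * (Real.exp (2 * φ z) * kron i j) - flatRicci φ i j z + 𝔡 i φ z * 𝔡 j f z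
      + 𝔡 j φ z * 𝔡 i f z - (∑ d, 𝔡 d φ z * 𝔡 d f z) * kron i j := by
  have := h.equation z hz i j
  rw [flatHessian] at this
  linear_combination this

/-- The function ⟨∇φ, ∇f⟩ enters the conformal Hessian and is differentiated in
`partialDeriv_third`. Both Hessians it produces are eliminated, that of φ by the Schouten tensor and
that of f by the soliton equation. -/
theorem partialDeriv_gradInner (k : Fin n) : 𝔡 k (fun w => ∑ d, 𝔡 d φ w * 𝔡 d f w) z =
    - ∑ l, schouten φ k l z * 𝔡 l f z + 𝔡 k φ z * (∑ d, 𝔡 d φ z * 𝔡 d f z)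
      + (1 / 2 : ℝ) * (∑ d, 𝔡 d φ z ^ 2) * 𝔡 k f z + ρ * Real.exp (2 * φ z) * 𝔡 k φ z
      - (n - 2) * (∑ l, schouten φ k l z * 𝔡 l φ z) - schoutenTrace φ z * 𝔡 k φ z := by
  have d1 : ∀ i, DifferentiableAt ℝ (𝔡 i φ) z := fun i =>
    (contDiffAt_partialDeriv (i := i) (h.smooth_factor z hz)).differentiableAt (by simp)
  have d2 : ∀ i, DifferentiableAt ℝ (𝔡 i f) z := fun i =>
    (contDiffAt_partialDeriv (i := i) (h.smooth_potential z hz)).differentiableAt (by simp)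
  rw [partialDeriv_sum (w := fun d w => 𝔡 d φ w * 𝔡 d f w) _ fun d _ => (d1 d).mul (d2 d)]
  have hr := sum_flatRicci_mul φ z k fun l => 𝔡 l φ z
  generalize hc : ∑ d, 𝔡 d φ z * 𝔡 d f z = c
  have : ∀ l, 𝔡 k (fun w => 𝔡 l φ w * 𝔡 l f w) z = - (schouten φ k l z * 𝔡 l f z)
      + 𝔡 k φ z * (𝔡 l φ z * 𝔡 l f z)
      - (1 / 2 : ℝ) * (∑ d, 𝔡 d φ z ^ 2) * (kron k l * 𝔡 l f z)
      + ρ * Real.exp (2 * φ z) * (kron k l * 𝔡 l φ z) - flatRicci φ k l z * 𝔡 l φ z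
      + 𝔡 k φ z * (𝔡 l φ z * 𝔡 l f z) + 𝔡 k f z * 𝔡 l φ z ^ 2 - c * (kron k l * 𝔡 l φ z) := by
    intro l
    rw [partialDeriv_mul (d1 l) (d2 l), partialDeriv_partialDeriv_eq_schouten,
      h.partialDeriv_partialDeriv_potential hz, hc]
    ring
  simp only [this, sum_sub_distrib, sum_add_distrib, ← mul_sum, sum_neg_distrib, sum_kron_mul, hr,
    hc]
  ring

theorem partialDeriv_third (k i j : Fin n) : 𝔡 k (𝔡 i (𝔡 j f)) z =
    2 * ρ * Real.exp (2 * φ z) * 𝔡 k φ z * kron i j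
      - ((n - 2) * 𝔡 k (schouten φ i j) z + 𝔡 k (schoutenTrace φ) z * kron i j)
      + (𝔡 k (𝔡 i φ) z * 𝔡 j f z + 𝔡 i φ z * 𝔡 k (𝔡 j f) z)
      + (𝔡 k (𝔡 j φ) z * 𝔡 i f z + 𝔡 j φ z * 𝔡 k (𝔡 i f) z)
      - 𝔡 k (fun w => ∑ d, 𝔡 d φ w * 𝔡 d f w) z * kron i j := by
  have d1 : ∀ i, DifferentiableAt ℝ (𝔡 i φ) z := fun i =>
    (contDiffAt_partialDeriv (i := i) (h.smooth_factor z hz)).differentiableAt (by simp)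
  have d2 : ∀ i, DifferentiableAt ℝ (𝔡 i f) z := fun i =>
    (contDiffAt_partialDeriv (i := i) (h.smooth_potential z hz)).differentiableAt (by simp)
  have dφ : DifferentiableAt ℝ φ z := (h.smooth_factor z hz).differentiableAt (by simp)
  have dS : DifferentiableAt ℝ (schouten φ i j) z :=
    (contDiffAt_schouten (h.smooth_factor z hz) i j).differentiableAt (by simp)
  have dJ : DifferentiableAt ℝ (schoutenTrace φ) z :=
    (contDiffAt_schoutenTrace (h.smooth_factor z hz)).differentiableAt (by simp)
  have dr : DifferentiableAt ℝ (flatRicci φ i j) z :=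
    (contDiffAt_flatRicci (h.smooth_factor z hz) i j).differentiableAt (by simp)
  have dc : DifferentiableAt ℝ (fun w => ∑ d, 𝔡 d φ w * 𝔡 d f w) z :=
    DifferentiableAt.fun_sum fun d _ => (d1 d).fun_mul (d2 d)
  have dE : DifferentiableAt ℝ (fun w => Real.exp (2 * φ w)) z := (dφ.const_mul 2).exp
  rw [partialDeriv_congr_on h.isOpen
    (fun w hw => h.partialDeriv_partialDeriv_potential hw i j) hz,
    partialDeriv_sub (((((dE.mul_const _).const_mul _).fun_sub dr).fun_add
      ((d1 i).fun_mul (d2 j))).fun_add ((d1 j).fun_mul (d2 i))) (dc.mul_const _),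
    partialDeriv_add ((((dE.mul_const _).const_mul _).fun_sub dr).fun_add
      ((d1 i).fun_mul (d2 j))) ((d1 j).fun_mul (d2 i)),
    partialDeriv_add (((dE.mul_const _).const_mul _).fun_sub dr) ((d1 i).fun_mul (d2 j)),
    partialDeriv_sub ((dE.mul_const _).const_mul _) dr,
    partialDeriv_const_mul _ (dE.mul_const _), partialDeriv_mul_const _ dE,
    partialDeriv_exp (dφ.const_mul 2), partialDeriv_const_mul _ dφ,
    partialDeriv_mul (d1 i) (d2 j), partialDeriv_mul (d1 j) (d2 i), partialDeriv_mul_const _ dc,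
    show flatRicci φ i j = fun w => (n - 2) * schouten φ i j w + schoutenTrace φ w * kron i j
      from rfl, partialDeriv_add (dS.const_mul _) (dJ.mul_const _),
    partialDeriv_const_mul _ dS, partialDeriv_mul_const _ dJ]
  ring

/-- The algebraic constraint on the Schouten tensor that comes from commuting the third derivatives
of the potential. -/
theorem schouten_mul_sub (k i j : Fin n) :
    schouten φ i j z * 𝔡 k f z - schouten φ k j z * 𝔡 i f z
      + (- 𝔡 k (schoutenTrace φ) z + 2 * schoutenTrace φ z * 𝔡 k φ z
          + ∑ l, schouten φ k l z * 𝔡 l f z) * kron i j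
      - (- 𝔡 i (schoutenTrace φ) z + 2 * schoutenTrace φ z * 𝔡 i φ z
          + ∑ l, schouten φ i l z * 𝔡 l f z) * kron k j = 0 := by
  have hφ := h.smooth_factor z hz
  have h1 := h.partialDeriv_third hz k i j
  have h2 := h.partialDeriv_third hz i k j
  have h3 := partialDeriv_comm (i := i) (j := k)
    (contDiffAt_partialDeriv (i := j) (h.smooth_potential z hz))
  have h4 := partialDeriv_schouten_sub hφ k i j
  have h5 := partialDeriv_comm (i := i) (j := k) hφ
  have h6 := partialDeriv_comm (i := i) (j := k) (h.smooth_potential z hz)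
  rw [h.partialDeriv_gradInner hz] at h1 h2
  rw [h5, h6] at h2
  rw [h1, h2] at h3
  rw [h.partialDeriv_partialDeriv_potential hz k j, h.partialDeriv_partialDeriv_potential hz i j,
    partialDeriv_partialDeriv_eq_schouten k j, partialDeriv_partialDeriv_eq_schouten i j,
    flatRicci, flatRicci] at h3
  -- In the symmetry of the third derivatives of f, the Schouten tensor is differentiated only
  -- through its antisymmetrization and its trace. The Cotton identity removes the former.
  linear_combination -h3 + (n - 2) * h4

/-- The contraction over i = j of the constraint. It determines the unknown vector multiplying the
Kronecker deltas there, and it is ∇R = 2 Ric(∇f) in flat terms. -/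
theorem schouten_mul_sub_trace (k : Fin n) :
    schoutenTrace φ z * 𝔡 k f z - ∑ l, schouten φ k l z * 𝔡 l f z
      + (n - 1) * (- 𝔡 k (schoutenTrace φ) z + 2 * schoutenTrace φ z * 𝔡 k φ z
          + ∑ l, schouten φ k l z * 𝔡 l f z) = 0 := by
  have h1 := sum_eq_zero fun i (_ : i ∈ univ) => h.schouten_mul_sub hz k i i
  have h2 := sum_kron_mul k fun i => - 𝔡 i (schoutenTrace φ) z
    + 2 * schoutenTrace φ z * 𝔡 i φ z + ∑ l, schouten φ i l z * 𝔡 l f z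
  simp only [sum_sub_distrib, sum_add_distrib, ← sum_mul, kron_self, mul_one, sum_const,
    card_univ, Fintype.card_fin, nsmul_eq_mul] at h1
  rw [sum_congr rfl fun x _ => mul_comm _ (kron k x), h2] at h1
  rw [schoutenTrace] at h1 ⊢
  linear_combination h1

/-- `∇R = 2 Ric(∇f)`. -/
theorem partialDeriv_flatScalar (k : Fin n) : 𝔡 k (flatScalar φ) z =
    2 * Real.exp (-(2 * φ z)) * ∑ l, flatRicci φ k l z * 𝔡 l f z := by
  have hφ := h.smooth_factor z hz
  have dφ : DifferentiableAt ℝ φ z := hφ.differentiableAt (by simp)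
  have dJ : DifferentiableAt ℝ (schoutenTrace φ) z :=
    (contDiffAt_schoutenTrace hφ).differentiableAt (by simp)
  rw [show flatScalar φ = fun w => Real.exp (-(2 * φ w)) * (2 * (n - 1) * schoutenTrace φ w) from
    funext fun w => by rw [flatScalar, sum_flatRicci_self],
    partialDeriv_mul (dφ.const_mul 2).fun_neg.exp (dJ.const_mul _),
    partialDeriv_exp (dφ.const_mul 2).fun_neg, partialDeriv_neg, partialDeriv_const_mul _ dφ,
    partialDeriv_const_mul _ dJ, sum_flatRicci_mul]
  linear_combination -2 * Real.exp (-(2 * φ z)) * h.schouten_mul_sub_trace hz k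

theorem flatLaplacian_potential : flatLaplacian φ f z = n * ρ - flatScalar φ z := by
  have hE : Real.exp (-(2 * φ z)) * Real.exp (2 * φ z) = 1 := by
    rw [← Real.exp_add]; simp
  have : ∀ i, 𝔡 i (𝔡 i f) z = ρ * Real.exp (2 * φ z) - flatRicci φ i i z
      + 2 * (𝔡 i φ z * 𝔡 i f z) - (∑ d, 𝔡 d φ z * 𝔡 d f z) := fun i => by
    rw [h.partialDeriv_partialDeriv_potential hz, kron_self]; ring
  rw [flatLaplacian, flatScalar]
  simp only [this, sum_sub_distrib, sum_add_distrib, ← mul_sum, sum_const, card_univ,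
    Fintype.card_fin, nsmul_eq_mul]
  linear_combination n * ρ * hE

/-- ∇|∇f|² is twice Hess f applied to ∇f; the soliton equation and ∇R = 2 Ric(∇f) finish.
Equivalently, R + |∇f|² - 2ρf is locally constant. -/
theorem partialDeriv_gradNormSq (i : Fin n) :
    𝔡 i (flatGradInner φ f f) z = 2 * ρ * 𝔡 i f z - 𝔡 i (flatScalar φ) z := by
  have hE : Real.exp (-(2 * φ z)) * Real.exp (2 * φ z) = 1 := by
    rw [← Real.exp_add]; simp
  have dφ : DifferentiableAt ℝ φ z := (h.smooth_factor z hz).differentiableAt (by simp)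
  have d2 : ∀ i, DifferentiableAt ℝ (𝔡 i f) z := fun i =>
    (contDiffAt_partialDeriv (i := i) (h.smooth_potential z hz)).differentiableAt (by simp)
  have ds : DifferentiableAt ℝ (fun w => ∑ d, 𝔡 d f w * 𝔡 d f w) z :=
    DifferentiableAt.fun_sum fun d _ => (d2 d).fun_mul (d2 d)
  have e : 𝔡 i (fun w => ∑ d, 𝔡 d f w * 𝔡 d f w) z = 2 * (ρ * Real.exp (2 * φ z) * 𝔡 i f z
      - ∑ l, flatRicci φ i l z * 𝔡 l f z + 𝔡 i φ z * ∑ d, 𝔡 d f z * 𝔡 d f z) := by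
    rw [partialDeriv_sum (w := fun d w => 𝔡 d f w * 𝔡 d f w) _ fun d _ => (d2 d).fun_mul (d2 d)]
    generalize hc : ∑ d, 𝔡 d φ z * 𝔡 d f z = c
    have : ∀ l, 𝔡 i (fun w => 𝔡 l f w * 𝔡 l f w) z =
        2 * (ρ * Real.exp (2 * φ z) * (kron i l * 𝔡 l f z) - flatRicci φ i l z * 𝔡 l f z
        + 𝔡 i φ z * (𝔡 l f z * 𝔡 l f z) + 𝔡 i f z * (𝔡 l φ z * 𝔡 l f z)
        - c * (kron i l * 𝔡 l f z)) := fun l => by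
      rw [partialDeriv_mul (d2 l) (d2 l), h.partialDeriv_partialDeriv_potential hz, hc]; ring
    simp only [this, sum_sub_distrib, sum_add_distrib, ← mul_sum, sum_kron_mul, hc]
    ring
  rw [show flatGradInner φ f f = fun w => Real.exp (-(2 * φ w)) * ∑ d, 𝔡 d f w * 𝔡 d f w from rfl,
    partialDeriv_mul (dφ.const_mul 2).fun_neg.exp ds, e,
    partialDeriv_exp (dφ.const_mul 2).fun_neg, partialDeriv_neg, partialDeriv_const_mul _ dφ,
    h.partialDeriv_flatScalar hz]
  linear_combination 2 * ρ * 𝔡 i f z * hE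

/-- The contracted Bianchi identity in flat derivatives, read off from the divergence of the
Schouten tensor. -/
theorem sum_partialDeriv_flatRicci (k : Fin n) : ∑ i, 𝔡 i (flatRicci φ k i) z =
    (n - 1) * 𝔡 k (schoutenTrace φ) z - (n - 2) * schoutenTrace φ z * 𝔡 k φ z
      - (n - 2) ^ 2 * ∑ l, schouten φ k l z * 𝔡 l φ z := by
  have hφ := h.smooth_factor z hz
  have dS : ∀ i j, DifferentiableAt ℝ (schouten φ i j) z := fun i j =>
    (contDiffAt_schouten hφ i j).differentiableAt (by simp)
  have dJ : DifferentiableAt ℝ (schoutenTrace φ) z :=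
    (contDiffAt_schoutenTrace hφ).differentiableAt (by simp)
  have : ∀ i, 𝔡 i (flatRicci φ k i) z =
      (n - 2) * 𝔡 i (schouten φ k i) z + kron k i * 𝔡 i (schoutenTrace φ) z := fun i => by
    rw [show flatRicci φ k i = fun w => (n - 2) * schouten φ k i w + schoutenTrace φ w * kron k i
        from rfl, partialDeriv_add ((dS k i).const_mul _) (dJ.mul_const _),
      partialDeriv_const_mul _ (dS k i), partialDeriv_mul_const _ dJ]
    ring
  simp only [this, sum_add_distrib, ← mul_sum, sum_kron_mul, sum_partialDeriv_schouten hφ]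
  ring

/-- `ΔR - ⟨∇f, ∇R⟩ = 2ρR - 2|Ric|²`. -/
theorem flatLaplacian_flatScalar : flatLaplacian φ (flatScalar φ) z =
    flatGradInner φ f (flatScalar φ) z + 2 * ρ * flatScalar φ z - 2 * flatRicciNormSq φ z := by
  have hφ := h.smooth_factor z hz
  have hE : Real.exp (-(2 * φ z)) * Real.exp (2 * φ z) = 1 := by
    rw [← Real.exp_add]; simp
  have dφ : DifferentiableAt ℝ φ z := hφ.differentiableAt (by simp)
  have d2 : ∀ i, DifferentiableAt ℝ (𝔡 i f) z := fun i =>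
    (contDiffAt_partialDeriv (i := i) (h.smooth_potential z hz)).differentiableAt (by simp)
  have dr : ∀ i j, DifferentiableAt ℝ (flatRicci φ i j) z := fun i j =>
    (contDiffAt_flatRicci hφ i j).differentiableAt (by simp)
  have ds : ∀ k, DifferentiableAt ℝ (fun w => ∑ l, flatRicci φ k l w * 𝔡 l f w) z := fun k =>
    DifferentiableAt.fun_sum fun l _ => (dr k l).fun_mul (d2 l)
  have dw : DifferentiableAt ℝ (fun w => Real.exp (-(2 * φ w))) z :=
    (dφ.const_mul 2).fun_neg.exp
  set w := Real.exp (-(2 * φ z)) with hw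
  -- Differentiating ∇R = 2 Ric(∇f) once more splits ΔR into the divergence of Ric paired with ∇f
  -- (`h2`) and Ric paired with Hess f (`h3`). The soliton equation in the second gives ρR - |Ric|².
  have h1 : ∀ k, 𝔡 k (𝔡 k (flatScalar φ)) z =
      2 * w * (-2 * (𝔡 k φ z * ∑ l, flatRicci φ k l z * 𝔡 l f z)
        + ∑ l, (𝔡 k (flatRicci φ k l) z * 𝔡 l f z + flatRicci φ k l z * 𝔡 k (𝔡 l f) z)) := by
    intro k
    rw [partialDeriv_congr_on h.isOpen (fun w hw => h.partialDeriv_flatScalar hw k) hz,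
      partialDeriv_mul (dw.const_mul _) (ds k), partialDeriv_const_mul _ dw,
      partialDeriv_exp (dφ.const_mul 2).fun_neg, partialDeriv_neg, partialDeriv_const_mul _ dφ,
      partialDeriv_sum (w := fun l w => flatRicci φ k l w * 𝔡 l f w) _
        fun l _ => (dr k l).fun_mul (d2 l)]
    simp only [fun l => partialDeriv_mul (i := k) (dr k l) (d2 l)]
    rw [← hw]; ring
  have h2 : ∑ k, ∑ l, 𝔡 k (flatRicci φ k l) z * 𝔡 l f z =
      (n - 1) * ∑ l, 𝔡 l (schoutenTrace φ) z * 𝔡 l f z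
      - (n - 2) * schoutenTrace φ z * (∑ l, 𝔡 l φ z * 𝔡 l f z)
      - (n - 2) ^ 2 * ∑ l, 𝔡 l φ z * ∑ k, schouten φ l k z * 𝔡 k f z := by
    have hs : ∀ k l, 𝔡 k (flatRicci φ k l) z = 𝔡 k (flatRicci φ l k) z := fun k l =>
      partialDeriv_congr_on h.isOpen (fun w hw => flatRicci_comm (h.smooth_factor w hw) k l) hz
    have hs2 : ∑ l, (∑ k, schouten φ l k z * 𝔡 k φ z) * 𝔡 l f z =
        ∑ l, 𝔡 l φ z * ∑ k, schouten φ l k z * 𝔡 k f z := by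
      simp only [sum_mul, mul_sum]
      rw [sum_comm]
      exact sum_congr rfl fun l _ => sum_congr rfl fun k _ => by
        rw [schouten_comm hφ]; ring
    rw [sum_comm, sum_congr rfl fun l _ => (sum_mul _ _ _).symm]
    simp only [hs, h.sum_partialDeriv_flatRicci hz]
    rw [← hs2]
    simp only [mul_sum _ _ ((n : ℝ) - 1), mul_sum _ _ (((n : ℝ) - 2) ^ 2),
      mul_sum _ _ (((n : ℝ) - 2) * schoutenTrace φ z), ← sum_sub_distrib]
    exact sum_congr rfl fun l _ => by rw [← mul_sum]; ring
  have h3 : ∑ k, ∑ l, flatRicci φ k l z * 𝔡 k (𝔡 l f) z =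
      ρ * Real.exp (2 * φ z) * (∑ i, flatRicci φ i i z) - ∑ i, ∑ j, flatRicci φ i j z ^ 2
      + 2 * (∑ k, 𝔡 k φ z * ∑ l, flatRicci φ k l z * 𝔡 l f z)
      - (∑ d, 𝔡 d φ z * 𝔡 d f z) * ∑ i, flatRicci φ i i z := by
    have e1 : ∑ k, ∑ l, 𝔡 l φ z * 𝔡 k f z * flatRicci φ k l z =
        ∑ k, 𝔡 k φ z * ∑ l, flatRicci φ k l z * 𝔡 l f z := by
      simp only [mul_sum]
      rw [sum_comm]
      exact sum_congr rfl fun l _ => sum_congr rfl fun k _ => by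
        rw [flatRicci_comm hφ]; ring
    have e2 : ∑ k, ∑ l, 𝔡 k φ z * 𝔡 l f z * flatRicci φ k l z =
        ∑ k, 𝔡 k φ z * ∑ l, flatRicci φ k l z * 𝔡 l f z := by
      simp only [mul_sum]
      exact sum_congr rfl fun l _ => sum_congr rfl fun k _ => by ring
    generalize hc : ∑ d, 𝔡 d φ z * 𝔡 d f z = c
    have : ∀ k l, flatRicci φ k l z * 𝔡 k (𝔡 l f) z =
        ρ * Real.exp (2 * φ z) * (kron k l * flatRicci φ k l z) - flatRicci φ k l z ^ 2
        + 𝔡 k φ z * 𝔡 l f z * flatRicci φ k l z + 𝔡 l φ z * 𝔡 k f z * flatRicci φ k l z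
        - c * (kron k l * flatRicci φ k l z) := fun k l => by
      rw [h.partialDeriv_partialDeriv_potential hz, hc]; ring
    simp only [this, sum_sub_distrib, sum_add_distrib, ← mul_sum, e1, e2]
    simp only [sum_kron_mul _ fun l => flatRicci φ _ l z]
    ring
  have h4 : ∑ k, 𝔡 k φ z * 𝔡 k (flatScalar φ) z =
      2 * w * ∑ k, 𝔡 k φ z * ∑ l, flatRicci φ k l z * 𝔡 l f z := by
    rw [mul_sum]
    exact sum_congr rfl fun k _ => by rw [h.partialDeriv_flatScalar hz, ← hw]; ring
  have h5 : ∑ k, 𝔡 k f z * 𝔡 k (flatScalar φ) z =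
      2 * (n - 1) * w * (∑ k, 𝔡 k (schoutenTrace φ) z * 𝔡 k f z
        - 2 * schoutenTrace φ z * ∑ k, 𝔡 k φ z * 𝔡 k f z) := by
    rw [mul_sum, ← sum_sub_distrib, mul_sum]
    refine sum_congr rfl fun k _ => ?_
    rw [h.partialDeriv_flatScalar hz, sum_flatRicci_mul, ← hw]
    linear_combination 2 * w * 𝔡 k f z * h.schouten_mul_sub_trace hz k
  have h6 : ∑ k, 𝔡 k φ z * ∑ l, flatRicci φ k l z * 𝔡 l f z =
      (n - 2) * (∑ l, 𝔡 l φ z * ∑ k, schouten φ l k z * 𝔡 k f z)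
      + schoutenTrace φ z * ∑ l, 𝔡 l φ z * 𝔡 l f z := by
    simp only [sum_flatRicci_mul]
    rw [mul_sum, mul_sum, ← sum_add_distrib]
    exact sum_congr rfl fun k _ => by ring
  rw [flatLaplacian, flatGradInner, flatScalar, flatRicciNormSq, ← hw, h5]
  simp only [h1, ← mul_sum, sum_add_distrib]
  rw [h2, h3, h4, h6, sum_flatRicci_self]
  linear_combination 4 * w * ρ * (n - 1) * schoutenTrace φ z * hE

end IsFlatSoliton

/-! ### The pinching function -/

section Pinching

variable {n : ℕ} {φ f : EuclideanSpace ℝ (Fin n) → ℝ} {ρ : ℝ}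
  {U : Set (EuclideanSpace ℝ (Fin n))} {z : EuclideanSpace ℝ (Fin n)}

/-- The differential of `u` at `z` is `c` times the differential of `f`. -/
def HasSlope (f u : EuclideanSpace ℝ (Fin n) → ℝ) (c : ℝ) (z : EuclideanSpace ℝ (Fin n)) : Prop :=
  DifferentiableAt ℝ u z ∧ ∀ i, 𝔡 i u z = c * 𝔡 i f z

namespace HasSlope

variable {u v : EuclideanSpace ℝ (Fin n) → ℝ} {c d : ℝ}

theorem const (r : ℝ) : HasSlope f (fun _ => r) 0 z :=
  ⟨differentiableAt_const r, fun i => by rw [partialDeriv_const, zero_mul]⟩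

theorem add (hu : HasSlope f u c z) (hv : HasSlope f v d z) :
    HasSlope f (fun w => u w + v w) (c + d) z :=
  ⟨hu.1.fun_add hv.1, fun i => by rw [partialDeriv_add hu.1 hv.1, hu.2, hv.2]; ring⟩

theorem sub (hu : HasSlope f u c z) (hv : HasSlope f v d z) :
    HasSlope f (fun w => u w - v w) (c - d) z :=
  ⟨hu.1.fun_sub hv.1, fun i => by rw [partialDeriv_sub hu.1 hv.1, hu.2, hv.2]; ring⟩

theorem mul (hu : HasSlope f u c z) (hv : HasSlope f v d z) :
    HasSlope f (fun w => u w * v w) (c * v z + u z * d) z :=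
  ⟨hu.1.fun_mul hv.1, fun i => by rw [partialDeriv_mul hu.1 hv.1, hu.2, hv.2]; ring⟩

theorem comp_real {θ : ℝ → ℝ} {θ' : ℝ} (hu : HasSlope f u c z) (hθ : HasDerivAt θ θ' (u z)) :
    HasSlope f (fun w => θ (u w)) (θ' * c) z :=
  ⟨hθ.differentiableAt.comp z hu.1, fun i => by
    rw [partialDeriv_comp_real hθ hu.1, hu.2]; ring⟩

theorem div (hu : HasSlope f u c z) (hv : HasSlope f v d z) (h0 : v z ≠ 0) :
    HasSlope f (fun w => u w / v w) ((c * v z - u z * d) / v z ^ 2) z := by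
  have h := hu.mul (hv.comp_real (hasDerivAt_inv h0))
  simp only [div_eq_mul_inv] at h ⊢
  convert h using 1
  field_simp
  ring

theorem pow_two (hu : HasSlope f u c z) : HasSlope f (fun w => u w ^ 2) (2 * u z * c) z := by
  have h := hu.mul hu
  simp only [← sq] at h
  convert h using 1
  ring

theorem congr_of_eqOn {W : Set (EuclideanSpace ℝ (Fin n))} (hu : HasSlope f u c z)
    (hW : IsOpen W) (hz : z ∈ W) (h : ∀ w ∈ W, v w = u w) : HasSlope f v c z :=
  ⟨hu.1.congr_of_eventuallyEq (eventually_of_mem (hW.mem_nhds hz) h), fun i => by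
    rw [partialDeriv_congr_on hW h hz, hu.2]⟩

theorem congr_slope (hu : HasSlope f u c z) (h : c = d) : HasSlope f u d z := h ▸ hu

/-- Where gradients are parallel to ∇f, u behaves like a function of f with first derivative s and
second derivative s', and Δu = u''|∇f|² + u'Δf. -/
theorem flatLaplacian_eq {W : Set (EuclideanSpace ℝ (Fin n))} (hW : IsOpen W) (hz : z ∈ W)
    (hf : ContDiffAt ℝ ∞ f z) {s : EuclideanSpace ℝ (Fin n) → ℝ} {s' : ℝ}
    (hu : ∀ w ∈ W, HasSlope f u (s w) w) (hs : HasSlope f s s' z) :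
    flatLaplacian φ u z = s' * flatGradInner φ f f z + s z * flatLaplacian φ f z := by
  have d2 : ∀ i, DifferentiableAt ℝ (𝔡 i f) z := fun i =>
    (contDiffAt_partialDeriv (i := i) hf).differentiableAt (by simp)
  have h1 : ∀ i, 𝔡 i (𝔡 i u) z = s' * (𝔡 i f z * 𝔡 i f z) + s z * 𝔡 i (𝔡 i f) z := fun i => by
    rw [partialDeriv_congr_on hW (fun w hw => (hu w hw).2 i) hz, partialDeriv_mul hs.1 (d2 i),
      hs.2]
    ring
  have h2 : ∀ i, 𝔡 i φ z * 𝔡 i u z = s z * (𝔡 i φ z * 𝔡 i f z) := fun i => by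
    rw [(hu z hz).2]; ring
  rw [flatLaplacian, flatLaplacian, flatGradInner]
  simp only [h1, h2, sum_add_distrib, ← mul_sum]
  ring

theorem flatGradInner_right (hv : HasSlope f v d z) (u : EuclideanSpace ℝ (Fin n) → ℝ) :
    flatGradInner φ u v z = d * flatGradInner φ u f z := by
  have : ∀ i, 𝔡 i u z * 𝔡 i v z = d * (𝔡 i u z * 𝔡 i f z) := fun i => by rw [hv.2]; ring
  rw [flatGradInner, flatGradInner]
  simp only [this, ← mul_sum]
  ring

end HasSlope

theorem flatGradInner_comm (u v : EuclideanSpace ℝ (Fin n) → ℝ) :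
    flatGradInner φ u v z = flatGradInner φ v u z := by
  simp only [flatGradInner, mul_comm (𝔡 _ u z)]

/-- The operator `Δu - ⟨∇f, ∇u⟩ + 2 ⟨∇ log R, ∇u⟩`. -/
def driftLaplacian (φ f u : EuclideanSpace ℝ (Fin n) → ℝ) (y : EuclideanSpace ℝ (Fin n)) : ℝ :=
  flatLaplacian φ u y - flatGradInner φ f u y
    + 2 / flatScalar φ y * flatGradInner φ (flatScalar φ) u y

/-- The scale invariant measure of the failure of `exp (2 φ) δ` to be Einstein. -/
def pinching (φ : EuclideanSpace ℝ (Fin n) → ℝ) (y : EuclideanSpace ℝ (Fin n)) : ℝ :=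
  (n * flatRicciNormSq φ y - flatScalar φ y ^ 2) / ((n - 1) * flatScalar φ y ^ 2)

/-- The eigenvalue of the Ricci tensor in the direction of `∇f`, where `∇f ≠ 0`. -/
def radialRicci (φ f : EuclideanSpace ℝ (Fin n) → ℝ) (y : EuclideanSpace ℝ (Fin n)) : ℝ :=
  (∑ i, 𝔡 i (flatScalar φ) y * 𝔡 i f y) / (2 * ∑ i, 𝔡 i f y ^ 2)

namespace IsFlatSoliton

variable (h : IsFlatSoliton φ f ρ U) (hn : 3 ≤ n) (hz : z ∈ U)
include h hn hz

/-- Where `∇f ≠ 0`, the Ricci tensor has `∇f` as an eigenvector and is a multiple of the metric on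
the orthogonal complement. -/
theorem exists_radial (hne : ∑ i, 𝔡 i f z ^ 2 ≠ 0) : ∃ r : ℝ,
    (∀ i, 𝔡 i (flatScalar φ) z = 2 * r * 𝔡 i f z) ∧
    flatRicciNormSq φ z = r ^ 2 + (flatScalar φ z - r) ^ 2 / (n - 1) := by
  have hn' : (3 : ℝ) ≤ n := by exact_mod_cast hn
  have hm : (n : ℝ) - 1 ≠ 0 := by linarith
  have hm2 : (n : ℝ) - 2 ≠ 0 := by linarith
  set a : Fin n → ℝ := fun i => 𝔡 i f z with ha
  set Q := ∑ i, a i ^ 2 with hQ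
  set p : Fin n → Fin n → ℝ := fun i j => schouten φ i j z with hp
  set J := schoutenTrace φ z with hJ
  set pa : Fin n → ℝ := fun k => ∑ l, p k l * a l with hpa
  set Z : Fin n → ℝ := fun k => - 𝔡 k (schoutenTrace φ) z + 2 * J * 𝔡 k φ z + pa k with hZ
  have hps : ∀ i j, p i j = p j i := schouten_comm (h.smooth_factor z hz)
  have hD : ∀ k i j, p i j * a k - p k j * a i + Z k * kron i j - Z i * kron k j = 0 :=
    fun k i j => h.schouten_mul_sub hz k i j
  have hT : ∀ k, J * a k - pa k + (n - 1) * Z k = 0 := fun k => h.schouten_mul_sub_trace hz k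
  -- The constraint contracted with ∇f in j, with Z eliminated by the trace identity, leaves a
  -- multiple n - 2 of the claim. So ∇f is an eigenvector because n ≥ 3.
  have hpar : ∀ i k, pa i * a k = pa k * a i := by
    intro i k
    have h1 := sum_eq_zero fun j (_ : j ∈ univ) => show
      a k * (p i j * a j) - a i * (p k j * a j) + Z k * (kron i j * a j) - Z i * (kron k j * a j) = 0
      by linear_combination a j * hD k i j
    simp only [sum_sub_distrib, sum_add_distrib, ← mul_sum, sum_kron_mul] at h1
    have h2 : (n - 2 : ℝ) * (pa i * a k - pa k * a i) = 0 := by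
      change a k * pa i - a i * pa k + _ - _ = 0 at h1
      linear_combination (n - 1) * h1 - a i * hT k + a k * hT i
    have := (mul_eq_zero.1 h2).resolve_left hm2
    linarith
  set α := (∑ i, pa i * a i) / Q with hα
  have hαQ : ∑ i, pa i * a i = α * Q := by rw [hα, div_mul_cancel₀ _ hne]
  have hpaα : ∀ k, pa k = α * a k := by
    intro k
    have h1 : ∑ i, pa i * a i * a k = ∑ i, pa k * a i ^ 2 :=
      sum_congr rfl fun i _ => by linear_combination a i * hpar i k
    rw [← sum_mul, ← mul_sum, hαQ] at h1
    exact mul_right_cancel₀ hne (by rw [← hQ] at h1; linear_combination -h1)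
  -- The trace J is α plus n - 1 copies of the eigenvalue on the complement of ∇f, which fixes the
  -- candidate β.
  set β := (J - α) / (n - 1) with hβ
  have hβm : (n - 1) * β = J - α := by rw [hβ]; field_simp
  have hZβ : ∀ k, Z k = - β * a k := fun k => by
    have := hT k
    rw [hpaα] at this
    exact mul_left_cancel₀ hm (by linear_combination this + a k * hβm)
  -- Now Z is known, so contracting the constraint with ∇f in k solves for the whole Schouten
  -- tensor: β on the complement, α along ∇f.
  have hpij : ∀ i j, p i j = β * kron i j + (α - β) / Q * (a i * a j) := by
    intro i j
    have h1 := sum_eq_zero fun k (_ : k ∈ univ) => show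
      p i j * a k ^ 2 - a i * (p j k * a k) - β * kron i j * a k ^ 2 + β * a i * (kron k j * a k) = 0
      by
        have := hD k i j
        rw [hZβ, hZβ, hps k j] at this
        linear_combination a k * this
    simp only [sum_sub_distrib, sum_add_distrib, ← mul_sum, sum_kron_mul'] at h1
    change p i j * Q - a i * pa j - β * kron i j * Q + _ = 0 at h1
    rw [hpaα] at h1
    field_simp
    linear_combination h1
  have hw := h.partialDeriv_flatScalar hz
  set w := Real.exp (-(2 * φ z)) with hwdef
  have hra : ∀ k, ∑ l, flatRicci φ k l z * a l = ((n - 2) * α + J) * a k := fun k => by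
    rw [sum_flatRicci_mul]
    change (n - 2) * pa k + J * a k = _
    rw [hpaα]; ring
  have hsc : flatScalar φ z = w * (2 * (n - 1) * J) := by
    rw [flatScalar, sum_flatRicci_self]
  have hsq : ∑ i, ∑ j, flatRicci φ i j z ^ 2 =
      ((n - 2) * α + J) ^ 2 + (n - 1) * ((n - 2) * β + J) ^ 2 := by
    have hr : ∀ i j, flatRicci φ i j z ^ 2 =
        (((n - 2) * β + J) ^ 2 * kron i j) * kron i j
        + (2 * ((n - 2) * β + J) * ((n - 2) * (α - β) / Q)) * a i * (kron i j * a j)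
        + ((n - 2) * (α - β) / Q) ^ 2 * a i ^ 2 * a j ^ 2 := fun i j => by
      change ((n - 2) * p i j + J * kron i j) ^ 2 = _
      rw [hpij]; ring
    have hk : ∑ i : Fin n, kron i i = n := by simp
    simp only [hr, sum_add_distrib, ← mul_sum, sum_kron_mul, mul_assoc]
    simp only [← mul_assoc, ← sum_mul, ← sq]
    rw [← hQ, hk]
    field_simp
    ring
  refine ⟨w * ((n - 2) * α + J), fun i => ?_, ?_⟩
  · rw [hw]; change 2 * w * (∑ l, flatRicci φ i l z * a l) = _; rw [hra]; ring
  · have e : flatScalar φ z - w * ((n - 2) * α + J) = w * ((n - 1) * ((n - 2) * β + J)) := by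
      rw [hsc]; linear_combination -w * (n - 2) * hβm
    rw [e, flatRicciNormSq, hsq, ← hwdef]
    field_simp

/-- The eigenvalue r is unique as ∇f ≠ 0, so it equals the explicit quotient `radialRicci`. This
makes it a smooth function that can be differentiated. -/
theorem radial_eqs (hne : ∑ i, 𝔡 i f z ^ 2 ≠ 0) :
    (∀ i, 𝔡 i (flatScalar φ) z = 2 * radialRicci φ f z * 𝔡 i f z) ∧
    flatRicciNormSq φ z = radialRicci φ f z ^ 2
      + (flatScalar φ z - radialRicci φ f z) ^ 2 / (n - 1) := by
  obtain ⟨r, hr1, hr2⟩ := h.exists_radial hn hz hne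
  have : radialRicci φ f z = r := by
    rw [radialRicci]
    simp only [hr1]
    rw [sum_congr rfl fun x _ => show 2 * r * 𝔡 x f z * 𝔡 x f z = 2 * r * 𝔡 x f z ^ 2 by ring,
      ← mul_sum]
    field_simp
  rw [this]
  exact ⟨hr1, hr2⟩

omit hn in
theorem contDiffAt_flatScalar : ContDiffAt ℝ ∞ (flatScalar φ) z :=
  ((contDiffAt_const.mul (h.smooth_factor z hz)).neg.exp).mul
    (ContDiffAt.sum fun i _ => contDiffAt_flatRicci (h.smooth_factor z hz) i i)

omit hn in
theorem contDiffAt_flatRicciNormSq : ContDiffAt ℝ ∞ (flatRicciNormSq φ) z :=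
  ((contDiffAt_const.mul (h.smooth_factor z hz)).neg.exp.pow 2).mul
    (ContDiffAt.sum fun i _ => ContDiffAt.sum fun j _ =>
      (contDiffAt_flatRicci (h.smooth_factor z hz) i j).pow 2)

omit hn in
theorem contDiffAt_gradNormSq : ContDiffAt ℝ ∞ (flatGradInner φ f f) z :=
  ((contDiffAt_const.mul (h.smooth_factor z hz)).neg.exp).mul
    (ContDiffAt.sum fun _ _ => (contDiffAt_partialDeriv (h.smooth_potential z hz)).mul
      (contDiffAt_partialDeriv (h.smooth_potential z hz)))

omit hn in
theorem contDiffAt_radialRicci (hne : ∑ i, 𝔡 i f z ^ 2 ≠ 0) :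
    ContDiffAt ℝ ∞ (radialRicci φ f) z := by
  have h1 := fun i => contDiffAt_partialDeriv (i := i) (h.smooth_potential z hz)
  have h2 := fun i => contDiffAt_partialDeriv (i := i) (h.contDiffAt_flatScalar hz)
  exact (ContDiffAt.sum fun i _ => (h2 i).mul (h1 i)).div
    (contDiffAt_const.mul (ContDiffAt.sum fun i _ => (h1 i).pow 2)) (mul_ne_zero two_ne_zero hne)

omit hn hz in
theorem isOpen_regular : IsOpen {z ∈ U | ∑ i, 𝔡 i f z ^ 2 ≠ 0} := by
  rw [isOpen_iff_mem_nhds]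
  rintro z ⟨hz, hne⟩
  have hc : ContinuousAt (fun w => ∑ i, 𝔡 i f w ^ 2) z :=
    (ContDiffAt.sum fun i _ => (contDiffAt_partialDeriv (i := i)
      (h.smooth_potential z hz)).pow 2).continuousAt
  filter_upwards [h.isOpen.mem_nhds hz, hc.eventually_ne hne] with w hw1 hw2 using ⟨hw1, hw2⟩

theorem hasSlope_flatScalar (hne : ∑ i, 𝔡 i f z ^ 2 ≠ 0) :
    HasSlope f (flatScalar φ) (2 * radialRicci φ f z) z :=
  ⟨(h.contDiffAt_flatScalar hz).differentiableAt (by simp), (h.radial_eqs hn hz hne).1⟩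

theorem hasSlope_gradNormSq (hne : ∑ i, 𝔡 i f z ^ 2 ≠ 0) :
    HasSlope f (flatGradInner φ f f) (2 * (ρ - radialRicci φ f z)) z :=
  ⟨(h.contDiffAt_gradNormSq hz).differentiableAt (by simp), fun i => by
    rw [h.partialDeriv_gradNormSq hz, (h.radial_eqs hn hz hne).1]; ring⟩

omit h hn hz in
theorem gradNormSq_pos (hne : ∑ i, 𝔡 i f z ^ 2 ≠ 0) : 0 < flatGradInner φ f f z := by
  rw [flatGradInner]
  refine mul_pos (Real.exp_pos _) ?_
  simp only [← sq]
  exact lt_of_le_of_ne (sum_nonneg fun i _ => sq_nonneg _) hne.symm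

/-- From ∇R = 2r∇f and the symmetry of the second derivatives of R and f, ∇r is parallel to ∇f. Its
size follows from computing ΔR twice: 2⟨∇r, ∇f⟩ + 2rΔf = 2r|∇f|² + 2ρR - 2|Ric|². -/
theorem hasSlope_radialRicci (hne : ∑ i, 𝔡 i f z ^ 2 ≠ 0) :
    HasSlope f (radialRicci φ f)
      ((ρ * flatScalar φ z - (radialRicci φ f z ^ 2
          + (flatScalar φ z - radialRicci φ f z) ^ 2 / (n - 1))
        - radialRicci φ f z * (n * ρ - flatScalar φ z)
        + radialRicci φ f z * flatGradInner φ f f z) / flatGradInner φ f f z) z := by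
  have hq := (gradNormSq_pos (φ := φ) hne).ne'
  have hd := (h.contDiffAt_radialRicci hz hne).differentiableAt (by simp)
  refine ⟨hd, fun j => ?_⟩
  have d2 : ∀ i, DifferentiableAt ℝ (𝔡 i f) z := fun i =>
    (contDiffAt_partialDeriv (i := i) (h.smooth_potential z hz)).differentiableAt (by simp)
  have hW := h.isOpen_regular
  have hzW : z ∈ {z ∈ U | ∑ i, 𝔡 i f z ^ 2 ≠ 0} := ⟨hz, hne⟩
  have h1 : ∀ i j, 𝔡 i (𝔡 j (flatScalar φ)) z =
      2 * (𝔡 i (radialRicci φ f) z * 𝔡 j f z + radialRicci φ f z * 𝔡 i (𝔡 j f) z) := by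
    intro i j
    rw [partialDeriv_congr_on hW (fun w hw => (h.radial_eqs hn hw.1 hw.2).1 j) hzW,
      partialDeriv_mul (hd.const_mul 2) (d2 j), partialDeriv_const_mul _ hd]
    ring
  have hpar : ∀ i j, 𝔡 i (radialRicci φ f) z * 𝔡 j f z = 𝔡 j (radialRicci φ f) z * 𝔡 i f z := by
    intro i j
    have e1 := partialDeriv_comm (i := i) (j := j) (h.contDiffAt_flatScalar hz)
    have e2 := partialDeriv_comm (i := i) (j := j) (h.smooth_potential z hz)
    rw [h1, h1, e2] at e1
    linarith
  set S := ∑ i, 𝔡 i (radialRicci φ f) z * 𝔡 i f z with hS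
  have h2 : 𝔡 j (radialRicci φ f) z * ∑ i, 𝔡 i f z ^ 2 = S * 𝔡 j f z := by
    rw [hS, sum_mul, mul_sum]
    exact sum_congr rfl fun i _ => by linear_combination -𝔡 i f z * hpar i j
  have hqw : flatGradInner φ f f z = Real.exp (-(2 * φ z)) * ∑ i, 𝔡 i f z ^ 2 := by
    simp only [flatGradInner, sq]
  have h3 : Real.exp (-(2 * φ z)) * S = ρ * flatScalar φ z - flatRicciNormSq φ z
      - radialRicci φ f z * (n * ρ - flatScalar φ z)
      + radialRicci φ f z * flatGradInner φ f f z := by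
    have e1 := h.flatLaplacian_flatScalar hz
    have e2 := h.flatLaplacian_potential hz
    rw [(h.hasSlope_flatScalar hn hz hne).flatGradInner_right] at e1
    rw [← e2]
    rw [flatLaplacian] at e1 ⊢
    simp only [h1, (h.radial_eqs hn hz hne).1] at e1
    have e3 : ∑ x, 𝔡 x φ z * (2 * radialRicci φ f z * 𝔡 x f z) =
        2 * radialRicci φ f z * ∑ x, 𝔡 x φ z * 𝔡 x f z := by
      rw [mul_sum]; exact sum_congr rfl fun _ _ => by ring
    rw [e3, ← mul_sum, sum_add_distrib, ← mul_sum, ← hS] at e1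
    linear_combination e1 / 2
  rw [← (h.radial_eqs hn hz hne).2, ← h3, div_mul_eq_mul_div, eq_div_iff hq, hqw]
  linear_combination Real.exp (-(2 * φ z)) * h2

/-- With eigenvalues r and, n - 1 times, (R - r)/(n - 1), one has n|Ric|² - R² = (nr - R)²/(n - 1).
The value is 0 for Einstein metrics and 1/(n - 1)² when r = 0, as on a cylinder. -/
theorem pinching_eq (hne : ∑ i, 𝔡 i f z ^ 2 ≠ 0) (hR : flatScalar φ z ≠ 0) : pinching φ z =
    (n * (radialRicci φ f z / flatScalar φ z) - 1) ^ 2 / (n - 1) ^ 2 := by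
  have hn' : (3 : ℝ) ≤ n := by exact_mod_cast hn
  have hm : (n : ℝ) - 1 ≠ 0 := by linarith
  rw [pinching, (h.radial_eqs hn hz hne).2]
  field_simp
  ring

/-- The slope of the ratio of the radial Ricci eigenvalue to the scalar curvature. -/
def ratioSlope (n : ℕ) (ρ r R q : ℝ) : ℝ :=
  ((ρ * R - (r ^ 2 + (R - r) ^ 2 / (n - 1)) - r * (n * ρ - R) + r * q) / q * R - 2 * r ^ 2) / R ^ 2

theorem hasSlope_ratio (hne : ∑ i, 𝔡 i f z ^ 2 ≠ 0) (hR : flatScalar φ z ≠ 0) :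
    HasSlope f (fun w => radialRicci φ f w / flatScalar φ w)
      (ratioSlope n ρ (radialRicci φ f z) (flatScalar φ z) (flatGradInner φ f f z)) z := by
  refine ((h.hasSlope_radialRicci hn hz hne).div (h.hasSlope_flatScalar hn hz hne)
    hR).congr_slope ?_
  rw [ratioSlope]
  ring

/-- The key identity for the drift Laplacian of the pinching function. -/
theorem driftLaplacian_pinching (hne : ∑ i, 𝔡 i f z ^ 2 ≠ 0)
    (hR : ∀ w ∈ U, 0 < flatScalar φ w) : ∃ s : ℝ,
    driftLaplacian φ f (pinching φ) z = 2 * n ^ 2 / (n - 1) ^ 2 * s ^ 2 * flatGradInner φ f f z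
      + 4 * n * pinching φ z * (radialRicci φ f z ^ 2 / ((n - 1) * flatScalar φ z)
        + (ρ - (flatScalar φ z - radialRicci φ f z) / (n - 1)) ^ 2 / flatGradInner φ f f z) := by
  have hn' : (3 : ℝ) ≤ n := by exact_mod_cast hn
  have hm : (n : ℝ) - 1 ≠ 0 := by linarith
  have hW := h.isOpen_regular
  have hzW : z ∈ {z ∈ U | ∑ i, 𝔡 i f z ^ 2 ≠ 0} := ⟨hz, hne⟩
  have hslope : ∀ w ∈ {z ∈ U | ∑ i, 𝔡 i f z ^ 2 ≠ 0}, HasSlope f (pinching φ)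
      (2 * n / (n - 1) ^ 2 * ((n * (radialRicci φ f w / flatScalar φ w) - 1) *
        ratioSlope n ρ (radialRicci φ f w) (flatScalar φ w) (flatGradInner φ f f w))) w := by
    intro w hw
    have ht := h.hasSlope_ratio hn hw.1 hw.2 (hR w hw.1).ne'
    refine HasSlope.congr_of_eqOn (((((HasSlope.const (n : ℝ)).mul ht).sub
      (HasSlope.const 1)).pow_two.div (HasSlope.const (((n : ℝ) - 1) ^ 2))
        (pow_ne_zero 2 hm)).congr_slope ?_) hW hw
      (fun w hw => h.pinching_eq hn hw.1 hw.2 (hR w hw.1).ne')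
    field_simp
    ring
  have q0 := (gradNormSq_pos (φ := φ) hne).ne'
  have R0 := (hR z hz).ne'
  have hr := h.hasSlope_radialRicci hn hz hne
  have hRs := h.hasSlope_flatScalar hn hz hne
  have hq := h.hasSlope_gradNormSq hn hz hne
  have ht := h.hasSlope_ratio hn hz hne R0
  -- The slope of `ratioSlope` is assembled by the same operations that define it, using the slopes
  -- of r, R and |∇f|². Its explicit form is left to unification and is needed only in the final
  -- algebra.
  have hct := (((((((HasSlope.const ρ).mul hRs).sub (hr.pow_two.add ((hRs.sub hr).pow_two.div
    (HasSlope.const ((n : ℝ) - 1)) hm))).sub (hr.mul ((HasSlope.const (n * ρ)).sub hRs))).add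
    (hr.mul hq)).div hq q0 |>.mul hRs).sub ((HasSlope.const 2).mul hr.pow_two)).div hRs.pow_two
    (pow_ne_zero 2 R0)
  change HasSlope f (fun w => ratioSlope n ρ (radialRicci φ f w) (flatScalar φ w)
    (flatGradInner φ f f w)) _ z at hct
  have hσ := (HasSlope.const (2 * n / ((n : ℝ) - 1) ^ 2)).mul
    ((((HasSlope.const (n : ℝ)).mul ht).sub (HasSlope.const 1)).mul hct)
  have hlap := HasSlope.flatLaplacian_eq (φ := φ) hW hzW (h.smooth_potential z hz) hslope hσ
  refine ⟨ratioSlope n ρ (radialRicci φ f z) (flatScalar φ z) (flatGradInner φ f f z), ?_⟩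
  rw [driftLaplacian, hlap, (hslope z hzW).flatGradInner_right, (hslope z hzW).flatGradInner_right,
    h.flatLaplacian_potential hz, flatGradInner_comm (flatScalar φ) f,
    hRs.flatGradInner_right, h.pinching_eq hn hz hne R0]
  generalize flatGradInner φ f f z = q at *
  generalize flatScalar φ z = R at *
  generalize radialRicci φ f z = r at *
  -- Writing n = m + 1 turns the denominators n - 1 into an atom, so that the identity is one of
  -- rational functions in m, ρ, r, R and q.
  obtain ⟨m, hm'⟩ : ∃ m : ℝ, (n : ℝ) = m + 1 := ⟨n - 1, by ring⟩
  rw [hm'] at hm ⊢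
  simp only [add_sub_cancel_right] at hm ⊢
  simp only [ratioSlope]
  rw [hm']
  simp only [add_sub_cancel_right]
  field_simp
  ring

end IsFlatSoliton

end Pinching

/-! ### Differential inequalities in a conformally flat chart -/

section FlatChartInequalities

variable {n : ℕ} {φ f u v : EuclideanSpace ℝ (Fin n) → ℝ} {ρ : ℝ}
  {U : Set (EuclideanSpace ℝ (Fin n))} {z : EuclideanSpace ℝ (Fin n)}

section Operators

theorem contDiffAt_flatGradInner (hφ : ContDiffAt ℝ ∞ φ z) (hu : ContDiffAt ℝ ∞ u z)
    (hv : ContDiffAt ℝ ∞ v z) : ContDiffAt ℝ ∞ (flatGradInner φ u v) z :=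
  ((contDiffAt_const.mul hφ).neg.exp).mul
    (ContDiffAt.sum fun _ _ => (contDiffAt_partialDeriv hu).mul (contDiffAt_partialDeriv hv))

theorem contDiffAt_flatLaplacian (hφ : ContDiffAt ℝ ∞ φ z) (hu : ContDiffAt ℝ ∞ u z) :
    ContDiffAt ℝ ∞ (flatLaplacian φ u) z :=
  ((contDiffAt_const.mul hφ).neg.exp).mul
    ((ContDiffAt.sum fun _ _ => contDiffAt_partialDeriv (contDiffAt_partialDeriv hu)).add
      (contDiffAt_const.mul
        (ContDiffAt.sum fun _ _ => (contDiffAt_partialDeriv hφ).mul (contDiffAt_partialDeriv hu))))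

theorem partialDeriv_add_const_mul (hu : ContDiffAt ℝ ∞ u z) (hv : ContDiffAt ℝ ∞ v z) (ε : ℝ)
    (i : Fin n) : 𝔡 i (fun w => u w + ε * v w) z = 𝔡 i u z + ε * 𝔡 i v z := by
  have du := hu.differentiableAt (by simp)
  have dv := hv.differentiableAt (by simp)
  rw [partialDeriv_add du (dv.const_mul _), partialDeriv_const_mul _ dv]

theorem flatGradInner_add_const_mul (hu : ContDiffAt ℝ ∞ u z) (hv : ContDiffAt ℝ ∞ v z) (ε : ℝ)
    (p : EuclideanSpace ℝ (Fin n) → ℝ) : flatGradInner φ p (fun w => u w + ε * v w) z =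
      flatGradInner φ p u z + ε * flatGradInner φ p v z := by
  simp only [flatGradInner, partialDeriv_add_const_mul hu hv, mul_sum, ← sum_add_distrib]
  exact sum_congr rfl fun _ _ => by ring

theorem flatLaplacian_add_const_mul (hU : IsOpen U) (hz : z ∈ U)
    (hu : ∀ w ∈ U, ContDiffAt ℝ ∞ u w) (hv : ∀ w ∈ U, ContDiffAt ℝ ∞ v w) (ε : ℝ) :
    flatLaplacian φ (fun w => u w + ε * v w) z = flatLaplacian φ u z + ε * flatLaplacian φ v z := by
  have h2 : ∀ i, 𝔡 i (𝔡 i (fun w => u w + ε * v w)) z = 𝔡 i (𝔡 i u) z + ε * 𝔡 i (𝔡 i v) z := by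
    intro i
    rw [partialDeriv_congr_on hU
      (fun w hw => partialDeriv_add_const_mul (hu w hw) (hv w hw) ε i) hz,
      partialDeriv_add_const_mul (contDiffAt_partialDeriv (hu z hz))
        (contDiffAt_partialDeriv (hv z hz))]
  simp only [flatLaplacian, h2, partialDeriv_add_const_mul (hu z hz) (hv z hz), mul_add,
    sum_add_distrib, mul_left_comm _ ε, ← mul_sum]
  ring

theorem driftLaplacian_add_const_mul (hU : IsOpen U) (hz : z ∈ U)
    (hu : ∀ w ∈ U, ContDiffAt ℝ ∞ u w) (hv : ∀ w ∈ U, ContDiffAt ℝ ∞ v w) (ε : ℝ) :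
    driftLaplacian φ f (fun w => u w + ε * v w) z =
      driftLaplacian φ f u z + ε * driftLaplacian φ f v z := by
  rw [driftLaplacian, flatLaplacian_add_const_mul hU hz hu hv,
    flatGradInner_add_const_mul (hu z hz) (hv z hz),
    flatGradInner_add_const_mul (hu z hz) (hv z hz), driftLaplacian, driftLaplacian]
  ring

theorem flatGradInner_eq_zero (h : ∀ i, 𝔡 i v z = 0) (u : EuclideanSpace ℝ (Fin n) → ℝ) :
    flatGradInner φ u v z = 0 := by
  simp [flatGradInner, h]

theorem flatLaplacian_nonpos_of_isLocalMax (hu : ContDiffAt ℝ ∞ u z) (h : IsLocalMax u z) :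
    flatLaplacian φ u z ≤ 0 := by
  have h1 : ∀ i, 𝔡 i u z = 0 := fun i => partialDeriv_eq_zero_of_isLocalMax h
  simp only [flatLaplacian, h1, mul_zero, sum_const_zero, add_zero]
  exact mul_nonpos_of_nonneg_of_nonpos (Real.exp_pos _).le
    (sum_nonpos fun i _ => partialDeriv_partialDeriv_nonpos_of_isLocalMax h hu)

theorem driftLaplacian_nonpos_of_isLocalMax (hu : ContDiffAt ℝ ∞ u z) (h : IsLocalMax u z) :
    driftLaplacian φ f u z ≤ 0 := by
  have h1 : ∀ i, 𝔡 i u z = 0 := fun i => partialDeriv_eq_zero_of_isLocalMax h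
  rw [driftLaplacian, flatGradInner_eq_zero h1, flatGradInner_eq_zero h1]
  simpa using flatLaplacian_nonpos_of_isLocalMax hu h

theorem flatLaplacian_const (c : ℝ) : flatLaplacian φ (fun _ => c) z = 0 := by
  have h1 : ∀ i, 𝔡 i (fun _ : EuclideanSpace ℝ (Fin n) => c) = fun _ => 0 := fun i =>
    funext fun w => partialDeriv_const c
  simp only [flatLaplacian, h1, partialDeriv_const]
  simp

theorem flatLaplacian_congr (h : u =ᶠ[𝓝 z] v) : flatLaplacian φ u z = flatLaplacian φ v z := by
  simp only [flatLaplacian, partialDeriv_congr (partialDeriv_eventuallyEq h), partialDeriv_congr h]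

theorem flatGradInner_congr (h : u =ᶠ[𝓝 z] v) (p : EuclideanSpace ℝ (Fin n) → ℝ) :
    flatGradInner φ p u z = flatGradInner φ p v z := by
  simp only [flatGradInner, partialDeriv_congr h]

/-- Cauchy–Schwarz on the diagonal entries; the off-diagonal squares are dropped. -/
theorem sq_flatScalar_le (φ : EuclideanSpace ℝ (Fin n) → ℝ) (z : EuclideanSpace ℝ (Fin n)) :
    flatScalar φ z ^ 2 ≤ n * flatRicciNormSq φ z := by
  rw [flatScalar, flatRicciNormSq, mul_pow, mul_left_comm]
  refine mul_le_mul_of_nonneg_left ?_ (sq_nonneg _)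
  have h1 := sq_sum_le_card_mul_sum_sq (s := univ) (f := fun i => flatRicci φ i i z)
  rw [card_univ, Fintype.card_fin] at h1
  refine h1.trans (mul_le_mul_of_nonneg_left (sum_le_sum fun i _ => ?_) (Nat.cast_nonneg n))
  exact single_le_sum (f := fun j => flatRicci φ i j z ^ 2) (fun j _ => sq_nonneg _) (mem_univ i)

theorem flatRicciNormSq_nonneg (φ : EuclideanSpace ℝ (Fin n) → ℝ)
    (z : EuclideanSpace ℝ (Fin n)) : 0 ≤ flatRicciNormSq φ z :=
  mul_nonneg (sq_nonneg _) (sum_nonneg fun _ _ => sum_nonneg fun _ _ => sq_nonneg _)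

end Operators

/-- The barrier function `exp (f - ((n - 1) / 2) log R)`. -/
def barrier (φ f : EuclideanSpace ℝ (Fin n) → ℝ) (y : EuclideanSpace ℝ (Fin n)) : ℝ :=
  Real.exp (f y - (n - 1) / 2 * Real.log (flatScalar φ y))

namespace IsFlatSoliton

variable (h : IsFlatSoliton φ f ρ U)
include h

theorem flatLaplacian_exp (hz : z ∈ U) : flatLaplacian φ (fun w => Real.exp (f w)) z =
    Real.exp (f z) * (flatLaplacian φ f z + flatGradInner φ f f z) := by
  have d1 : ∀ w ∈ U, DifferentiableAt ℝ f w := fun w hw =>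
    (h.smooth_potential w hw).differentiableAt (by simp)
  have d2 : ∀ i, DifferentiableAt ℝ (𝔡 i f) z := fun i =>
    (contDiffAt_partialDeriv (i := i) (h.smooth_potential z hz)).differentiableAt (by simp)
  have h1 : ∀ i, 𝔡 i (𝔡 i (fun w => Real.exp (f w))) z =
      Real.exp (f z) * (𝔡 i f z * 𝔡 i f z) + Real.exp (f z) * 𝔡 i (𝔡 i f) z := fun i => by
    rw [partialDeriv_congr_on h.isOpen (fun w hw => partialDeriv_exp (d1 w hw)) hz,
      partialDeriv_mul (d1 z hz).exp (d2 i), partialDeriv_exp (d1 z hz)]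
    ring
  simp only [flatLaplacian, flatGradInner, h1, partialDeriv_exp (d1 z hz), sum_add_distrib,
    mul_left_comm _ (Real.exp (f z)), ← mul_sum]
  ring

/-- At a local minimum of `R - ε exp f`. -/
theorem ineq_of_isLocalMin (hz : z ∈ U) {ε : ℝ}
    (hmin : IsLocalMin (fun w => flatScalar φ w - ε * Real.exp (f w)) z) :
    ε * (Real.exp (f z) * (n * ρ - flatScalar φ z)) ≤ 2 * ρ * flatScalar φ z := by
  have hR : ∀ w ∈ U, ContDiffAt ℝ ∞ (flatScalar φ) w := fun w hw => h.contDiffAt_flatScalar hw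
  have hE : ∀ w ∈ U, ContDiffAt ℝ ∞ (fun w => Real.exp (f w)) w := fun w hw =>
    (h.smooth_potential w hw).exp
  have hmax : IsLocalMax (fun w => -1 * flatScalar φ w + ε * Real.exp (f w)) z := by
    have := hmin.neg
    simpa [neg_add_eq_sub] using this
  have hR' : ∀ w ∈ U, ContDiffAt ℝ ∞ (fun w => -1 * flatScalar φ w) w := fun w hw =>
    contDiffAt_const.mul (hR w hw)
  have h0 : ∀ i, 𝔡 i (fun w => -1 * flatScalar φ w + ε * Real.exp (f w)) z = 0 := fun i =>
    partialDeriv_eq_zero_of_isLocalMax hmax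
  have h1 := flatLaplacian_nonpos_of_isLocalMax (φ := φ)
    ((hR' z hz).add (contDiffAt_const.mul (hE z hz))) hmax
  have h2 := flatGradInner_eq_zero (φ := φ) h0 f
  have c0 : ∀ w ∈ U, ContDiffAt ℝ ∞ (fun _ : EuclideanSpace ℝ (Fin n) => (0 : ℝ)) w :=
    fun w _ => contDiffAt_const
  have e1 : flatLaplacian φ (fun w => -1 * flatScalar φ w) z =
      - flatLaplacian φ (flatScalar φ) z := by
    have := flatLaplacian_add_const_mul (φ := φ) h.isOpen hz c0 hR (-1)
    simp only [zero_add] at this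
    rw [this, neg_one_mul, flatLaplacian_const, zero_add]
  have e2 : flatGradInner φ f (fun w => -1 * flatScalar φ w) z =
      - flatGradInner φ f (flatScalar φ) z := by
    have := flatGradInner_add_const_mul (φ := φ) (c0 z hz) (hR z hz) (-1) f
    simp only [zero_add] at this
    rw [this, neg_one_mul, flatGradInner_eq_zero (fun i => partialDeriv_const 0), zero_add]
  have e3 : flatGradInner φ f (fun w => Real.exp (f w)) z =
      Real.exp (f z) * flatGradInner φ f f z := by
    simp only [flatGradInner,
      partialDeriv_exp ((h.smooth_potential z hz).differentiableAt (by simp)),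
      mul_left_comm _ (Real.exp (f z)), ← mul_sum]
  rw [flatLaplacian_add_const_mul h.isOpen hz hR' hE, e1, h.flatLaplacian_exp hz,
    h.flatLaplacian_flatScalar hz, h.flatLaplacian_potential hz] at h1
  rw [flatGradInner_add_const_mul (hR' z hz) (hE z hz), e2, e3] at h2
  -- Criticality gives ⟨∇f, ∇R⟩ = ε e^f |∇f|², which cancels the |∇f|² term of ε Δe^f. The term
  -- -2|Ric|² has a favourable sign.
  have h3 := flatRicciNormSq_nonneg φ z
  nlinarith

variable (hn : 3 ≤ n)
include hn

theorem contDiffAt_pinching (hz : z ∈ U) (hR : 0 < flatScalar φ z) :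
    ContDiffAt ℝ ∞ (pinching φ) z := by
  have hn' : (3 : ℝ) ≤ n := by exact_mod_cast hn
  refine ((contDiffAt_const.mul (h.contDiffAt_flatRicciNormSq hz)).sub
    ((h.contDiffAt_flatScalar hz).pow 2)).div
    (contDiffAt_const.mul ((h.contDiffAt_flatScalar hz).pow 2)) ?_
  exact mul_ne_zero (by linarith) (pow_ne_zero 2 hR.ne')

omit h in
theorem pinching_nonneg (φ : EuclideanSpace ℝ (Fin n) → ℝ) (z : EuclideanSpace ℝ (Fin n)) :
    0 ≤ pinching φ z := by
  have hn' : (3 : ℝ) ≤ n := by exact_mod_cast hn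
  exact div_nonneg (sub_nonneg.2 (sq_flatScalar_le φ z))
    (mul_nonneg (by linarith) (sq_nonneg _))

omit hn in
theorem continuousAt_driftLaplacian (hz : z ∈ U) (hR : 0 < flatScalar φ z)
    (hu : ContDiffAt ℝ ∞ u z) : ContinuousAt (driftLaplacian φ f u) z := by
  have hφ := h.smooth_factor z hz
  have hf := h.smooth_potential z hz
  have hs := h.contDiffAt_flatScalar hz
  exact ((contDiffAt_flatLaplacian hφ hu).continuousAt.sub
    (contDiffAt_flatGradInner hφ hf hu).continuousAt).add
    ((continuousAt_const.div hs.continuousAt hR.ne').mul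
      (contDiffAt_flatGradInner hφ hs hu).continuousAt)

/-- The differential inequality for the pinching function, at all points. -/
theorem le_driftLaplacian_pinching (hz : z ∈ U) (hR : ∀ w ∈ U, 0 < flatScalar φ w) :
    4 * flatScalar φ z / (n * (n - 1)) * (pinching φ z * (1 - (n - 1) * √(pinching φ z)) ^ 2) ≤
      driftLaplacian φ f (pinching φ) z := by
  have hn' : (3 : ℝ) ≤ n := by exact_mod_cast hn
  have hm : 0 < (n : ℝ) - 1 := by linarith
  -- The left side contains no ∇f, so both sides are continuous across critical points. The
  -- inequality extends from the regular set to its closure, and off the closure f is locally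
  -- constant.
  by_cases hcl : z ∈ closure {w ∈ U | ∑ i, 𝔡 i f w ^ 2 ≠ 0}
  · have hfr : ∃ᶠ w in 𝓝 z, w ∈ {w ∈ U | ∑ i, 𝔡 i f w ^ 2 ≠ 0} :=
      mem_closure_iff_frequently.1 hcl
    have hp := (h.contDiffAt_pinching hn hz (hR z hz)).continuousAt
    have c1 : ContinuousAt (fun w => 4 * flatScalar φ w / (n * (n - 1)) *
        (pinching φ w * (1 - (n - 1) * √(pinching φ w)) ^ 2)) z :=
      ((continuousAt_const.mul (h.contDiffAt_flatScalar hz).continuousAt).div_const _).mul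
        (hp.mul ((continuousAt_const.sub (continuousAt_const.mul hp.sqrt)).pow 2))
    have c2 := h.continuousAt_driftLaplacian hz (hR z hz)
      (h.contDiffAt_pinching hn hz (hR z hz))
    by_contra! hlt
    obtain ⟨w, ⟨hw, hne⟩, hlt⟩ := (hfr.and_eventually (c2.eventually_lt c1 hlt)).exists
    refine hlt.not_ge ?_
    obtain ⟨s, hs⟩ := h.driftLaplacian_pinching hn hw hne hR
    have hRw := hR w hw
    have hq := gradNormSq_pos (φ := φ) hne
    have hY := pinching_nonneg hn φ w
    have hYeq := h.pinching_eq hn hw hne hRw.ne'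
    set Y := pinching φ w with hYdef
    set R := flatScalar φ w
    set r := radialRicci φ f w
    have hsq : √Y ^ 2 = Y := Real.sq_sqrt hY
    have habs : (n - 1) * √Y = |n * (r / R) - 1| := by
      rw [hYeq, Real.sqrt_div (sq_nonneg _), Real.sqrt_sq_eq_abs, Real.sqrt_sq hm.le]
      field_simp
    -- With x = nr/R - 1 and |x| = (n - 1)√Y, this is (1 - |x|)² ≤ (1 + x)². It replaces r by a
    -- quantity defined at critical points too.
    have hr2 : R ^ 2 * (1 - (n - 1) * √Y) ^ 2 ≤ n ^ 2 * r ^ 2 := by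
      rw [habs]
      have e : n ^ 2 * r ^ 2 = R ^ 2 * (1 + (n * (r / R) - 1)) ^ 2 := by
        field_simp; ring
      rw [e]
      refine mul_le_mul_of_nonneg_left ?_ (sq_nonneg _)
      have := neg_abs_le (n * (r / R) - 1)
      nlinarith [sq_abs (n * (r / R) - 1)]
    rw [hs]
    have t1 : 0 ≤ 2 * (n : ℝ) ^ 2 / (n - 1) ^ 2 * s ^ 2 * flatGradInner φ f f w := by positivity
    have t2 : 0 ≤ 4 * n * Y * ((ρ - (R - r) / (n - 1)) ^ 2 / flatGradInner φ f f w) := by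
      positivity
    have t3 : 4 * R / (n * (n - 1)) * (Y * (1 - (n - 1) * √Y) ^ 2) ≤
        4 * n * Y * (r ^ 2 / ((n - 1) * R)) := by
      have e1 : 4 * R / (n * (n - 1)) * (Y * (1 - (n - 1) * √Y) ^ 2) =
          4 * Y / (n * (n - 1) * R) * (R ^ 2 * (1 - (n - 1) * √Y) ^ 2) := by field_simp
      have e2 : 4 * n * Y * (r ^ 2 / ((n - 1) * R)) =
          4 * Y / (n * (n - 1) * R) * (n ^ 2 * r ^ 2) := by field_simp
      rw [e1, e2]
      exact mul_le_mul_of_nonneg_left hr2 (by positivity)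
    linarith [mul_add (4 * n * Y) (r ^ 2 / ((n - 1) * R))
      ((ρ - (R - r) / (n - 1)) ^ 2 / flatGradInner φ f f w)]
  · have hev : ∀ᶠ w in 𝓝 z, w ∈ U ∧ ∀ i, 𝔡 i f w = 0 := by
      have h1 : ∀ᶠ w in 𝓝 z, w ∉ {w ∈ U | ∑ i, 𝔡 i f w ^ 2 ≠ 0} := by
        simpa [mem_closure_iff_frequently] using hcl
      filter_upwards [h1, h.isOpen.mem_nhds hz] with w hw hwU
      refine ⟨hwU, fun i => ?_⟩
      have h2 : ∑ i, 𝔡 i f w ^ 2 = 0 := by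
        by_contra hne; exact hw ⟨hwU, hne⟩
      have := (sum_eq_zero_iff_of_nonneg fun i _ => sq_nonneg _).1 h2 i (mem_univ i)
      exact pow_eq_zero_iff two_ne_zero |>.1 this
    -- Where f is locally constant the soliton equation reads Ric = ρg, so the pinching function
    -- vanishes near z and both sides are 0.
    have hY : pinching φ =ᶠ[𝓝 z] fun _ => 0 := by
      filter_upwards [hev.eventually_nhds] with w hw
      obtain ⟨hwU, hw0⟩ := hw.self_of_nhds
      have h2 : ∀ i j, 𝔡 i (𝔡 j f) w = 0 := fun i j => by
        rw [partialDeriv_congr (v := fun _ => 0) (hw.mono fun x hx => hx.2 j), partialDeriv_const]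
      have hr : ∀ i j, flatRicci φ i j w = ρ * (Real.exp (2 * φ w) * kron i j) := fun i j => by
        have := h.equation w hwU i j
        simpa [flatHessian, h2, hw0] using this
      have hk : ∀ i j : Fin n, (kron i j : ℝ) ^ 2 = kron i j * 1 := fun i j => by
        simp [kron]
      rw [pinching, flatRicciNormSq, flatScalar]
      simp only [hr, mul_pow, hk, ← mul_sum, sum_kron_mul, kron_self, sum_const, card_univ,
        Fintype.card_fin, nsmul_eq_mul]
      ring
    have e1 : driftLaplacian φ f (pinching φ) z = 0 := by
      rw [driftLaplacian, flatLaplacian_congr hY, flatGradInner_congr hY, flatGradInner_congr hY,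
        flatGradInner_eq_zero (fun i => partialDeriv_const 0),
        flatGradInner_eq_zero (fun i => partialDeriv_const 0)]
      rw [flatLaplacian_const]
      ring
    rw [e1, hY.eq_of_nhds]
    simp

/-- At a positive local maximum of the pinching function, it takes the value of a cylinder, and the
gradient of the scalar curvature vanishes. -/
theorem pinching_of_isLocalMax (hz : z ∈ U) (hR : ∀ w ∈ U, 0 < flatScalar φ w)
    (hmax : IsLocalMax (pinching φ) z) (hpos : 0 < pinching φ z) :
    (n - 1) ^ 2 * pinching φ z = 1 ∧ ∀ i, 𝔡 i (flatScalar φ) z = 0 := by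
  have hn' : (3 : ℝ) ≤ n := by exact_mod_cast hn
  have hm : 0 < (n : ℝ) - 1 := by linarith
  have hRz := hR z hz
  have hL : driftLaplacian φ f (pinching φ) z ≤ 0 :=
    driftLaplacian_nonpos_of_isLocalMax (h.contDiffAt_pinching hn hz hRz) hmax
  constructor
  · have h1 := (h.le_driftLaplacian_pinching hn hz hR).trans hL
    have hc : 0 < 4 * flatScalar φ z / (n * (n - 1)) * pinching φ z := by positivity
    rw [← mul_assoc] at h1
    have h2 : (1 - (n - 1) * √(pinching φ z)) ^ 2 ≤ 0 := nonpos_of_mul_nonpos_right h1 hc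
    have h3 : 1 - (n - 1) * √(pinching φ z) = 0 :=
      pow_eq_zero_iff two_ne_zero |>.1 (le_antisymm h2 (sq_nonneg _))
    have h4 := Real.sq_sqrt hpos.le
    have h5 : (n - 1) * √(pinching φ z) = 1 := by linarith
    rw [← h4, ← mul_pow, h5, one_pow]
  · intro i
    -- At a critical point of f the claim is ∇R = 2 Ric(∇f). Elsewhere the identity for LY is a sum
    -- of nonnegative terms that is at most 0, which forces r = 0, and ∇R = 2r∇f.
    by_cases hne : ∑ i, 𝔡 i f z ^ 2 = 0
    · have h0 : ∀ i, 𝔡 i f z = 0 := fun i => pow_eq_zero_iff two_ne_zero |>.1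
        ((sum_eq_zero_iff_of_nonneg fun i _ => sq_nonneg _).1 hne i (mem_univ i))
      rw [h.partialDeriv_flatScalar hz]
      simp [h0]
    · obtain ⟨s, hs⟩ := h.driftLaplacian_pinching hn hz hne hR
      have hq := gradNormSq_pos (φ := φ) hne
      rw [hs] at hL
      have t1 : 0 ≤ 2 * (n : ℝ) ^ 2 / (n - 1) ^ 2 * s ^ 2 * flatGradInner φ f f z := by positivity
      have t2 : 0 ≤ (ρ - (flatScalar φ z - radialRicci φ f z) / (n - 1)) ^ 2
        / flatGradInner φ f f z := by positivity
      have hc : 0 < 4 * n * pinching φ z := by positivity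
      have t3 : radialRicci φ f z ^ 2 / ((n - 1) * flatScalar φ z) ≤ 0 := by
        by_contra! hcon
        nlinarith [mul_pos hc hcon, mul_nonneg hc.le t2]
      have t4 : radialRicci φ f z ^ 2 ≤ 0 := by
        by_contra! hcon
        exact t3.not_gt (div_pos hcon (mul_pos hm hRz))
      have t5 : radialRicci φ f z = 0 :=
        pow_eq_zero_iff two_ne_zero |>.1 (le_antisymm t4 (sq_nonneg _))
      rw [(h.radial_eqs hn hz hne).1, t5]; ring

omit hn in
theorem contDiffAt_barrier (hz : z ∈ U) (hR : 0 < flatScalar φ z) :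
    ContDiffAt ℝ ∞ (barrier φ f) z :=
  ((h.smooth_potential z hz).sub (contDiffAt_const.mul
    ((h.contDiffAt_flatScalar hz).log hR.ne'))).exp

/-- The hypotheses give |Ric|² = R²/(n - 1) and ∇R = 0, so LB = B(Δf - (n - 1)/2 · ΔR/R) = B(nρ - R
- (n - 1)ρ + R) = ρB. The coefficient (n - 1)/2 in the barrier is the one for which R cancels. -/
theorem driftLaplacian_barrier_pos (hρ : 0 < ρ) (hz : z ∈ U) (hR : ∀ w ∈ U, 0 < flatScalar φ w)
    (hp : (n - 1) ^ 2 * pinching φ z = 1) (h0 : ∀ i, 𝔡 i (flatScalar φ) z = 0) :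
    0 < driftLaplacian φ f (barrier φ f) z := by
  have hn' : (3 : ℝ) ≤ n := by exact_mod_cast hn
  have hm : 0 < (n : ℝ) - 1 := by linarith
  have hRz := hR z hz
  have df : ∀ w ∈ U, DifferentiableAt ℝ f w := fun w hw =>
    (h.smooth_potential w hw).differentiableAt (by simp)
  have dR : ∀ w ∈ U, DifferentiableAt ℝ (flatScalar φ) w := fun w hw =>
    (h.contDiffAt_flatScalar hw).differentiableAt (by simp)
  have d2f : ∀ i, DifferentiableAt ℝ (𝔡 i f) z := fun i =>
    (contDiffAt_partialDeriv (i := i) (h.smooth_potential z hz)).differentiableAt (by simp)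
  have d2R : ∀ i, DifferentiableAt ℝ (𝔡 i (flatScalar φ)) z := fun i =>
    (contDiffAt_partialDeriv (i := i) (h.contDiffAt_flatScalar hz)).differentiableAt (by simp)
  have db : DifferentiableAt ℝ (barrier φ f) z :=
    (h.contDiffAt_barrier hz hRz).differentiableAt (by simp)
  have hi : ∀ w ∈ U, DifferentiableAt ℝ (fun w => (flatScalar φ w)⁻¹) w := fun w hw =>
    (dR w hw).fun_inv (hR w hw).ne'
  have h1 : ∀ w ∈ U, ∀ i, 𝔡 i (barrier φ f) w = barrier φ f w *
      (𝔡 i f w - (n - 1) / 2 * ((flatScalar φ w)⁻¹ * 𝔡 i (flatScalar φ) w)) := by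
    intro w hw i
    have dl := (dR w hw).log (hR w hw).ne'
    rw [show barrier φ f = fun w => Real.exp (f w - (n - 1) / 2 * Real.log (flatScalar φ w))
        from rfl, partialDeriv_exp ((df w hw).fun_sub (dl.const_mul _)),
      partialDeriv_sub (df w hw) (dl.const_mul _), partialDeriv_const_mul _ dl,
      partialDeriv_comp_real (Real.hasDerivAt_log (hR w hw).ne') (dR w hw)]
  have h2 : ∀ i, 𝔡 i (𝔡 i (barrier φ f)) z = barrier φ f z * (𝔡 i f z * 𝔡 i f z)
      + barrier φ f z * 𝔡 i (𝔡 i f) z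
      - barrier φ f z * ((n - 1) / 2) * (flatScalar φ z)⁻¹ * 𝔡 i (𝔡 i (flatScalar φ)) z := by
    intro i
    rw [partialDeriv_congr_on h.isOpen (fun w hw => h1 w hw i) hz,
      partialDeriv_mul db ((d2f i).fun_sub (((hi z hz).fun_mul (d2R i)).const_mul _)), h1 z hz,
      partialDeriv_sub (d2f i) (((hi z hz).fun_mul (d2R i)).const_mul _),
      partialDeriv_const_mul _ ((hi z hz).fun_mul (d2R i)), partialDeriv_mul (hi z hz) (d2R i), h0]
    ring
  have h3 : ∀ i, 𝔡 i (barrier φ f) z = barrier φ f z * 𝔡 i f z := fun i => by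
    rw [h1 z hz, h0]; ring
  have e1 : flatLaplacian φ (barrier φ f) z = barrier φ f z * (flatGradInner φ f f z
      + flatLaplacian φ f z
      - (n - 1) / 2 * (flatScalar φ z)⁻¹ * flatLaplacian φ (flatScalar φ) z) := by
    simp only [flatLaplacian, flatGradInner, h2, h3, h0, sum_sub_distrib, sum_add_distrib,
      mul_left_comm _ (barrier φ f z), ← mul_sum]
    simp only [mul_zero, sum_const_zero]
    ring
  have e2 : flatGradInner φ f (barrier φ f) z = barrier φ f z * flatGradInner φ f f z := by
    simp only [flatGradInner, h3, mul_left_comm _ (barrier φ f z), ← mul_sum]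
  have e3 : flatGradInner φ (flatScalar φ) (barrier φ f) z = 0 := by
    rw [flatGradInner_comm, flatGradInner_eq_zero h0]
  have e4 : flatRicciNormSq φ z = flatScalar φ z ^ 2 / (n - 1) := by
    rw [pinching] at hp
    field_simp at hp ⊢
    have : (n : ℝ) * ((n - 1) * flatRicciNormSq φ z - flatScalar φ z ^ 2) = 0 := by
      linear_combination hp
    rcases mul_eq_zero.1 this with h' | h'
    · linarith
    · linarith
  have hb : 0 < barrier φ f z := Real.exp_pos _
  rw [driftLaplacian, e1, e2, e3, h.flatLaplacian_potential hz, h.flatLaplacian_flatScalar hz,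
    flatGradInner_eq_zero h0, e4]
  have : barrier φ f z * (flatGradInner φ f f z + (n * ρ - flatScalar φ z) - (n - 1) / 2 *
      (flatScalar φ z)⁻¹ * (0 + 2 * ρ * flatScalar φ z - 2 * (flatScalar φ z ^ 2 / (n - 1))))
      - barrier φ f z * flatGradInner φ f f z + 2 / flatScalar φ z * 0 = barrier φ f z * ρ := by
    field_simp
    ring
  rw [this]
  positivity

/-- If the pinching function vanishes identically, the potential is locally constant. -/
theorem partialDeriv_potential_eq_zero (hz : z ∈ U) (hR : ∀ w ∈ U, 0 < flatScalar φ w)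
    (hp : ∀ w ∈ U, pinching φ w = 0) (i : Fin n) : 𝔡 i f z = 0 := by
  have hn' : (3 : ℝ) ≤ n := by exact_mod_cast hn
  have hm : 0 < (n : ℝ) - 1 := by linarith
  have hRz := hR z hz
  by_contra hi
  have hne : ∑ i, 𝔡 i f z ^ 2 ≠ 0 := fun h0 => hi <| pow_eq_zero_iff two_ne_zero |>.1
    ((sum_eq_zero_iff_of_nonneg fun i _ => sq_nonneg _).1 h0 i (mem_univ i))
  have hconst : ∀ w ∈ {z ∈ U | ∑ i, 𝔡 i f z ^ 2 ≠ 0},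
      radialRicci φ f w / flatScalar φ w = 1 / n := by
    rintro w ⟨hw, hwne⟩
    have h1 := h.pinching_eq hn hw hwne (hR w hw).ne'
    rw [hp w hw, eq_comm, div_eq_zero_iff] at h1
    have h2 := pow_eq_zero_iff two_ne_zero |>.1 (h1.resolve_right (by positivity))
    field_simp at h2 ⊢
    linarith
  have hs := h.hasSlope_ratio hn hz hne hRz.ne'
  have h1 := hs.2 i
  rw [partialDeriv_congr_on h.isOpen_regular hconst ⟨hz, hne⟩, partialDeriv_const] at h1
  have h2 := (mul_eq_zero.1 h1.symm).resolve_right hi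
  have hr : radialRicci φ f z = flatScalar φ z / n := by
    have := hconst z ⟨hz, hne⟩
    field_simp at this ⊢
    linarith
  have hq := (gradNormSq_pos (φ := φ) hne).ne'
  -- For r = R/n the ODE gives r the slope R/n, while R has slope 2R/n; the quotient then has slope
  -- 1/n - 2/n². A constant quotient would need 0, which fails for n ≥ 3.
  have h3 : ratioSlope n ρ (radialRicci φ f z) (flatScalar φ z) (flatGradInner φ f f z) =
      (n - 2) / n ^ 2 := by
    rw [ratioSlope, hr]
    field_simp
    ring
  rw [h3, div_eq_zero_iff] at h2
  rcases h2 with h2 | h2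
  · linarith
  · have : (n : ℝ) ^ 2 ≠ 0 := by positivity
    exact this h2

end IsFlatSoliton

end FlatChartInequalities

/-! ### Conformally flat charts of a manifold -/

section FlatChart

variable {n : ℕ} {φ f : EuclideanSpace ℝ (Fin n) → ℝ} {ρ : ℝ}
  {G : EuclideanSpace ℝ (Fin n) → Matrix (Fin n) (Fin n) ℝ}
  {U : Set (EuclideanSpace ℝ (Fin n))} {z : EuclideanSpace ℝ (Fin n)}

theorem jac_id (a i : Fin n) (z : EuclideanSpace ℝ (Fin n)) :
    jac (fun w : EuclideanSpace ℝ (Fin n) => w) a i z = kron a i := by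
  have : HasFDerivAt (fun w : EuclideanSpace ℝ (Fin n) => w a)
      (EuclideanSpace.proj (𝕜 := ℝ) a : EuclideanSpace ℝ (Fin n) →L[ℝ] ℝ) z :=
    (EuclideanSpace.proj (𝕜 := ℝ) a).hasFDerivAt
  rw [jac, partialDeriv, this.fderiv]
  simp [kron]

theorem isConformalPullback_id (hU : IsOpen U) (hφ : ContDiffOn ℝ ∞ φ U)
    (hG : ∀ y ∈ U, G y = Real.exp (2 * φ y) • (1 : Matrix (Fin n) (Fin n) ℝ)) :
    IsConformalPullback φ (fun w => w) G U where
  isOpen := hU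
  smooth_map _ _ := contDiffAt_id
  smooth_factor z hz := hφ.contDiffAt (hU.mem_nhds hz)
  metric_eq z hz i j := by
    simp only [jac_id, sum_kron_mul']
    rw [hG z hz]
    simp [Matrix.one_apply, kron]
  isUnit_det z _ := by
    have : (Matrix.of fun a i => jac (fun w : EuclideanSpace ℝ (Fin n) => w) a i z) = 1 := by
      ext a i; simp [jac_id, kron, Matrix.one_apply]
    rw [this]; simp

theorem hessian_eq_flatHessian (h : IsConformalPullback φ (fun w => w) G U) (hz : z ∈ U)
    (hf : ∀ w ∈ U, ContDiffAt ℝ ∞ f w) (i j : Fin n) :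
    hessian G f i j z = flatHessian φ f i j z := by
  rw [show hessian G f i j z = hessian G (fun w => f w) i j z from rfl, h.hessian_eq hz hf]
  simp only [jac_id, sum_kron_mul', mul_comm _ (kron _ i)]
  rw [flatHessian, flatHessian, partialDeriv_comm (hf z hz), kron_comm]
  ring

/-- The contraction of `riemann_eq` for ψ the identity; the conformal factor cancels against the
inverse metric. -/
theorem ricci_eq_flatRicci (h : IsConformalPullback φ (fun w => w) G U) (hz : z ∈ U)
    (i j : Fin n) : ricci G i j z = flatRicci φ i j z := by
  have hG : G z = Real.exp (2 * φ z) • (1 : Matrix (Fin n) (Fin n) ℝ) := by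
    ext p q
    rw [h.metric_eq z hz]
    simp only [jac_id, sum_kron_mul']
    simp [kron, Matrix.one_apply]
  have hE : Real.exp (2 * φ z) ≠ 0 := (Real.exp_pos _).ne'
  have hinv : (G z)⁻¹ = (Real.exp (2 * φ z))⁻¹ • (1 : Matrix (Fin n) (Fin n) ℝ) := by
    apply Matrix.inv_eq_left_inv
    rw [hG]
    simp [smul_smul]
  have hs := schouten_comm (h.smooth_factor z hz)
  have h1 : ∀ p k, (G z)⁻¹ p k * riemann G p i k j z = kron p k * (kron k p * schouten φ i j z
      - kron k i * schouten φ p j z + kron i j * schouten φ k p z - kron p j * schouten φ k i z) := by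
    intro p k
    have e : (G z)⁻¹ p k = (Real.exp (2 * φ z))⁻¹ * kron p k := by
      rw [hinv]; simp [kron, Matrix.one_apply]
    rw [e, h.riemann_eq hz]
    simp only [jac_id, sum_kron_mul', mul_comm _ (kron _ i), mul_comm _ (kron _ p)]
    rw [hs j i, hs j p, kron_comm p k]
    field_simp
    rw [kron_comm i k]
    ring
  rw [ricci]
  simp only [h1, sum_kron_mul, kron_self, one_mul]
  simp only [sum_add_distrib, sum_sub_distrib, ← mul_sum, sum_kron_mul', sum_const, card_univ,
    Fintype.card_fin, nsmul_eq_mul]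
  rw [flatRicci, schoutenTrace, hs j i]
  ring

end FlatChart

/-! ### Transition maps into conformally flat charts -/

section Transition

variable {n : ℕ} {M : Type*} [TopologicalSpace M] [ChartedSpace (EuclideanSpace ℝ (Fin n)) M]
  [IsManifold (𝓡 n) ∞ M]
  {g : ContMDiffRiemannianMetric (𝓡 n) ∞ (EuclideanSpace ℝ (Fin n))
      (fun x : M => TangentSpace (𝓡 n) x)}

/-- The chart `e` is one in which the metric is `exp (2 φ) δ`. -/
structure IsFlatChart (g : ContMDiffRiemannianMetric (𝓡 n) ∞ (EuclideanSpace ℝ (Fin n))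
      (fun x : M => TangentSpace (𝓡 n) x))
    (e : OpenPartialHomeomorph M (EuclideanSpace ℝ (Fin n)))
    (φ : EuclideanSpace ℝ (Fin n) → ℝ) : Prop where
  mem_atlas : e ∈ IsManifold.maximalAtlas (𝓡 n) ∞ M
  smooth : ContDiffOn ℝ ∞ φ e.target
  metric_eq : ∀ y ∈ e.target, metricCoeff g e y =
    Real.exp (2 * φ y) • (1 : Matrix (Fin n) (Fin n) ℝ)

variable {e e' : OpenPartialHomeomorph M (EuclideanSpace ℝ (Fin n))}
  {φ : EuclideanSpace ℝ (Fin n) → ℝ} {z : EuclideanSpace ℝ (Fin n)}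

omit [IsManifold (𝓡 n) ∞ M] in
theorem contDiffAt_transition (he : e ∈ IsManifold.maximalAtlas (𝓡 n) ∞ M)
    (he' : e' ∈ IsManifold.maximalAtlas (𝓡 n) ∞ M) (hz : z ∈ e.target)
    (hz' : e.symm z ∈ e'.source) : ContDiffAt ℝ ∞ (fun w => e' (e.symm w)) z := by
  have h1 : ContMDiffAt (𝓡 n) (𝓡 n) ∞ e.symm z :=
    (contMDiffOn_symm_of_mem_maximalAtlas he).contMDiffAt (e.open_target.mem_nhds hz)
  have h2 : ContMDiffAt (𝓡 n) (𝓡 n) ∞ e' (e.symm z) :=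
    (contMDiffOn_of_mem_maximalAtlas he').contMDiffAt (e'.open_source.mem_nhds hz')
  exact (h2.comp z h1).contDiffAt

/-- The two expressions of a base point in overlapping charts are equal only propositionally. Taking
the vectors in the model space, to which every tangent space unfolds, lets the equality be
substituted. -/
theorem inner_congr (x x' : M) (h : x = x') (v w : EuclideanSpace ℝ (Fin n)) :
    g.inner x v w = g.inner x' v w := by subst h; rfl

omit [ChartedSpace (EuclideanSpace ℝ (Fin n)) M] [IsManifold (𝓡 n) ∞ M] in
theorem isOpen_transition (e e' : OpenPartialHomeomorph M (EuclideanSpace ℝ (Fin n))) :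
    IsOpen {w ∈ e.target | e.symm w ∈ e'.source} :=
  e.isOpen_inter_preimage_symm e'.open_source

omit [IsManifold (𝓡 n) ∞ M] in
theorem mfderiv_symm_eq (he : e ∈ IsManifold.maximalAtlas (𝓡 n) ∞ M)
    (he' : e' ∈ IsManifold.maximalAtlas (𝓡 n) ∞ M) (hz : z ∈ e.target)
    (hz' : e.symm z ∈ e'.source) (v : EuclideanSpace ℝ (Fin n)) :
    (mfderiv (𝓡 n) (𝓡 n) e.symm z v : EuclideanSpace ℝ (Fin n)) =
      (mfderiv (𝓡 n) (𝓡 n) e'.symm (e' (e.symm z)) (fderiv ℝ (fun w => e' (e.symm w)) z v)) := by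
  have hev : e.symm =ᶠ[𝓝 z] e'.symm ∘ (fun w => e' (e.symm w)) :=
    eventually_of_mem ((isOpen_transition e e').mem_nhds ⟨hz, hz'⟩)
      fun w hw => (e'.left_inv hw.2).symm
  have h1 : MDifferentiableAt (𝓡 n) (𝓡 n) (fun w => e' (e.symm w)) z :=
    ((contDiffAt_transition he he' hz hz').differentiableAt (by simp)).mdifferentiableAt
  have h2 : MDifferentiableAt (𝓡 n) (𝓡 n) e'.symm (e' (e.symm z)) :=
    have h : ContMDiffAt (𝓡 n) (𝓡 n) ∞ e'.symm (e' (e.symm z)) :=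
      (contMDiffOn_symm_of_mem_maximalAtlas he').contMDiffAt
        (e'.open_target.mem_nhds (e'.map_source hz'))
    h.mdifferentiableAt (by simp)
  have h3 := congrArg (fun L : EuclideanSpace ℝ (Fin n) →L[ℝ] EuclideanSpace ℝ (Fin n) => L v)
    (hev.mfderiv_eq (I := 𝓡 n) (I' := 𝓡 n))
  refine h3.trans ?_
  have h4 := mfderiv_comp_apply z h2 h1 v
  rw [mfderiv_eq_fderiv] at h4
  exact h4

theorem fderiv_single_eq_sum {ψ : EuclideanSpace ℝ (Fin n) → EuclideanSpace ℝ (Fin n)}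
    (hψ : DifferentiableAt ℝ ψ z) (i : Fin n) :
    fderiv ℝ ψ z (EuclideanSpace.single i 1) =
      ∑ a, jac ψ a i z • EuclideanSpace.single a (1 : ℝ) := by
  have h1 : ∀ a, jac ψ a i z = (fderiv ℝ ψ z (EuclideanSpace.single i 1)) a := by
    intro a
    have := ((EuclideanSpace.proj (𝕜 := ℝ) a).hasFDerivAt.comp z hψ.hasFDerivAt).fderiv
    simp only [jac, partialDeriv]
    rw [show (fun z => ψ z a) = (EuclideanSpace.proj (𝕜 := ℝ) a) ∘ ψ from rfl, this]
    simp
  ext k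
  simp [h1, Finset.sum_apply, Pi.single_apply]

theorem metricCoeff_transition (he : e ∈ IsManifold.maximalAtlas (𝓡 n) ∞ M)
    (he' : e' ∈ IsManifold.maximalAtlas (𝓡 n) ∞ M) (hz : z ∈ e.target)
    (hz' : e.symm z ∈ e'.source) (i j : Fin n) :
    metricCoeff g e z i j = ∑ a, ∑ b, jac (fun w => e' (e.symm w)) a i z *
      jac (fun w => e' (e.symm w)) b j z * metricCoeff g e' (e' (e.symm z)) a b := by
  have hψ := (contDiffAt_transition he he' hz hz').differentiableAt (by simp)
  have h1 : metricCoeff g e z i j = g.inner (e.symm z)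
      (mfderiv (𝓡 n) (𝓡 n) e.symm z (EuclideanSpace.single i (1 : ℝ)))
      (mfderiv (𝓡 n) (𝓡 n) e.symm z (EuclideanSpace.single j (1 : ℝ))) := rfl
  set L : EuclideanSpace ℝ (Fin n) →L[ℝ] EuclideanSpace ℝ (Fin n) :=
    mfderiv (𝓡 n) (𝓡 n) e'.symm (e' (e.symm z)) with hL
  set B : EuclideanSpace ℝ (Fin n) →L[ℝ] EuclideanSpace ℝ (Fin n) →L[ℝ] ℝ :=
    g.inner (e'.symm (e' (e.symm z))) with hB
  have h2 : metricCoeff g e z i j =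
      B (L (fderiv ℝ (fun w => e' (e.symm w)) z (EuclideanSpace.single i (1 : ℝ))))
        (L (fderiv ℝ (fun w => e' (e.symm w)) z (EuclideanSpace.single j (1 : ℝ)))) := by
    rw [h1]
    exact (inner_congr _ _ (e'.left_inv hz').symm _ _).trans (congrArg₂ (fun v w => B v w)
      (mfderiv_symm_eq he he' hz hz' _) (mfderiv_symm_eq he he' hz hz' _))
  have h3 : ∀ a b, metricCoeff g e' (e' (e.symm z)) a b =
      B (L (EuclideanSpace.single a (1 : ℝ))) (L (EuclideanSpace.single b (1 : ℝ))) :=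
    fun a b => rfl
  rw [h2, fderiv_single_eq_sum hψ, fderiv_single_eq_sum hψ]
  simp only [map_sum, map_smul, _root_.sum_apply, smul_apply,
    smul_eq_mul, h3, mul_sum]
  rw [sum_comm]
  exact sum_congr rfl fun _ _ => sum_congr rfl fun _ _ => by ring

omit [IsManifold (𝓡 n) ∞ M] in
-- The Jacobian matrix of the reverse transition is a left inverse, by the chain rule.
theorem isUnit_det_transition (he : e ∈ IsManifold.maximalAtlas (𝓡 n) ∞ M)
    (he' : e' ∈ IsManifold.maximalAtlas (𝓡 n) ∞ M) (hz : z ∈ e.target)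
    (hz' : e.symm z ∈ e'.source) :
    IsUnit (Matrix.of fun a i => jac (fun w => e' (e.symm w)) a i z).det := by
  have hy : e' (e.symm z) ∈ e'.target := e'.map_source hz'
  have hy' : e'.symm (e' (e.symm z)) ∈ e.source := by
    rw [e'.left_inv hz']; exact e.map_target hz
  have h1 := (contDiffAt_transition he he' hz hz').differentiableAt (by simp)
  have h2 := contDiffAt_transition he' he hy hy'
  have key : (Matrix.of fun a i => jac (fun w => e (e'.symm w)) a i (e' (e.symm z))) *
      (Matrix.of fun a i => jac (fun w => e' (e.symm w)) a i z) = 1 := by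
    ext a i
    have hco : ContDiffAt ℝ ∞ (fun w => e (e'.symm w) a) (e' (e.symm z)) :=
      contDiffAt_euclidean.1 h2 a
    have h3 := partialDeriv_comp (i := i) (u := fun w => e (e'.symm w) a)
      (hco.differentiableAt (by simp)) h1
    have h4 : 𝔡 i (fun w => e (e'.symm (e' (e.symm w))) a) z = kron a i := by
      rw [partialDeriv_congr (v := fun w => w a)]
      · exact jac_id a i z
      · filter_upwards [(isOpen_transition e e').mem_nhds ⟨hz, hz'⟩] with w hw
        rw [e'.left_inv hw.2, e.right_inv hw.1]
    rw [h4] at h3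
    rw [Matrix.mul_apply, Matrix.one_apply]
    exact h3.symm
  exact (IsUnit.of_mul_eq_one _ (by rw [mul_comm, ← Matrix.det_mul, key, Matrix.det_one]))

theorem IsFlatChart.isConformalPullback (h : IsFlatChart g e' φ)
    (he : e ∈ IsManifold.maximalAtlas (𝓡 n) ∞ M) :
    IsConformalPullback φ (fun w => e' (e.symm w)) (metricCoeff g e)
      {w ∈ e.target | e.symm w ∈ e'.source} where
  isOpen := isOpen_transition e e'
  smooth_map z hz := contDiffAt_transition he h.mem_atlas hz.1 hz.2
  smooth_factor z hz := h.smooth.contDiffAt (e'.open_target.mem_nhds (e'.map_source hz.2))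
  metric_eq z hz i j := by
    rw [metricCoeff_transition he h.mem_atlas hz.1 hz.2, h.metric_eq _ (e'.map_source hz.2)]
    simp [Matrix.one_apply, mul_sum, mul_comm]
  isUnit_det z hz := isUnit_det_transition he h.mem_atlas hz.1 hz.2

theorem IsFlatChart.isConformalPullback_id (h : IsFlatChart g e φ) :
    IsConformalPullback φ (fun w => w) (metricCoeff g e) e.target :=
  RicciSoliton.isConformalPullback_id e.open_target h.smooth h.metric_eq

variable {f : M → ℝ} {ρ : ℝ}

omit [IsManifold (𝓡 n) ∞ M] in
theorem contDiffAt_comp_symm (hf : ContMDiff (𝓡 n) 𝓘(ℝ, ℝ) ∞ f)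
    (he : e ∈ IsManifold.maximalAtlas (𝓡 n) ∞ M) (hz : z ∈ e.target) :
    ContDiffAt ℝ ∞ (f ∘ e.symm) z := by
  have h1 : ContMDiffAt (𝓡 n) (𝓡 n) ∞ e.symm z :=
    (contMDiffOn_symm_of_mem_maximalAtlas he).contMDiffAt (e.open_target.mem_nhds hz)
  exact (hf.contMDiffAt.comp z h1).contDiffAt

theorem IsFlatChart.isFlatSoliton (h : IsFlatChart g e φ)
    (hf : ContMDiff (𝓡 n) 𝓘(ℝ, ℝ) ∞ f)
    (hsol : ∀ e ∈ IsManifold.maximalAtlas (𝓡 n) ∞ M, ∀ y ∈ e.target, ∀ i j : Fin n,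
      ricci (metricCoeff g e) i j y + hessian (metricCoeff g e) (f ∘ e.symm) i j y
        = ρ * metricCoeff g e y i j) : IsFlatSoliton φ (f ∘ e.symm) ρ e.target where
  isOpen := e.open_target
  smooth_factor z hz := h.smooth.contDiffAt (e.open_target.mem_nhds hz)
  smooth_potential z hz := contDiffAt_comp_symm hf h.mem_atlas hz
  equation z hz i j := by
    rw [← ricci_eq_flatRicci h.isConformalPullback_id hz, ← hessian_eq_flatHessian
      h.isConformalPullback_id hz (fun w hw => contDiffAt_comp_symm hf h.mem_atlas hw),
      hsol e h.mem_atlas z hz, h.metric_eq z hz]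
    simp [kron, Matrix.one_apply]

end Transition

/-! ### The maximum principle on a closed soliton -/

/-- The hypothesis makes A a multiple of an orthogonal matrix, so AAᵀ is scalar too, with factor
E/E'. Cyclicity of the trace does the rest. -/
theorem trace_conformal {n : ℕ} {A r r' : Matrix (Fin n) (Fin n) ℝ} {E E' : ℝ} (hE : E ≠ 0)
    (hE' : E' ≠ 0) (hA : E • (1 : Matrix (Fin n) (Fin n) ℝ) = E' • (A.transpose * A))
    (hr : r = A.transpose * r' * A) :
    E⁻¹ * r.trace = E'⁻¹ * r'.trace ∧
    E⁻¹ ^ 2 * (r * r.transpose).trace = E'⁻¹ ^ 2 * (r' * r'.transpose).trace := by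
  have h1 : ((E⁻¹ * E') • A.transpose) * A = 1 := by
    rw [Matrix.smul_mul, mul_smul, ← hA, smul_smul, inv_mul_cancel₀ hE, one_smul]
  have h2 : A * ((E⁻¹ * E') • A.transpose) = 1 := mul_eq_one_comm.1 h1
  have h3 : A * A.transpose = (E * E'⁻¹) • (1 : Matrix (Fin n) (Fin n) ℝ) := by
    rw [← h2, Matrix.mul_smul, smul_smul]
    rw [show E * E'⁻¹ * (E⁻¹ * E') = 1 by field_simp, one_smul]
  constructor
  · rw [hr, Matrix.mul_assoc, Matrix.trace_mul_comm, Matrix.mul_assoc, h3, Matrix.mul_smul,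
      Matrix.mul_one, Matrix.trace_smul, smul_eq_mul]
    field_simp
  · have : (r * r.transpose).trace = (E * E'⁻¹) ^ 2 * (r' * r'.transpose).trace := by
      have e : r * r.transpose = A.transpose * ((E * E'⁻¹) • (r' * r'.transpose)) * A := by
        rw [hr]
        simp only [Matrix.transpose_mul, Matrix.transpose_transpose]
        calc A.transpose * r' * A * (A.transpose * (r'.transpose * A))
            = A.transpose * r' * (A * A.transpose) * r'.transpose * A := by
              simp only [Matrix.mul_assoc]
          _ = _ := by rw [h3]; simp [Matrix.mul_assoc]
      rw [e, Matrix.mul_assoc, Matrix.trace_mul_comm, Matrix.mul_assoc, h3, Matrix.mul_smul,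
        Matrix.mul_one, Matrix.trace_smul, Matrix.trace_smul, smul_eq_mul, smul_eq_mul]
      ring
    rw [this]
    field_simp

theorem hessian_congr {n : ℕ} {G : EuclideanSpace ℝ (Fin n) → Matrix (Fin n) (Fin n) ℝ}
    {u v : EuclideanSpace ℝ (Fin n) → ℝ} {z : EuclideanSpace ℝ (Fin n)} (h : u =ᶠ[𝓝 z] v)
    (i j : Fin n) : hessian G u i j z = hessian G v i j z := by
  simp only [hessian, partialDeriv_congr h, partialDeriv_congr (partialDeriv_eventuallyEq h)]

section Global

variable {n : ℕ} {M : Type*} [TopologicalSpace M] [ChartedSpace (EuclideanSpace ℝ (Fin n)) M]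
  [IsManifold (𝓡 n) ∞ M]
  {g : ContMDiffRiemannianMetric (𝓡 n) ∞ (EuclideanSpace ℝ (Fin n))
      (fun x : M => TangentSpace (𝓡 n) x)}
  {e e' : OpenPartialHomeomorph M (EuclideanSpace ℝ (Fin n))}
  {φ φ' : EuclideanSpace ℝ (Fin n) → ℝ} {f : M → ℝ} {ρ : ℝ} {x : M}

/-- `f` is a potential of a gradient Ricci soliton structure on `(M, g)` with constant `ρ`. -/
structure IsSolitonPotential (g : ContMDiffRiemannianMetric (𝓡 n) ∞ (EuclideanSpace ℝ (Fin n))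
      (fun x : M => TangentSpace (𝓡 n) x)) (f : M → ℝ) (ρ : ℝ) : Prop where
  smooth : ContMDiff (𝓡 n) 𝓘(ℝ, ℝ) ∞ f
  equation : ∀ e ∈ IsManifold.maximalAtlas (𝓡 n) ∞ M, ∀ y ∈ e.target, ∀ i j : Fin n,
      ricci (metricCoeff g e) i j y + hessian (metricCoeff g e) (f ∘ e.symm) i j y
        = ρ * metricCoeff g e y i j

namespace IsSolitonPotential

variable (hs : IsSolitonPotential g f ρ)
include hs

theorem isFlatSoliton (h : IsFlatChart g e φ) : IsFlatSoliton φ (f ∘ e.symm) ρ e.target :=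
  h.isFlatSoliton hs.smooth hs.equation

/-- The soliton equation expresses Ric through the metric and Hess f, both already known to
transform as tensors. This avoids transforming the curvature itself. -/
theorem flatRicci_transition (h : IsFlatChart g e φ) (h' : IsFlatChart g e' φ')
    (hx : x ∈ e.source) (hx' : x ∈ e'.source) (i j : Fin n) :
    flatRicci φ i j (e x) = ∑ a, jac (fun w => e' (e.symm w)) a j (e x) *
      ∑ b, flatRicci φ' a b (e' x) * jac (fun w => e' (e.symm w)) b i (e x) := by
  have hz : e x ∈ e.target := e.map_source hx
  have hz' : e.symm (e x) ∈ e'.source := by rwa [e.left_inv hx]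
  have hψ : e' (e.symm (e x)) = e' x := by rw [e.left_inv hx]
  have hS : e x ∈ {w ∈ e.target | e.symm w ∈ e'.source} := ⟨hz, hz'⟩
  have hp := h'.isConformalPullback h.mem_atlas
  have hu : ∀ w ∈ {w ∈ e.target | e.symm w ∈ e'.source},
      ContDiffAt ℝ ∞ (f ∘ e'.symm) (e' (e.symm w)) := fun w hw =>
    contDiffAt_comp_symm hs.smooth h'.mem_atlas (e'.map_source hw.2)
  have h1 := hp.hessian_eq hS hu i j
  have h2 : hessian (metricCoeff g e) (fun w => (f ∘ e'.symm) (e' (e.symm w))) i j (e x) =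
      flatHessian φ (f ∘ e.symm) i j (e x) := by
    rw [← hessian_eq_flatHessian h.isConformalPullback_id hz
      (fun w hw => contDiffAt_comp_symm hs.smooth h.mem_atlas hw)]
    refine hessian_congr (eventually_of_mem ((isOpen_transition e e').mem_nhds hS) ?_) i j
    intro w hw
    simp [e'.left_inv hw.2]
  have e1 := (hs.isFlatSoliton h).equation _ hz i j
  have e2 := (hs.isFlatSoliton h').equation _ (e'.map_source hx')
  have e3 := hp.metric_eq _ hS i j
  have e4 := h.isConformalPullback_id.metric_eq _ hz i j
  simp only [jac_id, sum_kron_mul'] at e4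
  rw [e3, hψ] at e4
  rw [← h2, h1, hψ, ← e4] at e1
  have e5 : ∀ a b, flatRicci φ' a b (e' x) = ρ * Real.exp (2 * φ' (e' x)) * kron a b
      - flatHessian φ' (f ∘ e'.symm) a b (e' x) := fun a b => by
    linear_combination e2 a b
  have e6 : ∀ a, ∑ b, flatRicci φ' a b (e' x) * jac (fun w => e' (e.symm w)) b i (e x) =
      ρ * Real.exp (2 * φ' (e' x)) * jac (fun w => e' (e.symm w)) a i (e x)
      - ∑ b, flatHessian φ' (f ∘ e'.symm) a b (e' x)
        * jac (fun w => e' (e.symm w)) b i (e x) := fun a => by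
    simp only [e5, sub_mul, sum_sub_distrib, mul_assoc, ← mul_sum, sum_kron_mul]
  simp only [e6, mul_sub, sum_sub_distrib]
  rw [eq_sub_iff_add_eq, e1, mul_sum, mul_sum]
  exact sum_congr rfl fun a _ => by ring

/-- Makes scalar curvature and |Ric|² well defined on M, so that maxima over the compact manifold
make sense. -/
theorem flat_invariants (h : IsFlatChart g e φ) (h' : IsFlatChart g e' φ')
    (hx : x ∈ e.source) (hx' : x ∈ e'.source) :
    flatScalar φ (e x) = flatScalar φ' (e' x) ∧
    flatRicciNormSq φ (e x) = flatRicciNormSq φ' (e' x) := by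
  have hz : e x ∈ e.target := e.map_source hx
  have hz' : e.symm (e x) ∈ e'.source := by rwa [e.left_inv hx]
  have hψ : e' (e.symm (e x)) = e' x := by rw [e.left_inv hx]
  set A : Matrix (Fin n) (Fin n) ℝ :=
    Matrix.of fun a i => jac (fun w => e' (e.symm w)) a i (e x) with hA
  have h1 : Real.exp (2 * φ (e x)) • (1 : Matrix (Fin n) (Fin n) ℝ) =
      Real.exp (2 * φ' (e' x)) • (A.transpose * A) := by
    rw [← h.metric_eq _ hz, (h'.isConformalPullback h.mem_atlas).metric_eq_smul ⟨hz, hz'⟩, hψ]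
  have h2 : Matrix.of (fun i j => flatRicci φ i j (e x)) =
      A.transpose * Matrix.of (fun i j => flatRicci φ' i j (e' x)) * A := by
    ext i j
    rw [Matrix.of_apply, flatRicci_comm ((hs.isFlatSoliton h).smooth_factor _ hz),
      hs.flatRicci_transition h h' hx hx', Matrix.mul_assoc, Matrix.mul_apply]
    simp only [Matrix.mul_apply, hA, Matrix.transpose_apply, Matrix.of_apply]
  obtain ⟨t1, t2⟩ := trace_conformal (Real.exp_pos _).ne' (Real.exp_pos _).ne' h1 h2
  simp only [Matrix.trace, Matrix.diag, Matrix.mul_apply, Matrix.transpose_apply, Matrix.of_apply,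
    ← sq, ← Real.exp_neg] at t1 t2
  exact ⟨t1, t2⟩

theorem pinching_invariant (h : IsFlatChart g e φ) (h' : IsFlatChart g e' φ')
    (hx : x ∈ e.source) (hx' : x ∈ e'.source) : pinching φ (e x) = pinching φ' (e' x) := by
  obtain ⟨h1, h2⟩ := hs.flat_invariants h h' hx hx'
  rw [pinching, pinching, h1, h2]

end IsSolitonPotential

omit [ChartedSpace (EuclideanSpace ℝ (Fin n)) M] [IsManifold (𝓡 n) ∞ M] in
theorem continuousAt_of_eqOn_chart {F : M → ℝ} {u : EuclideanSpace ℝ (Fin n) → ℝ}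
    (hx : x ∈ e.source) (hF : ∀ y ∈ e.source, F y = u (e y)) (hu : ContinuousAt u (e x)) :
    ContinuousAt F x :=
  (ContinuousAt.comp (f := e) hu (e.continuousAt hx)).congr
    (eventually_of_mem (e.open_source.mem_nhds hx) fun y hy => (hF y hy).symm)

omit [ChartedSpace (EuclideanSpace ℝ (Fin n)) M] [IsManifold (𝓡 n) ∞ M] in
theorem isLocalMax_of_eqOn_chart {F : M → ℝ} {u : EuclideanSpace ℝ (Fin n) → ℝ}
    (hx : x ∈ e.source) (hF : ∀ y ∈ e.source, F y = u (e y)) (hmax : ∀ y, F y ≤ F x) :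
    IsLocalMax u (e x) := by
  filter_upwards [e.open_target.mem_nhds (e.map_source hx)] with w hw
  have := hmax (e.symm w)
  rwa [hF _ (e.map_target hw), hF _ hx, e.right_inv hw] at this

variable [CompactSpace M] (hn : 3 ≤ n) (hρ : 0 < ρ) (hs : IsSolitonPotential g f ρ)
  {R Y : M → ℝ} (hcov : ∀ x : M, ∃ e φ, IsFlatChart g e φ ∧ x ∈ e.source)
  (hR : ∀ e φ, IsFlatChart g e φ → ∀ x ∈ e.source, R x = flatScalar φ (e x))
  (hY : ∀ e φ, IsFlatChart g e φ → ∀ x ∈ e.source, Y x = pinching φ (e x))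

include hn hρ hs hcov hR

/-- The scalar curvature of a closed locally conformally flat shrinking soliton is positive. -/
theorem scalar_pos (x : M) : 0 < R x := by
  have hn' : (3 : ℝ) ≤ n := by exact_mod_cast hn
  have hRc : Continuous R := continuous_iff_continuousAt.2 fun x => by
    obtain ⟨e, φ, h, hx⟩ := hcov x
    exact continuousAt_of_eqOn_chart hx (hR e φ h)
      ((hs.isFlatSoliton h).contDiffAt_flatScalar (e.map_source hx)).continuousAt
  have hfc : Continuous f := hs.smooth.continuous
  have : Nonempty M := ⟨x⟩
  obtain ⟨x₁, -, hx₁⟩ := isCompact_univ.exists_isMaxOn Set.univ_nonempty hfc.rexp.continuousOn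
  set C := Real.exp (f x₁) with hC
  have hCpos : 0 < C := Real.exp_pos _
  have hC1 : ∀ y, Real.exp (f y) ≤ C := fun y => hx₁ (Set.mem_univ y)
  -- Chosen so that ε e^f ≤ ρ/2, which is below (n - 2)ρ; a minimum point with R > (n - 2)ρ is then
  -- harmless.
  set ε := ρ / (2 * C) with hε
  have hεpos : 0 < ε := by positivity
  have hεC : ε * C = ρ / 2 := by rw [hε]; field_simp
  obtain ⟨p, -, hp⟩ := isCompact_univ.exists_isMinOn Set.univ_nonempty
    (hRc.sub (continuous_const.mul hfc.rexp)).continuousOn (f := fun y => R y - ε * Real.exp (f y))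
  have hp' : ∀ y, R p - ε * Real.exp (f p) ≤ R y - ε * Real.exp (f y) :=
    fun y => hp (Set.mem_univ y)
  have key : 0 ≤ R p - ε * Real.exp (f p) := by
    have hfp := Real.exp_pos (f p)
    -- When R ≤ (n - 2)ρ, the factor nρ - R is at least 2ρ, and the inequality at the minimum
    -- reduces to ε e^f ≤ R.
    by_cases hle : R p ≤ (n - 2) * ρ
    · obtain ⟨e, φ, h, hpe⟩ := hcov p
      have hmax : IsLocalMax (fun w => -(flatScalar φ w - ε * Real.exp ((f ∘ e.symm) w))) (e p) :=
        isLocalMax_of_eqOn_chart (F := fun y => -(R y - ε * Real.exp (f y))) hpe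
          (fun y hy => by simp [hR e φ h y hy, e.left_inv hy]) (fun y => neg_le_neg (hp' y))
      have hmin : IsLocalMin (fun w => flatScalar φ w - ε * Real.exp ((f ∘ e.symm) w)) (e p) := by
        simpa using hmax.neg
      have := (hs.isFlatSoliton h).ineq_of_isLocalMin (e.map_source hpe) hmin
      rw [← hR e φ h p hpe, Function.comp_apply, e.left_inv hpe] at this
      have h1 : ε * (Real.exp (f p) * (2 * ρ)) ≤ ε * (Real.exp (f p) * (n * ρ - R p)) := by
        gcongr; linarith
      have h2 : (2 * ρ) * (ε * Real.exp (f p)) ≤ (2 * ρ) * R p := by linarith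
      have := le_of_mul_le_mul_left h2 (by positivity)
      linarith
    · push Not at hle
      have h1 : ε * Real.exp (f p) ≤ ε * C := by gcongr; exact hC1 p
      nlinarith
  have := hp' x
  have h1 : 0 < ε * Real.exp (f x) := mul_pos hεpos (Real.exp_pos _)
  linarith

include hY

/-- The pinching function of a closed locally conformally flat shrinking soliton vanishes. -/
theorem pinching_eq_zero (x : M) : Y x = 0 := by
  have hn' : (3 : ℝ) ≤ n := by exact_mod_cast hn
  have hRpos := scalar_pos hn hρ hs hcov hR
  have hRpos' : ∀ e φ, IsFlatChart g e φ → ∀ w ∈ e.target, 0 < flatScalar φ w := by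
    intro e φ h w hw
    have := hRpos (e.symm w)
    rwa [hR e φ h _ (e.map_target hw), e.right_inv hw] at this
  have hYc : Continuous Y := continuous_iff_continuousAt.2 fun x => by
    obtain ⟨e, φ, h, hx⟩ := hcov x
    exact continuousAt_of_eqOn_chart hx (hY e φ h)
      ((hs.isFlatSoliton h).contDiffAt_pinching hn (e.map_source hx)
        (hRpos' e φ h _ (e.map_source hx))).continuousAt
  have hY0 : ∀ x, 0 ≤ Y x := fun x => by
    obtain ⟨e, φ, h, hx⟩ := hcov x
    rw [hY e φ h x hx]; exact IsFlatSoliton.pinching_nonneg hn _ _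
  set B : M → ℝ := fun y => Real.exp (f y - (n - 1) / 2 * Real.log (R y)) with hB
  have hBchart : ∀ e φ, IsFlatChart g e φ → ∀ y ∈ e.source,
      B y = barrier φ (f ∘ e.symm) (e y) := fun e φ h y hy => by
    simp [hB, barrier, hR e φ h y hy, e.left_inv hy]
  have hBc : Continuous B := continuous_iff_continuousAt.2 fun x => by
    obtain ⟨e, φ, h, hx⟩ := hcov x
    exact continuousAt_of_eqOn_chart hx (hBchart e φ h)
      ((hs.isFlatSoliton h).contDiffAt_barrier (e.map_source hx)
        (hRpos' e φ h _ (e.map_source hx))).continuousAt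
  have hBpos : ∀ y, 0 < B y := fun y => Real.exp_pos _
  have : Nonempty M := ⟨x⟩
  obtain ⟨p, -, hp⟩ := isCompact_univ.exists_isMaxOn Set.univ_nonempty hYc.continuousOn
  have hp' : ∀ y, Y y ≤ Y p := fun y => hp (Set.mem_univ y)
  by_contra hne
  have hYp : 0 < Y p := (lt_of_le_of_ne (hY0 x) (Ne.symm hne)).trans_le (hp' x)
  -- The chart is part of membership in V: the operator is only evaluated in one chart at a time, so
  -- its independence of the chart is not needed.
  set V : Set M := {y | ∃ e φ, IsFlatChart g e φ ∧ y ∈ e.source ∧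
    0 < driftLaplacian φ (f ∘ e.symm) (barrier φ (f ∘ e.symm)) (e y)} with hV
  have hVopen : IsOpen V := by
    rw [isOpen_iff_mem_nhds]
    rintro y ⟨e, φ, h, hy, hpos⟩
    have hS := hs.isFlatSoliton h
    have hyt := e.map_source hy
    have hc : ContinuousAt (fun y => driftLaplacian φ (f ∘ e.symm) (barrier φ (f ∘ e.symm)) (e y)) y :=
      ContinuousAt.comp (f := e) (hS.continuousAt_driftLaplacian hyt (hRpos' e φ h _ hyt)
        (hS.contDiffAt_barrier hyt (hRpos' e φ h _ hyt))) (e.continuousAt hy)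
    filter_upwards [e.open_source.mem_nhds hy, hc.eventually (lt_mem_nhds hpos)] with y' h1 h2
    exact ⟨e, φ, h, h1, h2⟩
  have hVmax : ∀ y, Y y = Y p → y ∈ V := by
    intro y hyp
    obtain ⟨e, φ, h, hy⟩ := hcov y
    have hS := hs.isFlatSoliton h
    have hyt := e.map_source hy
    have hmax : IsLocalMax (pinching φ) (e y) :=
      isLocalMax_of_eqOn_chart hy (hY e φ h) fun y' => by rw [hyp]; exact hp' y'
    have hpos : 0 < pinching φ (e y) := by rw [← hY e φ h y hy, hyp]; exact hYp
    obtain ⟨h1, h2⟩ := hS.pinching_of_isLocalMax hn hyt (hRpos' e φ h) hmax hpos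
    exact ⟨e, φ, h, hy, hS.driftLaplacian_barrier_pos hn hρ hyt (hRpos' e φ h) h1 h2⟩
  obtain ⟨x₁, -, hx₁⟩ := isCompact_univ.exists_isMaxOn Set.univ_nonempty hBc.continuousOn
  have hx₁' : ∀ y, B y ≤ B x₁ := fun y => hx₁ (Set.mem_univ y)
  -- V is open and contains every maximum point of Y, so on its compact complement Y stays below its
  -- maximum by a definite amount.
  have hgap : ∃ δ > 0, ∀ y, y ∉ V → Y y ≤ Y p - δ := by
    by_cases hemp : (Vᶜ).Nonempty
    · obtain ⟨q, hq, hqmax⟩ := hVopen.isClosed_compl.isCompact.exists_isMaxOn hemp hYc.continuousOn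
      refine ⟨Y p - Y q, ?_, fun y hy => ?_⟩
      · refine sub_pos.2 (lt_of_le_of_ne (hp' q) fun heq => hq (hVmax q heq))
      · have : Y y ≤ Y q := hqmax hy
        linarith
    · exact ⟨1, one_pos, fun y hy => absurd ⟨y, hy⟩ hemp⟩
  obtain ⟨δ, hδ, hgap⟩ := hgap
  -- The perturbation εB is at most δ/2, less than the gap, so the maximum of Y + εB must lie in V.
  set ε := δ / (2 * B x₁) with hε
  have hεpos : 0 < ε := div_pos hδ (mul_pos two_pos (hBpos x₁))
  have hεB : ε * B x₁ = δ / 2 := by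
    have := (hBpos x₁).ne'
    rw [hε]; field_simp
  obtain ⟨q, -, hq⟩ := isCompact_univ.exists_isMaxOn Set.univ_nonempty
    (hYc.add (continuous_const.mul hBc)).continuousOn (f := fun y => Y y + ε * B y)
  have hq' : ∀ y, Y y + ε * B y ≤ Y q + ε * B q := fun y => hq (Set.mem_univ y)
  have hqV : q ∈ V := by
    by_contra hqV
    have h1 := hgap q hqV
    have h2 := hq' p
    have h3 : 0 < ε * B p := mul_pos hεpos (hBpos p)
    have h4 : ε * B q ≤ ε * B x₁ := mul_le_mul_of_nonneg_left (hx₁' q) hεpos.le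
    linarith
  obtain ⟨e, φ, h, hqe, hpos⟩ := hqV
  have hS := hs.isFlatSoliton h
  have hqt := e.map_source hqe
  have c1 : ∀ w ∈ e.target, ContDiffAt ℝ ∞ (pinching φ) w := fun w hw =>
    hS.contDiffAt_pinching hn hw (hRpos' e φ h w hw)
  have c2 : ∀ w ∈ e.target, ContDiffAt ℝ ∞ (barrier φ (f ∘ e.symm)) w := fun w hw =>
    hS.contDiffAt_barrier hw (hRpos' e φ h w hw)
  have hmax : IsLocalMax (fun w => pinching φ w + ε * barrier φ (f ∘ e.symm) w) (e q) :=
    isLocalMax_of_eqOn_chart (F := fun y => Y y + ε * B y) hqe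
      (fun y hy => by simp only [hY e φ h y hy, hBchart e φ h y hy]) hq'
  have h1 := driftLaplacian_nonpos_of_isLocalMax (φ := φ) (f := f ∘ e.symm)
    ((c1 _ hqt).add (contDiffAt_const.mul (c2 _ hqt))) hmax
  rw [driftLaplacian_add_const_mul e.open_target hqt c1 c2] at h1
  have h2 := hS.le_driftLaplacian_pinching hn hqt (hRpos' e φ h)
  have h3 : 0 ≤ 4 * flatScalar φ (e q) / (n * (n - 1)) *
      (pinching φ (e q) * (1 - (n - 1) * √(pinching φ (e q))) ^ 2) := by
    have hm : 0 < (n : ℝ) - 1 := by linarith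
    have := hRpos' e φ h _ hqt
    have := IsFlatSoliton.pinching_nonneg hn φ (e q)
    positivity
  -- At q both LY ≥ 0 and LB > 0 hold, contradicting L(Y + εB) ≤ 0 at a maximum.
  nlinarith [mul_pos hεpos hpos]

/-- The potential of a closed locally conformally flat shrinking soliton is locally constant. -/
theorem partialDeriv_potential_eq_zero (he : e ∈ IsManifold.maximalAtlas (𝓡 n) ∞ M)
    {y : EuclideanSpace ℝ (Fin n)} (hy : y ∈ e.target) (i : Fin n) : 𝔡 i (f ∘ e.symm) y = 0 := by
  obtain ⟨e', φ, h, hx⟩ := hcov (e.symm y)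
  have hS := hs.isFlatSoliton h
  have hYz := pinching_eq_zero hn hρ hs hcov hR hY
  have hRpos := scalar_pos hn hρ hs hcov hR
  have h0 : ∀ w ∈ e'.target, ∀ i, 𝔡 i (f ∘ e'.symm) w = 0 := fun w hw i =>
    hS.partialDeriv_potential_eq_zero hn hw
      (fun w hw => by
        have := hRpos (e'.symm w)
        rwa [hR e' φ h _ (e'.map_target hw), e'.right_inv hw] at this)
      (fun w hw => by
        have := hYz (e'.symm w)
        rwa [hY e' φ h _ (e'.map_target hw), e'.right_inv hw] at this) i
  have hp := h.isConformalPullback he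
  have hyS : y ∈ {w ∈ e.target | e.symm w ∈ e'.source} := ⟨hy, hx⟩
  -- The chain rule carries the vanishing gradient from a conformally flat chart to an arbitrary
  -- one.
  have h1 := hp.partialDeriv_comp_map hyS
    (contDiffAt_comp_symm hs.smooth h.mem_atlas (e'.map_source hx)) i
  rw [partialDeriv_congr_on (v := fun w => (f ∘ e'.symm) (e' (e.symm w))) hp.isOpen
    (fun w hw => by simp [e'.left_inv hw.2]) hyS, h1]
  exact sum_eq_zero fun a _ => by rw [h0 _ (e'.map_source hx), zero_mul]

end Global

/-! ### Rigidity -/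

section SectionalCurvature

variable {n : ℕ} {G : EuclideanSpace ℝ (Fin n) → Matrix (Fin n) (Fin n) ℝ}
  {y : EuclideanSpace ℝ (Fin n)}

theorem pairing_comm (hsymm : ∀ i j, G y i j = G y j i) (v w : EuclideanSpace ℝ (Fin n)) :
    pairing G y v w = pairing G y w v := by
  rw [pairing, pairing, sum_comm]
  exact sum_congr rfl fun i _ => sum_congr rfl fun j _ => by rw [hsymm j i]; ring

theorem pairing_smul_add_smul (hsymm : ∀ i j, G y i j = G y j i) (a b : ℝ)
    (v w : EuclideanSpace ℝ (Fin n)) :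
    pairing G y (a • v + b • w) (a • v + b • w) =
      a ^ 2 * pairing G y v v + 2 * a * b * pairing G y v w + b ^ 2 * pairing G y w w := by
  have h : pairing G y (a • v + b • w) (a • v + b • w) =
      a ^ 2 * pairing G y v v + a * b * pairing G y v w + a * b * pairing G y w v
        + b ^ 2 * pairing G y w w := by
    simp only [pairing, mul_sum, ← sum_add_distrib]
    refine sum_congr rfl fun i _ => sum_congr rfl fun j _ => ?_
    simp only [PiLp.add_apply, PiLp.smul_apply, smul_eq_mul]
    ring
  rw [h, pairing_comm hsymm w v]
  ring

theorem pairing_mul_sub_sq_ne_zero (hsymm : ∀ i j, G y i j = G y j i)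
    (hdef : ∀ v, pairing G y v v = 0 → v = 0) {v w : EuclideanSpace ℝ (Fin n)}
    (hvw : LinearIndependent ℝ ![v, w]) :
    pairing G y v v * pairing G y w w - pairing G y v w ^ 2 ≠ 0 := by
  intro h0
  -- The vector g(w,w)v - g(v,w)w has square norm g(w,w) times the Gram determinant. If that is 0,
  -- independence gives g(w,w) = 0, hence w = 0.
  have h1 := hdef (pairing G y w w • v + (-pairing G y v w) • w) (by
    rw [pairing_smul_add_smul hsymm]
    linear_combination pairing G y w w * h0)
  rw [LinearIndependent.pair_iff] at hvw
  have hw := hdef w (hvw _ _ h1).1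
  have := (hvw 0 1 (by simp [hw])).2
  exact one_ne_zero this

/-- A metric whose curvature tensor is `κ (gᵢₖ gⱼₗ - gᵢₗ gⱼₖ)` has sectional curvature `κ`. -/
theorem sectionalCurvature_eq {κ : ℝ} (hsymm : ∀ i j, G y i j = G y j i)
    (hdef : ∀ v, pairing G y v v = 0 → v = 0)
    (hR : ∀ i j k l, riemann G i j k l y = κ * (G y i k * G y j l - G y i l * G y j k))
    {v w : EuclideanSpace ℝ (Fin n)} (hvw : LinearIndependent ℝ ![v, w]) :
    sectionalCurvature G y v w = κ := by
  rw [sectionalCurvature, div_eq_iff (pairing_mul_sub_sq_ne_zero hsymm hdef hvw)]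
  have h1 : ∑ i, ∑ j, ∑ k, ∑ l, G y i k * G y j l * v i * w j * v k * w l =
      pairing G y v v * pairing G y w w := by
    simp only [pairing, sum_mul_sum]
    refine sum_congr rfl fun i _ => sum_congr rfl fun j _ => sum_congr rfl fun k _ =>
      sum_congr rfl fun l _ => by ring
  have h2 : ∑ i, ∑ j, ∑ k, ∑ l, G y i l * G y j k * v i * w j * v k * w l =
      pairing G y v w * pairing G y w v := by
    simp only [pairing, sum_mul_sum]
    refine sum_congr rfl fun i _ => sum_congr rfl fun j _ => ?_
    rw [sum_comm]
    exact sum_congr rfl fun k _ => sum_congr rfl fun l _ => by ring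
  rw [pairing_comm hsymm w v] at h2
  rw [sq, ← h1, ← h2]
  simp only [← sum_sub_distrib, mul_sum]
  refine sum_congr rfl fun i _ => sum_congr rfl fun j _ => sum_congr rfl fun k _ =>
    sum_congr rfl fun l _ => ?_
  rw [hR]; ring

end SectionalCurvature

namespace IsConformalPullback

variable {n : ℕ} {φ : EuclideanSpace ℝ (Fin n) → ℝ}
  {ψ : EuclideanSpace ℝ (Fin n) → EuclideanSpace ℝ (Fin n)}
  {G : EuclideanSpace ℝ (Fin n) → Matrix (Fin n) (Fin n) ℝ} {S : Set (EuclideanSpace ℝ (Fin n))}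
  (h : IsConformalPullback φ ψ G S) {z : EuclideanSpace ℝ (Fin n)} (hz : z ∈ S)
include h hz

theorem metric_comm (i j : Fin n) : G z i j = G z j i := by
  rw [h.metric_eq z hz, h.metric_eq z hz]
  congr 1
  exact sum_congr rfl fun _ _ => mul_comm _ _

/-- g(v,v) is a positive factor times |Av|² for the invertible Jacobian A. -/
theorem eq_zero_of_pairing_self (v : EuclideanSpace ℝ (Fin n)) (hv : pairing G z v v = 0) :
    v = 0 := by
  set A : Matrix (Fin n) (Fin n) ℝ := Matrix.of fun a i => jac ψ a i z with hA
  have h1 : pairing G z v v = Real.exp (2 * φ (ψ z)) * ∑ a, (∑ i, jac ψ a i z * v i) ^ 2 := by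
    simp only [pairing, h.metric_eq z hz, sq, mul_sum, sum_mul]
    rw [sum_congr rfl fun i _ => sum_comm, sum_comm]
    exact sum_congr rfl fun a _ => sum_congr rfl fun i _ => sum_congr rfl fun j _ => by ring
  rw [h1, mul_eq_zero, or_iff_right (Real.exp_pos _).ne',
    sum_eq_zero_iff_of_nonneg fun _ _ => sq_nonneg _] at hv
  have h2 : A.mulVec v.ofLp = 0 := by
    ext a
    exact pow_eq_zero_iff two_ne_zero |>.1 (hv a (mem_univ a))
  have h3 := Matrix.eq_zero_of_mulVec_eq_zero (h.isUnit_det z hz).ne_zero h2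
  ext i
  exact congrFun h3 i

/-- The curvature tensor of the pullback of a conformally flat metric whose Ricci tensor is `ρ`
times the metric. -/
theorem riemann_eq_of_flatRicci_eq (hn : 3 ≤ n) {ρ : ℝ}
    (hric : ∀ a b, flatRicci φ a b (ψ z) = ρ * Real.exp (2 * φ (ψ z)) * kron a b)
    (i j k l : Fin n) :
    riemann G i j k l z = ρ / (n - 1) * (G z i k * G z j l - G z i l * G z j k) := by
  have hn' : (3 : ℝ) ≤ n := by exact_mod_cast hn
  have hm1 : (n : ℝ) - 1 ≠ 0 := by linarith
  have hm2 : (n : ℝ) - 2 ≠ 0 := by linarith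
  set E := Real.exp (2 * φ (ψ z)) with hE
  -- Tracing the Einstein condition determines the Schouten trace. Dividing by n - 2 then makes the
  -- Schouten tensor itself a multiple of δ, ready for `riemann_eq`.
  have htr : 2 * (n - 1) * schoutenTrace φ (ψ z) = n * (ρ * E) := by
    rw [← IsFlatSoliton.sum_flatRicci_self]
    simp [hric]
  have hJ : schoutenTrace φ (ψ z) = n * (ρ * E) / (2 * (n - 1)) := by
    rw [eq_div_iff (by positivity), ← htr]; ring
  have hsch : ∀ a b, schouten φ a b (ψ z) = ρ * E / (2 * (n - 1)) * kron a b := by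
    intro a b
    have := hric a b
    rw [flatRicci, hJ] at this
    have h2 : (n - 2) * schouten φ a b (ψ z) = (n - 2) * (ρ * E / (2 * (n - 1)) * kron a b) := by
      rw [eq_sub_of_add_eq this]; field_simp; ring
    exact mul_left_cancel₀ hm2 h2
  set γ : Fin n → Fin n → ℝ := fun p q => ∑ a, jac ψ a p z * jac ψ a q z with hγ
  have hγc : ∀ p q, γ p q = γ q p := fun p q => sum_congr rfl fun _ _ => mul_comm _ _
  have h1 : ∀ p q, ∑ a, jac ψ a p z * ∑ b, schouten φ a b (ψ z) * jac ψ b q z =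
      ρ * E / (2 * (n - 1)) * γ p q := fun p q => by
    simp only [hsch, mul_assoc _ (kron _ _), ← mul_sum, sum_kron_mul, hγ]
    rw [mul_sum]
    exact sum_congr rfl fun _ _ => by ring
  have hG : ∀ p q, G z p q = E * γ p q := h.metric_eq z hz
  rw [h.riemann_eq hz]
  simp only [h1, hG, ← hE]
  change E * (γ k i * _ - γ k j * _ + γ j l * _ - γ i l * _) = _
  rw [hγc k i, hγc k j, hγc l j, hγc l i]
  field_simp
  ring

end IsConformalPullback

/-! ### From constancy of the potential to constant curvature -/

section Rigidity

variable {n : ℕ} {M : Type*} [TopologicalSpace M] [ChartedSpace (EuclideanSpace ℝ (Fin n)) M]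
  [IsManifold (𝓡 n) ∞ M] [CompactSpace M]
  {g : ContMDiffRiemannianMetric (𝓡 n) ∞ (EuclideanSpace ℝ (Fin n))
      (fun x : M => TangentSpace (𝓡 n) x)} {f : M → ℝ} {ρ : ℝ}
  (hn : 3 ≤ n) (hρ : 0 < ρ) (hs : IsSolitonPotential g f ρ) (hlcf : IsLocallyConformallyFlat g)
include hn hρ hs hlcf

theorem partialDeriv_potential_of_locallyConformallyFlat
    {e : OpenPartialHomeomorph M (EuclideanSpace ℝ (Fin n))}
    (he : e ∈ IsManifold.maximalAtlas (𝓡 n) ∞ M) {y : EuclideanSpace ℝ (Fin n)}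
    (hy : y ∈ e.target) (i : Fin n) : 𝔡 i (f ∘ e.symm) y = 0 := by
  have hcov : ∀ x : M, ∃ e φ, IsFlatChart g e φ ∧ x ∈ e.source := fun x => by
    obtain ⟨e, he, hx, φ, hφ, hm⟩ := hlcf x
    exact ⟨e, φ, ⟨he, hφ, hm⟩, hx⟩
  -- One conformally flat chart is chosen at each point to define R and Y on M; chart invariance
  -- shows that every other flat chart gives the same values.
  choose c θ hc hmem using hcov
  exact partialDeriv_potential_eq_zero (R := fun x => flatScalar (θ x) (c x x))
    (Y := fun x => pinching (θ x) (c x x)) hn hρ hs (fun x => ⟨c x, θ x, hc x, hmem x⟩)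
    (fun e φ h x hx => (hs.flat_invariants (hc x) h (hmem x) hx).1)
    (fun e φ h x hx => hs.pinching_invariant (hc x) h (hmem x) hx) he hy i

theorem partialDeriv_partialDeriv_potential_of_locallyConformallyFlat
    {e : OpenPartialHomeomorph M (EuclideanSpace ℝ (Fin n))}
    (he : e ∈ IsManifold.maximalAtlas (𝓡 n) ∞ M) {y : EuclideanSpace ℝ (Fin n)}
    (hy : y ∈ e.target) (i j : Fin n) : 𝔡 i (𝔡 j (f ∘ e.symm)) y = 0 := by
  rw [partialDeriv_congr_on (v := fun _ => 0) e.open_target (fun w hw =>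
    partialDeriv_potential_of_locallyConformallyFlat hn hρ hs hlcf he hw j) hy, partialDeriv_const]

theorem ricci_eq_of_locallyConformallyFlat
    {e : OpenPartialHomeomorph M (EuclideanSpace ℝ (Fin n))}
    (he : e ∈ IsManifold.maximalAtlas (𝓡 n) ∞ M) {y : EuclideanSpace ℝ (Fin n)}
    (hy : y ∈ e.target) (i j : Fin n) :
    ricci (metricCoeff g e) i j y = ρ * metricCoeff g e y i j := by
  have := hs.equation e he y hy i j
  rw [hessian, partialDeriv_partialDeriv_potential_of_locallyConformallyFlat hn hρ hs hlcf he hy]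
    at this
  simpa [partialDeriv_potential_of_locallyConformallyFlat hn hρ hs hlcf he hy] using this

theorem sectionalCurvature_eq_of_locallyConformallyFlat
    {e : OpenPartialHomeomorph M (EuclideanSpace ℝ (Fin n))}
    (he : e ∈ IsManifold.maximalAtlas (𝓡 n) ∞ M) {y : EuclideanSpace ℝ (Fin n)}
    (hy : y ∈ e.target) {v w : EuclideanSpace ℝ (Fin n)} (hvw : LinearIndependent ℝ ![v, w]) :
    sectionalCurvature (metricCoeff g e) y v w = ρ / (n - 1) := by
  obtain ⟨e', he', hx, φ, hφ, hm⟩ := hlcf (e.symm y)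
  have h : IsFlatChart g e' φ := ⟨he', hφ, hm⟩
  have hp := h.isConformalPullback he
  have hyS : y ∈ {w ∈ e.target | e.symm w ∈ e'.source} := ⟨hy, hx⟩
  have hyt := e'.map_source hx
  refine sectionalCurvature_eq (hp.metric_comm hyS) (hp.eq_zero_of_pairing_self hyS)
    (hp.riemann_eq_of_flatRicci_eq hyS hn fun a b => ?_) hvw
  rw [← ricci_eq_flatRicci h.isConformalPullback_id hyt,
    ricci_eq_of_locallyConformallyFlat hn hρ hs hlcf he' hyt, h.metric_eq _ hyt]
  simp [kron, Matrix.one_apply]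

end Rigidity

end RicciSoliton

end

theorem theorem2 {n : ℕ} (hn : 3 ≤ n) {M : Type*} [TopologicalSpace M] [T2Space M]
    [CompactSpace M] [ChartedSpace (EuclideanSpace ℝ (Fin n)) M] [IsManifold (𝓡 n) ∞ M]
    (g : ContMDiffRiemannianMetric (𝓡 n) ∞ (EuclideanSpace ℝ (Fin n))
      (fun x : M => TangentSpace (𝓡 n) x))
    (hsol : RicciSoliton.IsGradientShrinkingSoliton g)
    (hlcf : RicciSoliton.IsLocallyConformallyFlat g) :
    RicciSoliton.IsEinstein g ∧ RicciSoliton.HasConstantSectionalCurvature g := by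
  obtain ⟨f, hf, ρ, hρ, heq⟩ := hsol
  have hs : RicciSoliton.IsSolitonPotential g f ρ := ⟨hf, heq⟩
  exact ⟨⟨ρ, fun _ he _ hy =>
      RicciSoliton.ricci_eq_of_locallyConformallyFlat hn hρ hs hlcf he hy⟩,
    ⟨ρ / (n - 1), fun _ he _ hy _ _ =>
      RicciSoliton.sectionalCurvature_eq_of_locallyConformallyFlat hn hρ hs hlcf he hy⟩⟩
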